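/- For a graph $G$ with vertex set $\{1,\dots,n\}$ and a set $S$ of at least two vertices, let $\sigma(S)$ be the number of edges of $G$ with both ends in $S$ divided by $\binom{|S|}{2}$, and let $$\operatorname{den}_m(G;\gamma)=\binom nm^{-1}\sum_{|S|=m}\exp\{\gamma m\,\sigma(S)\},\qquad P_m(Z)=\sum_{|S|=m}\exp\Big\{\sum_{\{i,j\}\subset S,\ i\ne j}z_{ij}\Big\}$$ for a complex symmetric $n\times n$ matrix $Z=(z_{ij})$, the sums being over $m$-subsets $S\subset\{1,\dots,n\}$. For $0<\gamma<1$ put $w_{ij}=e^{\gamma/(m-1)}-1$ if $\{i,j\}$ is an edge of $G$ and $w_{ij}=e^{-\gamma/(m-1)}-1$ if it is not ($i\neq j$), and $$h(z)=\binom nm^{-1}\sum_{|S|=m}\ \prod_{\{i,j\}\subset S,\ i\ne j}(1+z\,w_{ij}).$$ For $\rho>0$ let $R_\rho=\{z\in\mathbb C:\ -\rho\le\Re z\le 1+\rho,\ |\Im z|\le\rho\}$. Let $0<\gamma<1$. There are real numbers $\gamma<\delta<1$, $\eta>0$, $\omega>1$, $\rho>0$, $\beta>1$, $C>0$, a real polynomial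 $\phi$ and a program $\Pi$ for the real random access machine, all depending on $\gamma$ only, such that the following holds. (1) If $m\ge2$ and $n\ge\omega m$, then $P_m(Z)\ne0$ for every complex symmetric $n\times n$ matrix $Z$ with $|\Re z_{ij}|\le\delta/(m-1)$ and $|\Im z_{ij}|\le\eta/(m-1)$ for all $i\ne j$. (2) $\phi(0)=0$, $\phi(1)=1$, and $\phi(z)\in R_\rho$ whenever $|z|\le\beta$. (3) Let $m\ge4$, $n\ge\omega m$, and let $G$ be a graph on $\{1,\dots,n\}$. (a) For every $z\in R_\rho$ we have $|\Re\ln(1+zw_{ij})|\le\delta/(m-1)$ and $|\Im\ln(1+zw_{ij})|\le\eta/(m-1)$ for all $i\ne j$ (principal branch), and $h(z)\neq0$. (b) There is a holomorphic $f$ on the disc $|z|<\beta$ with $f(0)=0$ and $e^{f(z)}=h(\phi(z))$ such that for all $0<\epsilon<1$ and all integers $r\ge C(\ln m-\ln\epsilon)$ $$\Big|\frac{\gamma m}{2}+\sum_{k=0}^r\frac{f^{(k)}(0)}{k!}-\ln\operatorname{den}_m(G;\gamma)\Big|\le\epsilon .$$ (c) For every $0<\epsilon<1$, the program $\Pi$,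 given $n$, $m$, the adjacency matrix of $G$, $\gamma$ and $\epsilon$, halts after at most $n^{C(\ln m-\ln\epsilon)}$ steps, and its output differs from $\ln\operatorname{den}_m(G;\gamma)$ by at most $\epsilon$. Here a program of the real random access machine is built by sequencing, branching and while loops from elementary steps on natural and real variables and on arrays of natural and of real numbers. Each of the following is one step: addition and truncated subtraction of natural numbers; addition, subtraction, multiplication and division of real numbers; setting a variable to a natural or rational constant; converting a natural number to a real number; reading or writing an array entry at a position held in a variable; comparing two numbers. Rounding, exponentials and logarithms of real numbers are not available. -/

import Mathlib

namespace DensePartition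

/-! Density, partition functions and the interpolating polynomial. -/

/-- The unordered pairs of distinct elements of `S ⊆ {0, …, n-1}`, each listed once, as `(i, j)` with `i < j`. -/
def pairs {n : ℕ} (S : Finset (Fin n)) : Finset (Fin n × Fin n) :=
  (S ×ˢ S).filter (fun p => p.1 < p.2)

open Classical in
/-- The density `σ(S)`: the fraction of the pairs of vertices of `S` that span an edge of `G`. -/
noncomputable def density {n : ℕ} (G : SimpleGraph (Fin n)) (S : Finset (Fin n)) : ℝ :=
  (((pairs S).filter (fun p => G.Adj p.1 p.2)).card : ℝ) / (S.card.choose 2 : ℝ)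

/-- The density partition function `den_m(G; γ)`. -/
noncomputable def den {n : ℕ} (m : ℕ) (G : SimpleGraph (Fin n)) (γ : ℝ) : ℝ :=
  (n.choose m : ℝ)⁻¹ *
    ∑ S ∈ (Finset.univ : Finset (Fin n)).powersetCard m, Real.exp (γ * m * density G S)

/-- The multivariate partition function `P_m(Z)` of a symmetric complex matrix `Z`. -/
noncomputable def P {n : ℕ} (m : ℕ) (Z : Matrix (Fin n) (Fin n) ℂ) : ℂ :=
  ∑ S ∈ (Finset.univ : Finset (Fin n)).powersetCard m, Complex.exp (∑ p ∈ pairs S, Z p.1 p.2)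

open Classical in
/-- The weights `w_ij` (used only for `i ≠ j`). -/
noncomputable def w {n : ℕ} (m : ℕ) (G : SimpleGraph (Fin n)) (γ : ℝ) (i j : Fin n) : ℝ :=
  if G.Adj i j then Real.exp (γ / ((m : ℝ) - 1)) - 1 else Real.exp (-(γ / ((m : ℝ) - 1))) - 1

/-- The univariate polynomial `h`, as a function on `ℂ`. -/
noncomputable def h {n : ℕ} (m : ℕ) (G : SimpleGraph (Fin n)) (γ : ℝ) (z : ℂ) : ℂ :=
  (n.choose m : ℂ)⁻¹ *
    ∑ S ∈ (Finset.univ : Finset (Fin n)).powersetCard m,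
      ∏ p ∈ pairs S, (1 + z * (w m G γ p.1 p.2 : ℂ))

/-- The closed rectangular neighbourhood of `[0, 1]` in `ℂ` of width `ρ`. -/
def rect (ρ : ℝ) : Set ℂ :=
  {z | -ρ ≤ z.re ∧ z.re ≤ 1 + ρ ∧ |z.im| ≤ ρ}

/-- The value at `z = 1` of the degree `r` Taylor polynomial of `f` at `0`. -/
noncomputable def taylorAtOne (f : ℂ → ℂ) (r : ℕ) : ℂ :=
  ∑ k ∈ Finset.range (r + 1), iteratedDeriv k f 0 / (k.factorial : ℂ)

end DensePartition

namespace RealRAM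

/-! A real random access machine: programs work on natural-number variables (counters and
array indices), real variables, and arrays of both kinds, and every arithmetic operation, memory
access and comparison costs one step.  The only operations on reals are the four field operations
and comparison; there is no rounding, no exponential and no logarithm, and the constants of a program
are rational. -/

/-- The memory: natural variables, real variables, and arrays (name, then position). -/
structure State where
  nat : ℕ → ℕ
  real : ℕ → ℝ
  natArr : ℕ → ℕ → ℕ
  realArr : ℕ → ℕ → ℝ

/-- Elementary instructions; the target is always listed first.  In `natLoad`, `natStore`,
`realLoad`, `realStore`, `a` is the name of an array and the position is the value of the natural variable `i`. -/
inductive Instr where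
  | natConst (x c : ℕ)
  | natAdd (x y z : ℕ)
  | natSub (x y z : ℕ)
  | natLoad (x a i : ℕ)
  | natStore (a i x : ℕ)
  | realConst (x : ℕ) (q : ℚ)
  | realOfNat (x y : ℕ)
  | realAdd (x y z : ℕ)
  | realSub (x y z : ℕ)
  | realMul (x y z : ℕ)
  | realDiv (x y z : ℕ)
  | realLoad (x a i : ℕ)
  | realStore (a i x : ℕ)

/-- The effect of an instruction (truncated subtraction of naturals; division by zero gives zero). -/
noncomputable def Instr.apply (s : State) : Instr → State
  | natConst x c => { s with nat := Function.update s.nat x c }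
  | natAdd x y z => { s with nat := Function.update s.nat x (s.nat y + s.nat z) }
  | natSub x y z => { s with nat := Function.update s.nat x (s.nat y - s.nat z) }
  | natLoad x a i => { s with nat := Function.update s.nat x (s.natArr a (s.nat i)) }
  | natStore a i x =>
      { s with natArr := Function.update s.natArr a
                (Function.update (s.natArr a) (s.nat i) (s.nat x)) }
  | realConst x q => { s with real := Function.update s.real x (q : ℝ) }
  | realOfNat x y => { s with real := Function.update s.real x (s.nat y : ℝ) }
  | realAdd x y z => { s with real := Function.update s.real x (s.real y + s.real z) }
  | realSub x y z => { s with real := Function.update s.real x (s.real y - s.real z) }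
  | realMul x y z => { s with real := Function.update s.real x (s.real y * s.real z) }
  | realDiv x y z => { s with real := Function.update s.real x (s.real y / s.real z) }
  | realLoad x a i => { s with real := Function.update s.real x (s.realArr a (s.nat i)) }
  | realStore a i x =>
      { s with realArr := Function.update s.realArr a
                (Function.update (s.realArr a) (s.nat i) (s.real x)) }

/-- Comparisons of two natural or two real variables. -/
inductive Test where
  | natLe (x y : ℕ)
  | realLe (x y : ℕ)

/-- The outcome of a comparison. -/
def Test.holds (s : State) : Test → Prop
  | natLe x y => s.nat x ≤ s.nat y
  | realLe x y => s.real x ≤ s.real y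

/-- Programs: finite objects built from instructions by sequencing, branching and while loops. -/
inductive Program where
  | instr (i : Instr)
  | seq (p q : Program)
  | ite (b : Test) (p q : Program)
  | loop (b : Test) (p : Program)

/-- `Runs p s s' t`: started in memory `s`, the program `p` halts in memory `s'` after exactly
`t` steps, each instruction and each evaluation of a test being one step. -/
inductive Runs : Program → State → State → ℕ → Prop where
  | instr (i : Instr) (s : State) : Runs (.instr i) s (i.apply s) 1
  | seq {p q : Program} {s s' s'' : State} {t t' : ℕ} :
      Runs p s s' t → Runs q s' s'' t' → Runs (.seq p q) s s'' (t + t')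
  | ite_true {b : Test} {p q : Program} {s s' : State} {t : ℕ} :
      b.holds s → Runs p s s' t → Runs (.ite b p q) s s' (t + 1)
  | ite_false {b : Test} {p q : Program} {s s' : State} {t : ℕ} :
      ¬ b.holds s → Runs q s s' t → Runs (.ite b p q) s s' (t + 1)
  | loop_true {b : Test} {p : Program} {s s' s'' : State} {t t' : ℕ} :
      b.holds s → Runs p s s' t → Runs (.loop b p) s' s'' t' →
      Runs (.loop b p) s s'' (t + t' + 1)
  | loop_false {b : Test} {p : Program} {s : State} :
      ¬ b.holds s → Runs (.loop b p) s s 1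

open Classical in
/-- The memory that holds the input: natural variables 0 and 1 hold `n` and `m`, real variables
0 and 1 hold `γ` and `ε`, the natural array 0 holds the adjacency matrix of `G` row by row
(the entry for `i, j` at position `i * n + j`), and everything else is zero. -/
noncomputable def input {n : ℕ} (m : ℕ) (G : SimpleGraph (Fin n)) (γ ε : ℝ) : State where
  nat := fun x => if x = 0 then n else if x = 1 then m else 0
  real := fun x => if x = 0 then γ else if x = 1 then ε else 0
  natArr := fun a k =>
    if a = 0 ∧ ∃ i j : Fin n, G.Adj i j ∧ k = (i : ℕ) * n + (j : ℕ) then 1 else 0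
  realArr := fun _ _ => 0

/-- The output is the value of real variable 0. -/
def output (s : State) : ℝ := s.real 0

end RealRAM

/-!
# Densities of subsets: zero-free region, interpolation, algorithm

**The zero-free region** (`exists_zero_free_region`).  For `Ω ⊆ {1, …, n}` let `Pext m Z Ω` be the part
of `P m Z` that comes from the sets containing `Ω`.  By downward induction on `|Ω|` one shows that
`Pext m Z Ω ≠ 0`, and that the numbers `Pext m Z (Ω ∪ {j})`, `j ∉ Ω`, have comparable absolute values and
pairwise angles at most `arctan τ`; since they add up to `(m - |Ω|) Pext m Z Ω`, small angles give
nonvanishing.  To compare `Ω ∪ {a}` and `Ω ∪ {b}`, move `Z` along the segment to the matrix with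
`a` and `b` exchanged.  The logarithmic derivative of `Pext` along this segment is the sum of the
row differences `z_bj - z_aj`, weighted with the quotients of the values at `Ω ∪ {a, j}` and `Ω ∪ {a}`, up to
the sets that contain both `a` and `b`, which are negligible as `n ≥ ω m`.  The real parts of the row
differences are at most `2 δ / (m - 1)`, and since the weights have pairwise angles at most `arctan τ` and
a nonnegative sum less than `m`, the angle changes by at most `δ τ` up to small terms (`abs_im_sum_le_of_close` provides the
decisive factor `1 / 2`).  With `δ < 1` this is less than `arctan τ` for small `τ`, and the
induction closes (`LevelBound.step`).

**Interpolation** (`exists_log_taylor_bound`).  A polynomial `φ` that maps a disc of radius `β > 1` into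
a thin neighbourhood of `[0, 1]`, with `φ 0 = 0` and `φ 1 = 1`, is a multiple of a Taylor polynomial
of `-log (1 - α z)` with `α` close to `1` (`exists_rat_polynomial_mapsTo_rect`).  If `H` has no zeros in the
neighbourhood and is at most `exp m` there, then `H ∘ φ` has a logarithm on the disc whose real part is at
most `m`, and the Borel–Carathéodory inequality together with Cauchy's estimates bounds the error of the
Taylor polynomial of degree `r` at `1` by a multiple of `m b ^ (-r)`, with `b > 1`.  For `h` the hypothesis
holds because `h z` is a multiple of `P` at the matrix with the entries `log (1 + z w_ij)`
(`log_weight_bounds`, `h_ne_zero`).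

**The algorithm** (`exists_program`).  The Taylor coefficients of `h` involve exponentials, which a program
cannot evaluate exactly.  The program uses instead the entire function `z ↦ den_m(G; γ z)`, here
`denFun`, which up to the factor `exp (z γ m / 2)` is `P` at the matrix with the entries `± z γ / (m - 1)`, so
that interpolation applies to it as well (`denFun_ne_zero`).  Its derivatives at `0` are powers of
`γ / (m - 1)` times the moments of the number of adjacent ordered pairs in a random `m`-set.  The
`l`-th moment is a sum over the `n ^ (2 l)` sequences of `l` ordered pairs of the probability that a random
`m`-set contains all vertices of the sequence, which is a rational function of `n`, `m` and the number of
these vertices (`momentRec_empty`, `sum_tupleVal`).  From the moments the program computes the coefficients of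
`denFun ∘ φ` (`φ` has rational coefficients) and then those of its logarithm, by the recurrence that follows
from `F' = f' F` (`taylorAtOne_eq_sum_logDerivCoeff`).  The order `R` is proportional to the number of
doublings that lead from `ε` beyond `m`, and so to `ln m - ln ε` up to constant factors.

The program is written with counted loops (`Code`), for which correctness is proved with the
denotation `Code.denote`, and the number of steps is bounded by a constant times a power of the largest
number of iterations of a loop (`Code.runs_compile`, `Code.time_le`), here `n ^ (2 R)`.
-/

namespace DensePartition

open Finset

/-! ### Families of complex numbers with small pairwise angles -/

/-- The angle between `z` and `w` is at most `arctan τ` (or one of them is zero). -/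
def Close (τ : ℝ) (z w : ℂ) : Prop :=
  |(z * (starRingEnd ℂ) w).im| ≤ τ * (z * (starRingEnd ℂ) w).re

lemma Close.zero_left {τ : ℝ} (w : ℂ) : Close τ 0 w := by simp [Close]

lemma Close.re_nonneg {τ : ℝ} (hτ : 0 < τ) {z w : ℂ} (hzw : Close τ z w) :
    0 ≤ (z * (starRingEnd ℂ) w).re :=
  nonneg_of_mul_nonneg_right ((abs_nonneg _).trans hzw) hτ

lemma Close.mul_left {τ : ℝ} {z w : ℂ} (hzw : Close τ z w) (c : ℂ) : Close τ (c * z) (c * w) := by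
  unfold Close at *
  have key : (c * z) * (starRingEnd ℂ) (c * w) =
      ((Complex.normSq c : ℝ) : ℂ) * (z * (starRingEnd ℂ) w) := by
    rw [map_mul, ← Complex.mul_conj]; ring
  rw [key, Complex.im_ofReal_mul, Complex.re_ofReal_mul, abs_mul,
    abs_of_nonneg (Complex.normSq_nonneg c)]
  nlinarith [Complex.normSq_nonneg c]

lemma Close.norm_mul_norm_le {τ : ℝ} (hτ : 0 < τ) (hτ1 : τ ≤ 1) {z w : ℂ} (hzw : Close τ z w) :
    ‖z‖ * ‖w‖ ≤ 2 * (z * (starRingEnd ℂ) w).re := by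
  have h0 := hzw.re_nonneg hτ
  have h1 := Complex.norm_le_abs_re_add_abs_im (z * (starRingEnd ℂ) w)
  rw [norm_mul, Complex.norm_conj, abs_of_nonneg h0] at h1
  unfold Close at hzw
  nlinarith

lemma Close.sum_left {ι : Type*} {τ : ℝ} {s : Finset ι} {q : ι → ℂ} {u : ι → ℝ} {z : ℂ}
    (hu : ∀ i ∈ s, 0 ≤ u i) (hq : ∀ i ∈ s, Close τ (q i) z) :
    Close τ (∑ i ∈ s, (u i : ℂ) * q i) z := by
  unfold Close at *
  simp only [Finset.sum_mul, Complex.im_sum, Complex.re_sum, Finset.mul_sum, mul_assoc,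
    Complex.im_ofReal_mul, Complex.re_ofReal_mul]
  refine (Finset.abs_sum_le_sum_abs _ _).trans (Finset.sum_le_sum fun i hi => ?_)
  rw [abs_mul, abs_of_nonneg (hu i hi)]
  nlinarith [hu i hi, hq i hi]

lemma Close.symm {τ : ℝ} {z w : ℂ} (hzw : Close τ z w) : Close τ w z := by
  unfold Close at *
  have : w * (starRingEnd ℂ) z = (starRingEnd ℂ) (z * (starRingEnd ℂ) w) := by
    simp [mul_comm]
  rw [this, Complex.conj_im, Complex.conj_re, abs_neg]
  exact hzw

lemma Close.sum_sum {ι : Type*} {τ : ℝ} {s : Finset ι} {q : ι → ℂ} {u v : ι → ℝ}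
    (hu : ∀ i ∈ s, 0 ≤ u i) (hv : ∀ i ∈ s, 0 ≤ v i)
    (hq : ∀ i ∈ s, ∀ j ∈ s, Close τ (q i) (q j)) :
    Close τ (∑ i ∈ s, (u i : ℂ) * q i) (∑ i ∈ s, (v i : ℂ) * q i) :=
  Close.sum_left hu fun i hi => (Close.sum_left hv fun j hj => hq j hj i hi).symm

/-- Complex numbers with pairwise angles at most `π / 4` add up without much cancellation. -/
lemma sum_norm_le_two_mul_norm_sum {ι : Type*} {τ : ℝ} (hτ : 0 < τ) (hτ1 : τ ≤ 1) {s : Finset ι}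
    {q : ι → ℂ} (hq : ∀ i ∈ s, ∀ j ∈ s, Close τ (q i) (q j)) :
    ∑ i ∈ s, ‖q i‖ ≤ 2 * ‖∑ i ∈ s, q i‖ := by
  have h1 : (∑ i ∈ s, ‖q i‖) * (∑ i ∈ s, ‖q i‖) ≤ 2 * (‖∑ i ∈ s, q i‖ * ‖∑ i ∈ s, q i‖) := by
    have e : ‖∑ i ∈ s, q i‖ * ‖∑ i ∈ s, q i‖ =
        ((∑ i ∈ s, q i) * (starRingEnd ℂ) (∑ i ∈ s, q i)).re := by
      rw [Complex.mul_conj, Complex.ofReal_re, Complex.normSq_eq_norm_sq, sq]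
    rw [e, map_sum, Finset.sum_mul_sum, Finset.sum_mul_sum, Complex.re_sum, Finset.mul_sum]
    refine Finset.sum_le_sum fun i hi => ?_
    rw [Complex.re_sum, Finset.mul_sum]
    exact Finset.sum_le_sum fun j hj => (hq i hi j hj).norm_mul_norm_le hτ hτ1
  have h2 : 0 ≤ ∑ i ∈ s, ‖q i‖ := Finset.sum_nonneg fun i _ => norm_nonneg _
  have h3 := norm_nonneg (∑ i ∈ s, q i)
  nlinarith

lemma sum_ne_zero_of_close {ι : Type*} {τ : ℝ} (hτ : 0 < τ) (hτ1 : τ ≤ 1) {s : Finset ι}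
    {q : ι → ℂ} (hq : ∀ i ∈ s, ∀ j ∈ s, Close τ (q i) (q j)) {i : ι} (hi : i ∈ s) (h0 : q i ≠ 0) :
    ∑ i ∈ s, q i ≠ 0 := by
  intro hs
  have h1 := sum_norm_le_two_mul_norm_sum hτ hτ1 hq
  rw [hs, norm_zero, mul_zero] at h1
  have h2 := Finset.single_le_sum (f := fun i => ‖q i‖) (fun i _ => norm_nonneg _) hi
  have h3 : ‖q i‖ ≤ 0 := h2.trans h1
  exact h0 (norm_le_zero_iff.mp h3)

/-- If the `q i` have pairwise angles at most `arctan τ` and a real sum `M`, then real weights bounded by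
`c` give a sum whose imaginary part is at most `c τ M / 2`.  The factor `1 / 2` is what allows `δ` to
be arbitrarily close to `1`: with `A = ∑ (c + x i) q i` and `B = ∑ (c - x i) q i`, the angle
between `A` and `B` is at most `arctan τ`, while `A + B = 2 c M` is real. -/
lemma abs_im_sum_le_of_close {ι : Type*} {τ : ℝ} (hτ : 0 < τ) (hτ1 : τ ≤ 1) {s : Finset ι}
    {q : ι → ℂ} (hq : ∀ i ∈ s, ∀ j ∈ s, Close τ (q i) (q j)) {M : ℝ} (hM : 0 ≤ M)
    (hsum : ∑ i ∈ s, q i = (M : ℂ)) {c : ℝ} (hc : 0 ≤ c) {x : ι → ℝ} (hx : ∀ i ∈ s, |x i| ≤ c) :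
    |(∑ i ∈ s, (x i : ℂ) * q i).im| ≤ c * τ * M / 2 := by
  have hAB := Close.sum_sum (u := fun i => c + x i) (v := fun i => c - x i) (s := s) (q := q)
    (τ := τ) (fun i hi => by linarith [neg_abs_le (x i), hx i hi])
    (fun i hi => by linarith [le_abs_self (x i), hx i hi]) hq
  set X := ∑ i ∈ s, (x i : ℂ) * q i with hX
  have eA : ∑ i ∈ s, ((c + x i : ℝ) : ℂ) * q i = (c * M : ℝ) + X := by
    rw [hX]; push_cast; rw [← hsum, Finset.mul_sum, ← Finset.sum_add_distrib]
    exact Finset.sum_congr rfl fun i _ => by ring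
  have eB : ∑ i ∈ s, ((c - x i : ℝ) : ℂ) * q i = (c * M : ℝ) - X := by
    rw [hX]; push_cast; rw [← hsum, Finset.mul_sum, ← Finset.sum_sub_distrib]
    exact Finset.sum_congr rfl fun i _ => by ring
  rw [eA, eB] at hAB
  unfold Close at hAB
  simp only [Complex.mul_im, Complex.mul_re, Complex.conj_re, Complex.conj_im, Complex.add_re,
    Complex.add_im, Complex.sub_re, Complex.sub_im, Complex.ofReal_re, Complex.ofReal_im] at hAB
  have e1 : (c * M + X.re) * -(0 - X.im) + (0 + X.im) * (c * M - X.re) = 2 * (c * M) * X.im := by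
    ring
  rw [e1, abs_mul, abs_of_nonneg (by positivity)] at hAB
  have hcM : 0 ≤ c * M := mul_nonneg hc hM
  rcases hcM.eq_or_lt with h0 | h0
  · have hX0 : X = 0 := by
      rcases mul_eq_zero.mp h0.symm with hc0 | hM0
      · rw [hX]
        refine Finset.sum_eq_zero fun i hi => ?_
        have : x i = 0 := abs_nonpos_iff.mp (hc0 ▸ hx i hi)
        simp [this]
      · rw [hX]
        refine Finset.sum_eq_zero fun i hi => ?_
        have : q i = 0 := by
          by_contra hne
          exact sum_ne_zero_of_close hτ hτ1 hq hi hne (by simp [hsum, hM0])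
        simp [this]
    rw [hX0]; simp; positivity
  · have h1 : 2 * (c * M) * |X.im| ≤ 2 * (c * M) * (c * τ * M / 2) := by
      nlinarith [sq_nonneg X.im, sq_nonneg X.re]
    exact le_of_mul_le_mul_left h1 (by positivity)

/-! ### Nonvanishing along a path -/

/-- A nonvanishing path whose logarithmic derivative is bounded changes by a factor `exp g` with `g`
in the corresponding rectangle. -/
lemma exists_exp_of_logDeriv_bound {p p' : ℝ → ℂ} (hp : ∀ t, HasDerivAt p (p' t) t)
    (hp' : Continuous p') (h0 : ∀ t ∈ Set.Icc (0 : ℝ) 1, p t ≠ 0) {A B : ℝ}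
    (hA : ∀ t ∈ Set.Icc (0 : ℝ) 1, |(p' t / p t).im| ≤ A)
    (hB : ∀ t ∈ Set.Icc (0 : ℝ) 1, ‖p' t / p t‖ ≤ B) :
    ∃ g : ℂ, p 1 = p 0 * Complex.exp g ∧ |g.im| ≤ A ∧ ‖g‖ ≤ B := by
  have hpc : Continuous p := continuous_iff_continuousAt.mpr fun t => (hp t).continuousAt
  have hcont : ContinuousOn (fun t => p' t / p t) (Set.Icc 0 1) :=
    hp'.continuousOn.div hpc.continuousOn h0
  have hint : IntervalIntegrable (fun t => p' t / p t) MeasureTheory.volume 0 1 :=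
    (hcont.mono (by rw [Set.uIcc_of_le zero_le_one])).intervalIntegrable
  set g : ℝ → ℂ := fun t => ∫ x in (0 : ℝ)..t, p' x / p x with hg
  have hgd : ∀ t ∈ Set.Ico (0 : ℝ) 1, HasDerivWithinAt g (p' t / p t) (Set.Ici t) t := by
    intro t ht
    have hsub : Set.Icc t 1 ⊆ Set.Icc (0:ℝ) 1 := Set.Icc_subset_Icc_left ht.1
    refine intervalIntegral.integral_hasDerivWithinAt_right ?_ ?_ ?_
    · refine (hcont.mono ?_).intervalIntegrable
      rw [Set.uIcc_of_le ht.1]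
      exact Set.Icc_subset_Icc_right ht.2.le
    · refine ⟨Set.Icc t 1, ?_, ?_⟩
      · exact Filter.mem_of_superset (Ioc_mem_nhdsGT ht.2) (Set.Ioc_subset_Icc_self)
      · exact (hcont.mono hsub).aestronglyMeasurable measurableSet_Icc
    · refine ((hcont.mono hsub) t ⟨le_rfl, ht.2.le⟩).mono_of_mem_nhdsWithin ?_
      exact Filter.mem_of_superset (Ioc_mem_nhdsGT ht.2) (Set.Ioc_subset_Icc_self)
  have hgc : ContinuousOn g (Set.Icc 0 1) := by
    have := intervalIntegral.continuousOn_primitive_interval' hint (Set.left_mem_uIcc)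
    rwa [Set.uIcc_of_le zero_le_one] at this
  have hconst := constant_of_has_deriv_right_zero (f := fun t => p t * Complex.exp (-g t))
    (a := 0) (b := 1) (hpc.continuousOn.mul (Complex.continuous_exp.comp_continuousOn hgc.neg))
    (fun t ht => by
      have h1 := ((hp t).hasDerivWithinAt (s := Set.Ici t)).mul ((hgd t ht).neg.cexp)
      refine h1.congr_deriv ?_
      have := h0 t ⟨ht.1, ht.2.le⟩
      field_simp
      ring)
  refine ⟨g 1, ?_, ?_, ?_⟩
  · have h1 := hconst 1 (by simp)
    have hg0 : g 0 = 0 := by simp [hg]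
    simp only [hg0, neg_zero, Complex.exp_zero, mul_one] at h1
    rw [← h1, mul_assoc, ← Complex.exp_add]; simp
  · have e : (g 1).im = ∫ x in (0 : ℝ)..1, (p' x / p x).im := by
      have := Complex.imCLM.intervalIntegral_comp_comm hint
      simpa using this.symm
    rw [e]
    have := intervalIntegral.norm_integral_le_of_norm_le_const (a := (0:ℝ)) (b := 1) (C := A)
      (f := fun x => (p' x / p x).im) (fun x hx => by
        rw [Set.uIoc_of_le zero_le_one] at hx
        exact hA x ⟨hx.1.le, hx.2⟩)
    simpa using this
  · have := intervalIntegral.norm_integral_le_of_norm_le_const (a := (0:ℝ)) (b := 1) (C := B)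
      (f := fun x => (p' x / p x)) (fun x hx => by
        rw [Set.uIoc_of_le zero_le_one] at hx
        exact hB x ⟨hx.1.le, hx.2⟩)
    simpa using this

lemma close_mul_exp {τ A : ℝ} (z g : ℂ) (hg : |g.im| ≤ A) (hA : A < Real.pi / 2)
    (hτ : Real.tan A ≤ τ) : Close τ z (z * Complex.exp g) := by
  unfold Close
  have key : z * (starRingEnd ℂ) (z * Complex.exp g) =
      ((Complex.normSq z * Real.exp g.re : ℝ) : ℂ) * Complex.exp ((-g.im : ℝ) * Complex.I) := by
    rw [map_mul, ← mul_assoc, Complex.mul_conj, ← Complex.exp_conj]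
    have : (starRingEnd ℂ) g = (g.re : ℂ) + ((-g.im : ℝ) : ℂ) * Complex.I := by
      apply Complex.ext <;> simp
    rw [this, Complex.exp_add]
    push_cast; ring
  have hp := Real.pi_pos
  have hA0 : 0 ≤ A := (abs_nonneg _).trans hg
  have hcos : 0 < Real.cos g.im :=
    Real.cos_pos_of_mem_Ioo ⟨by linarith [neg_abs_le g.im], by linarith [le_abs_self g.im]⟩
  have htan : |Real.tan g.im| ≤ τ := by
    rw [abs_le] at hg
    have hmono := Real.strictMonoOn_tan.monotoneOn
    have mem : ∀ {x : ℝ}, -A ≤ x → x ≤ A → x ∈ Set.Ioo (-(Real.pi / 2)) (Real.pi / 2) :=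
      fun h1 h2 => ⟨by linarith, by linarith⟩
    refine abs_le.mpr ⟨?_, ?_⟩
    · have := hmono (mem le_rfl (by linarith)) (mem hg.1 hg.2) hg.1
      rw [Real.tan_neg] at this
      linarith
    · exact (hmono (mem hg.1 hg.2) (mem (by linarith) le_rfl) hg.2).trans hτ
  rw [key, Complex.im_ofReal_mul, Complex.re_ofReal_mul, Complex.exp_ofReal_mul_I_im,
    Complex.exp_ofReal_mul_I_re, Real.sin_neg, Real.cos_neg, abs_mul, abs_neg]
  rw [Real.tan_eq_sin_div_cos, abs_div, abs_of_pos hcos, div_le_iff₀ hcos] at htan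
  rw [abs_of_nonneg (by have := Complex.normSq_nonneg z; positivity)]
  nlinarith [mul_nonneg (Complex.normSq_nonneg z) (Real.exp_pos g.re).le]

/-! ### Partition functions of the sets that contain a given set -/

lemma sum_pairs_add_sum_diag {R : Type*} [AddCommMonoid R] {n : ℕ} {f : Fin n → Fin n → R}
    (hf : ∀ i j, f i j = f j i) (S : Finset (Fin n)) :
    ∑ p ∈ pairs S, f p.1 p.2 + ∑ p ∈ pairs S, f p.1 p.2 + ∑ i ∈ S, f i i =
      ∑ i ∈ S, ∑ j ∈ S, f i j := by
  rw [← Finset.sum_product' S S f, ← Finset.sum_filter_add_sum_filter_not (S ×ˢ S) (fun p => p.1 < p.2),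
    ← Finset.sum_filter_add_sum_filter_not ((S ×ˢ S).filter (fun p => ¬ p.1 < p.2))
      (fun p => p.2 < p.1), ← add_assoc]
  congr 1
  · congr 1
    refine Finset.sum_nbij' Prod.swap Prod.swap ?_ ?_ ?_ ?_ ?_
    · rintro ⟨i, j⟩ hp
      simp only [pairs, mem_filter, mem_product, Prod.swap] at hp ⊢
      exact ⟨⟨⟨hp.1.2, hp.1.1⟩, hp.2.asymm⟩, hp.2⟩
    · rintro ⟨i, j⟩ hp
      simp only [pairs, mem_filter, mem_product, Prod.swap] at hp ⊢
      exact ⟨⟨hp.1.1.2, hp.1.1.1⟩, hp.2⟩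
    · simp
    · simp
    · rintro ⟨i, j⟩ _
      exact hf i j
  · refine Finset.sum_nbij' (fun i => (i, i)) Prod.fst ?_ ?_ ?_ ?_ ?_
    · intro i hi; simp [hi]
    · rintro ⟨i, j⟩ hp
      simp only [mem_filter, mem_product] at hp
      exact hp.1.1.1
    · simp
    · rintro ⟨i, j⟩ hp
      simp only [mem_filter, mem_product] at hp
      have : i = j := le_antisymm (not_lt.mp hp.2) (not_lt.mp hp.1.2)
      simp [this]
    · simp

/-- The exponent `∑_{ {i,j} ⊆ S } z_ij`. -/
noncomputable def pairSum {n : ℕ} (Z : Matrix (Fin n) (Fin n) ℂ) (S : Finset (Fin n)) : ℂ :=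
  ∑ p ∈ pairs S, Z p.1 p.2

section

variable {n m : ℕ} {Z : Matrix (Fin n) (Fin n) ℂ}

lemma two_mul_pairSum (hZ : Z.IsSymm) (S : Finset (Fin n)) :
    2 * pairSum Z S = ∑ i ∈ S, ∑ j ∈ S, Z i j - ∑ i ∈ S, Z i i := by
  rw [← sum_pairs_add_sum_diag (fun i j => (hZ.apply i j).symm) S, pairSum]; ring

lemma pairSum_insert (hZ : Z.IsSymm) {a : Fin n} {T : Finset (Fin n)} (ha : a ∉ T) :
    pairSum Z (insert a T) = pairSum Z T + ∑ j ∈ T, Z a j := by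
  have h2 : (2 : ℂ) ≠ 0 := two_ne_zero
  apply mul_left_cancel₀ h2
  rw [two_mul_pairSum hZ, mul_add, two_mul_pairSum hZ]
  have e : ∑ i ∈ T, Z i a = ∑ i ∈ T, Z a i := Finset.sum_congr rfl fun i _ => hZ.apply a i
  simp only [Finset.sum_insert ha, Finset.sum_add_distrib, e]
  ring

lemma pairSum_submatrix (hZ : Z.IsSymm) (σ : Equiv.Perm (Fin n)) (S : Finset (Fin n)) :
    pairSum (Z.submatrix σ σ) S = pairSum Z (S.map σ.toEmbedding) := by
  have h2 : (2 : ℂ) ≠ 0 := two_ne_zero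
  apply mul_left_cancel₀ h2
  rw [two_mul_pairSum hZ, two_mul_pairSum (hZ.submatrix σ)]
  simp [Finset.sum_map]

lemma pairSum_add_smul (Z D : Matrix (Fin n) (Fin n) ℂ) (t : ℂ) (S : Finset (Fin n)) :
    pairSum (Z + t • D) S = pairSum Z S + t * pairSum D S := by
  simp [pairSum, Finset.sum_add_distrib, Finset.mul_sum]

/-- The part of the sum `P m Z` over the `m`-sets that contain `Ω`. -/
noncomputable def Pext (m : ℕ) (Z : Matrix (Fin n) (Fin n) ℂ) (Ω : Finset (Fin n)) : ℂ :=
  ∑ S ∈ (Finset.univ : Finset (Fin n)).powersetCard m,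
    if Ω ⊆ S then Complex.exp (pairSum Z S) else 0

lemma Pext_empty (m : ℕ) (Z : Matrix (Fin n) (Fin n) ℂ) : Pext m Z ∅ = P m Z := by
  simp [Pext, P, pairSum]

lemma Pext_of_card_eq {Ω : Finset (Fin n)} (hΩ : Ω.card = m) :
    Pext m Z Ω = Complex.exp (pairSum Z Ω) := by
  rw [Pext, Finset.sum_eq_single_of_mem Ω (by simp [hΩ])]
  · simp
  · intro S hS hne
    rw [if_neg]
    intro hsub
    exact hne (Finset.eq_of_subset_of_card_le hsub (by simp_all)).symm

lemma Pext_of_lt_card {Ω : Finset (Fin n)} (hΩ : m < Ω.card) : Pext m Z Ω = 0 := by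
  refine Finset.sum_eq_zero fun S hS => ?_
  rw [if_neg]
  intro hsub
  have := Finset.card_le_card hsub
  simp only [mem_powersetCard, subset_univ, true_and] at hS
  omega

/-- An `m`-set that contains `Ω` has `m - |Ω|` elements outside of `Ω`. -/
lemma sum_Pext_insert (m : ℕ) (Z : Matrix (Fin n) (Fin n) ℂ) (Ω : Finset (Fin n)) :
    ∑ j ∈ Ωᶜ, Pext m Z (insert j Ω) = ((m : ℂ) - Ω.card) * Pext m Z Ω := by
  simp only [Pext]
  rw [Finset.sum_comm, Finset.mul_sum]
  refine Finset.sum_congr rfl fun S hS => ?_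
  simp only [mem_powersetCard, subset_univ, true_and] at hS
  by_cases hsub : Ω ⊆ S
  · simp only [Finset.insert_subset_iff, hsub, and_true, if_true]
    rw [← Finset.sum_filter, Finset.sum_const, nsmul_eq_mul]
    have : Ωᶜ.filter (· ∈ S) = S \ Ω := by ext j; simp [and_comm]
    rw [this, Finset.card_sdiff_of_subset hsub, Nat.cast_sub (Finset.card_le_card hsub), hS]
  · simp [Finset.insert_subset_iff, hsub]

lemma Pext_submatrix (hZ : Z.IsSymm) (σ : Equiv.Perm (Fin n)) (Ω : Finset (Fin n)) :
    Pext m (Z.submatrix σ σ) Ω = Pext m Z (Ω.map σ.toEmbedding) := by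
  unfold Pext
  refine Finset.sum_nbij' (fun S => S.map σ.toEmbedding) (fun S => S.map σ.symm.toEmbedding)
    ?_ ?_ ?_ ?_ ?_
  · intro S hS; simpa using hS
  · intro S hS; simpa using hS
  · intro S _; ext x; simp
  · intro S _; ext x; simp
  · intro S _
    rw [pairSum_submatrix hZ]
    simp [Finset.map_subset_map]

/-- The difference of the rows `b` and `a`, without the entries in the columns `a` and `b`. -/
def rowDiff (Z : Matrix (Fin n) (Fin n) ℂ) (a b : Fin n) (j : Fin n) : ℂ :=
  if j = a ∨ j = b then 0 else Z b j - Z a j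

lemma map_swap_insert {a b : Fin n} {T : Finset (Fin n)} (ha : a ∉ T) (hb : b ∉ T) :
    (insert a T).map (Equiv.swap a b).toEmbedding = insert b T := by
  rw [Finset.map_insert]
  congr 1
  · simp
  · have : T.map (Equiv.swap a b).toEmbedding = T.map (Equiv.refl _).toEmbedding := by
      rw [Finset.map_eq_image, Finset.map_eq_image]
      refine Finset.image_congr fun x hx => ?_
      have h1 : x ≠ a := fun h => ha (h ▸ hx)
      have h2 : x ≠ b := fun h => hb (h ▸ hx)
      simp [Equiv.swap_apply_of_ne_of_ne h1 h2]
    rw [this]; simp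

lemma pairSum_swap_sub (hZ : Z.IsSymm) {a b : Fin n} (hab : a ≠ b) {S : Finset (Fin n)} (ha : a ∈ S) :
    pairSum (Z.submatrix (Equiv.swap a b) (Equiv.swap a b) - Z) S =
      if b ∈ S then 0 else ∑ j ∈ S, rowDiff Z a b j := by
  have e0 : pairSum (Z.submatrix (Equiv.swap a b) (Equiv.swap a b) - Z) S =
      pairSum Z (S.map (Equiv.swap a b).toEmbedding) - pairSum Z S := by
    rw [← pairSum_submatrix hZ]; simp [pairSum]
  rw [e0]
  split_ifs with hb
  · have : S.map (Equiv.swap a b).toEmbedding = S := by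
      ext x
      simp only [Finset.mem_map_equiv, Equiv.symm_swap]
      rcases eq_or_ne x a with rfl | h1
      · simp [ha, hb]
      rcases eq_or_ne x b with rfl | h2
      · simp [ha, hb]
      rw [Equiv.swap_apply_of_ne_of_ne h1 h2]
    rw [this, sub_self]
  · obtain ⟨T, haT, rfl⟩ : ∃ T, a ∉ T ∧ insert a T = S :=
      ⟨S.erase a, by simp, Finset.insert_erase ha⟩
    have hbT : b ∉ T := fun h => hb (Finset.mem_insert_of_mem h)
    rw [map_swap_insert haT hbT, pairSum_insert hZ haT, pairSum_insert hZ hbT, Finset.sum_insert haT]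
    have : ∑ j ∈ T, rowDiff Z a b j = ∑ j ∈ T, (Z b j - Z a j) := by
      refine Finset.sum_congr rfl fun j hj => ?_
      rw [rowDiff, if_neg]
      rintro (rfl | rfl)
      · exact haT hj
      · exact hbT hj
    rw [this, Finset.sum_sub_distrib]
    simp [rowDiff]

/-- The derivative of `Pext` on sets containing `a` along the segment from `Z` to the matrix with `a`
and `b` exchanged: only the sets that contain exactly one of `a`, `b` contribute. -/
lemma hasDerivAt_Pext_swap (hZ : Z.IsSymm) {a b : Fin n} (hab : a ≠ b) (Ω : Finset (Fin n)) (t : ℝ) :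
    HasDerivAt (fun t : ℝ => Pext m (Z + (t : ℂ) •
        (Z.submatrix (Equiv.swap a b) (Equiv.swap a b) - Z)) (insert a Ω))
      (∑ j, rowDiff Z a b j * Pext m (Z + (t : ℂ) •
          (Z.submatrix (Equiv.swap a b) (Equiv.swap a b) - Z)) (insert j (insert a Ω)) -
        ∑ j, rowDiff Z a b j * Pext m (Z + (t : ℂ) •
          (Z.submatrix (Equiv.swap a b) (Equiv.swap a b) - Z)) (insert j (insert b (insert a Ω)))) t := by
  set D := Z.submatrix (Equiv.swap a b) (Equiv.swap a b) - Z with hD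
  have h1 : HasDerivAt (fun t : ℝ => Pext m (Z + (t : ℂ) • D) (insert a Ω))
      (∑ S ∈ (Finset.univ : Finset (Fin n)).powersetCard m, if insert a Ω ⊆ S then
        Complex.exp (pairSum (Z + (t : ℂ) • D) S) * pairSum D S else 0) t := by
    unfold Pext
    refine HasDerivAt.fun_sum fun S _ => ?_
    split_ifs
    · refine HasDerivAt.cexp ?_
      simp only [pairSum_add_smul]
      have := ((Complex.ofRealCLM.hasDerivAt (x := t)).mul_const (pairSum D S)).const_add (pairSum Z S)
      simpa using this
    · exact hasDerivAt_const _ _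
  refine h1.congr_deriv ?_
  simp only [Pext, Finset.mul_sum]
  rw [Finset.sum_comm, Finset.sum_comm (s := univ), ← Finset.sum_sub_distrib]
  refine Finset.sum_congr rfl fun S _ => ?_
  rw [← Finset.sum_sub_distrib]
  by_cases hsub : insert a Ω ⊆ S
  · rw [if_pos hsub, pairSum_swap_sub hZ hab (hsub (Finset.mem_insert_self _ _))]
    simp only [Finset.insert_subset_iff (s := insert a Ω), hsub, and_true,
      Finset.insert_subset_iff (s := insert b (insert a Ω))]
    by_cases hb : b ∈ S
    · simp [hb]
    · simp only [hb, if_false, and_false, mul_zero, sub_zero, mul_ite, Finset.mul_sum]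
      rw [← Finset.sum_filter]
      simp [mul_comm]
  · have : ∀ j, ¬ insert j (insert a Ω) ⊆ S := fun j h => hsub ((Finset.subset_insert _ _).trans h)
    have h' : ∀ j, ¬ insert j (insert b (insert a Ω)) ⊆ S := fun j h =>
      hsub ((Finset.subset_insert _ _).trans ((Finset.subset_insert _ _).trans h))
    simp [hsub, this, h']

/-! ### The zero-free region -/

/-- All pairwise angles among the `Pext m Z (Ω ∪ {j})`, `j ∉ Ω`, are at most `arctan τ`. -/
def CloseAbove (τ : ℝ) (m : ℕ) (Z : Matrix (Fin n) (Fin n) ℂ) (Ω : Finset (Fin n)) : Prop :=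
  ∀ a ∉ Ω, ∀ b ∉ Ω, Close τ (Pext m Z (insert a Ω)) (Pext m Z (insert b Ω))

lemma sum_norm_Pext_le {τ : ℝ} (hτ : 0 < τ) (hτ1 : τ ≤ 1) {Λ : Finset (Fin n)}
    (hcl : CloseAbove τ m Z Λ) (hΛ : Λ.card ≤ m) :
    ∑ j ∈ Λᶜ, ‖Pext m Z (insert j Λ)‖ ≤ 2 * ((m : ℝ) - Λ.card) * ‖Pext m Z Λ‖ := by
  have h1 := sum_norm_le_two_mul_norm_sum hτ hτ1 (s := Λᶜ) (q := fun j => Pext m Z (insert j Λ))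
    (fun i hi j hj => hcl i (by simpa using hi) j (by simpa using hj))
  rw [sum_Pext_insert, norm_mul] at h1
  have : ‖(m : ℂ) - (Λ.card : ℂ)‖ = (m : ℝ) - Λ.card := by
    rw [← Nat.cast_sub hΛ, Complex.norm_natCast, Nat.cast_sub hΛ]
  rw [this] at h1
  linarith

lemma sum_mul_Pext_insert (X : Fin n → ℂ) (Λ : Finset (Fin n)) :
    ∑ j, X j * Pext m Z (insert j Λ) =
      (∑ j ∈ Λ, X j) * Pext m Z Λ + ∑ j ∈ Λᶜ, X j * Pext m Z (insert j Λ) := by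
  rw [← Finset.sum_add_sum_compl Λ, Finset.sum_mul]
  congr 1
  exact Finset.sum_congr rfl fun j hj => by rw [Finset.insert_eq_of_mem hj]

lemma card_sub_one_le_of_eq_zero {X : Fin n → ℝ} {Λ : Finset (Fin n)} {a : Fin n} (ha : a ∈ Λ)
    (hXa : X a = 0) {c : ℝ} (hX : ∀ j, X j ≤ c) :
    ∑ j ∈ Λ, X j ≤ ((Λ.card : ℝ) - 1) * c := by
  rw [← Finset.add_sum_erase Λ X ha, hXa, zero_add]
  refine (Finset.sum_le_card_nsmul _ _ c fun j _ => hX j).trans ?_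
  rw [nsmul_eq_mul, Finset.card_erase_of_mem ha, Nat.cast_sub (Finset.card_pos.mpr ⟨a, ha⟩)]
  simp

/-- An element of `Λ` where `X` vanishes saves one term, which gives the factor `m - 1` in place of `m`. -/
lemma norm_sum_mul_Pext_le {τ : ℝ} (hτ : 0 < τ) (hτ1 : τ ≤ 1) {Λ : Finset (Fin n)}
    (hcl : CloseAbove τ m Z Λ) {X : Fin n → ℂ} {a : Fin n} (ha : a ∈ Λ) (hXa : X a = 0) {c : ℝ}
    (hX : ∀ j, ‖X j‖ ≤ c) :
    ‖∑ j, X j * Pext m Z (insert j Λ)‖ ≤ 2 * c * ((m : ℝ) - 1) * ‖Pext m Z Λ‖ := by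
  rcases lt_or_ge m Λ.card with hlt | hΛ
  · have h0 : ∀ j, Pext m Z (insert j Λ) = 0 := fun j =>
      Pext_of_lt_card (hlt.trans_le (Finset.card_le_card (Finset.subset_insert _ _)))
    simp [h0, Pext_of_lt_card hlt]
  have hc : 0 ≤ c := (norm_nonneg _).trans (hX a)
  have h1 : (1 : ℝ) ≤ Λ.card := by exact_mod_cast Finset.card_pos.mpr ⟨a, ha⟩
  have h2 : (Λ.card : ℝ) ≤ m := by exact_mod_cast hΛ
  rw [sum_mul_Pext_insert]
  have hA : ‖(∑ j ∈ Λ, X j) * Pext m Z Λ‖ ≤ ((Λ.card : ℝ) - 1) * c * ‖Pext m Z Λ‖ := by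
    rw [norm_mul]
    gcongr
    exact (norm_sum_le _ _).trans
      (card_sub_one_le_of_eq_zero (X := fun j => ‖X j‖) ha (by simp [hXa]) hX)
  have hB : ‖∑ j ∈ Λᶜ, X j * Pext m Z (insert j Λ)‖ ≤
      c * (2 * ((m : ℝ) - Λ.card) * ‖Pext m Z Λ‖) := by
    refine (norm_sum_le _ _).trans ?_
    refine le_trans ?_ (mul_le_mul_of_nonneg_left (sum_norm_Pext_le hτ hτ1 hcl hΛ) hc)
    rw [Finset.mul_sum]
    refine Finset.sum_le_sum fun j _ => ?_
    rw [norm_mul]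
    gcongr
    exact hX j
  refine (norm_add_le _ _).trans ((add_le_add hA hB).trans ?_)
  have : 0 ≤ c * ‖Pext m Z Λ‖ := by positivity
  nlinarith

/-- The change of the argument.  Only the real parts of `X` profit from the small angles between the
`Pext m Z (Λ ∪ {j})`; the imaginary parts are bounded by their size. -/
lemma abs_im_sum_mul_Pext_div_le {τ : ℝ} (hτ : 0 < τ) (hτ1 : τ ≤ 1) {Λ : Finset (Fin n)}
    (hcl : CloseAbove τ m Z Λ) (hne : Pext m Z Λ ≠ 0) {X : Fin n → ℂ} {a : Fin n} (ha : a ∈ Λ)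
    (hXa : X a = 0) {x y : ℝ} (hx : ∀ j, |(X j).re| ≤ x) (hy : ∀ j, |(X j).im| ≤ y) :
    |((∑ j, X j * Pext m Z (insert j Λ)) / Pext m Z Λ).im| ≤
      ((m : ℝ) - 1) * (x * τ / 2 + 2 * y) := by
  have hΛ : Λ.card ≤ m := by
    by_contra hlt
    exact hne (Pext_of_lt_card (not_le.mp hlt))
  have hx0 : 0 ≤ x := (abs_nonneg _).trans (hx a)
  have hy0 : 0 ≤ y := (abs_nonneg _).trans (hy a)
  have h1 : (1 : ℝ) ≤ Λ.card := by exact_mod_cast Finset.card_pos.mpr ⟨a, ha⟩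
  have h2 : (Λ.card : ℝ) ≤ m := by exact_mod_cast hΛ
  set q : Fin n → ℂ := fun j => Pext m Z (insert j Λ) / Pext m Z Λ with hq
  have hqcl : ∀ i ∈ Λᶜ, ∀ j ∈ Λᶜ, Close τ (q i) (q j) := fun i hi j hj => by
    have := (hcl i (by simpa using hi) j (by simpa using hj)).mul_left (Pext m Z Λ)⁻¹
    simpa [hq, div_eq_inv_mul] using this
  have hqsum : ∑ j ∈ Λᶜ, q j = (((m : ℝ) - Λ.card : ℝ) : ℂ) := by
    rw [hq, ← Finset.sum_div, sum_Pext_insert, mul_div_cancel_right₀ _ hne]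
    push_cast; rfl
  have hqn : ∑ j ∈ Λᶜ, ‖q j‖ ≤ 2 * ((m : ℝ) - Λ.card) := by
    have := sum_norm_le_two_mul_norm_sum hτ hτ1 hqcl
    rwa [hqsum, Complex.norm_real, Real.norm_of_nonneg (by linarith)] at this
  have e : (∑ j, X j * Pext m Z (insert j Λ)) / Pext m Z Λ =
      ∑ j ∈ Λ, X j + ∑ j ∈ Λᶜ, (((X j).re : ℝ) : ℂ) * q j +
        ∑ j ∈ Λᶜ, (((X j).im : ℝ) : ℂ) * Complex.I * q j := by
    rw [sum_mul_Pext_insert, add_div, mul_div_cancel_right₀ _ hne, add_assoc, ← Finset.sum_add_distrib,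
      Finset.sum_div]
    congr 1
    refine Finset.sum_congr rfl fun j _ => ?_
    rw [← add_mul, Complex.re_add_im, hq, mul_div_assoc]
  rw [e, Complex.add_im, Complex.add_im]
  have hA : |(∑ j ∈ Λ, X j).im| ≤ ((Λ.card : ℝ) - 1) * y := by
    rw [Complex.im_sum]
    exact (Finset.abs_sum_le_sum_abs _ _).trans
      (card_sub_one_le_of_eq_zero (X := fun j => |(X j).im|) ha (by simp [hXa]) hy)
  have hB := abs_im_sum_le_of_close hτ hτ1 hqcl (by linarith) hqsum hx0 (x := fun j => (X j).re)
    (fun j _ => hx j)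
  have hC : |(∑ j ∈ Λᶜ, (((X j).im : ℝ) : ℂ) * Complex.I * q j).im| ≤
      y * (2 * ((m : ℝ) - Λ.card)) := by
    refine (Complex.abs_im_le_norm _).trans ((norm_sum_le _ _).trans ?_)
    refine le_trans ?_ (mul_le_mul_of_nonneg_left hqn hy0)
    rw [Finset.mul_sum]
    refine Finset.sum_le_sum fun j _ => ?_
    rw [norm_mul, norm_mul, Complex.norm_I, mul_one, Complex.norm_real, Real.norm_eq_abs]
    gcongr
    exact hy j
  have := abs_add_three (∑ j ∈ Λ, X j).im (∑ j ∈ Λᶜ, (((X j).re : ℝ) : ℂ) * q j).im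
    (∑ j ∈ Λᶜ, (((X j).im : ℝ) : ℂ) * Complex.I * q j).im
  have hxτ : 0 ≤ x * τ := by positivity
  nlinarith

/-- The symmetric matrices of the zero-free region. -/
def Region (m : ℕ) (δ η : ℝ) (Z : Matrix (Fin n) (Fin n) ℂ) : Prop :=
  Z.IsSymm ∧ ∀ i j, i ≠ j → |(Z i j).re| ≤ δ / ((m : ℝ) - 1) ∧ |(Z i j).im| ≤ η / ((m : ℝ) - 1)

lemma Region.swap_path {δ η : ℝ} (hZ : Region m δ η Z) (σ : Equiv.Perm (Fin n)) {t : ℝ}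
    (ht : t ∈ Set.Icc (0 : ℝ) 1) : Region m δ η (Z + (t : ℂ) • (Z.submatrix σ σ - Z)) := by
  refine ⟨?_, fun i j hij => ?_⟩
  · exact hZ.1.add (((hZ.1.submatrix σ).sub hZ.1).smul _)
  · have h1 := hZ.2 i j hij
    have h2 := hZ.2 (σ i) (σ j) (fun h => hij (σ.injective h))
    simp only [Matrix.add_apply, Matrix.smul_apply, Matrix.sub_apply, Matrix.submatrix_apply,
      smul_eq_mul, Complex.add_re, Complex.add_im, Complex.re_ofReal_mul, Complex.im_ofReal_mul,
      Complex.sub_re, Complex.sub_im]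
    obtain ⟨t0, t1⟩ := ht
    simp only [abs_le] at h1 h2 ⊢
    refine ⟨⟨?_, ?_⟩, ?_, ?_⟩ <;> nlinarith

/-- The induction hypothesis at level `k` for the zero-free region: the functions `Pext` of the
`k`-sets do not vanish, and one-element extensions have comparable values and small angles.  The `16`
bounds the logarithmic derivative along an exchange of two elements. -/
def LevelBound (n m : ℕ) (δ η τ : ℝ) (k : ℕ) : Prop :=
  ∀ Z : Matrix (Fin n) (Fin n) ℂ, Region m δ η Z → ∀ Ω : Finset (Fin n), Ω.card = k →
    CloseAbove τ m Z Ω ∧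
    (∀ a ∉ Ω, ∀ b ∉ Ω, ‖Pext m Z (insert b Ω)‖ ≤ Real.exp 16 * ‖Pext m Z (insert a Ω)‖) ∧
    (k ≤ m → Pext m Z Ω ≠ 0)

/-- Since `n ≥ ω m`, sets containing a further prescribed element make up a small part. -/
lemma norm_Pext_insert_le {τ ω : ℝ} (hτ : 0 < τ) (hτ1 : τ ≤ 1) (hω : 1 ≤ ω) (hn : ω * m ≤ n)
    {Λ : Finset (Fin n)} (hcl : CloseAbove τ m Z Λ)
    (hcmp : ∀ a ∉ Λ, ∀ b ∉ Λ, ‖Pext m Z (insert b Λ)‖ ≤ Real.exp 16 * ‖Pext m Z (insert a Λ)‖)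
    {b : Fin n} (hb : b ∉ Λ) :
    ‖Pext m Z (insert b Λ)‖ ≤ 2 * Real.exp 16 / ω * ‖Pext m Z Λ‖ := by
  rcases lt_or_ge m Λ.card with hlt | hΛ
  · rw [Pext_of_lt_card (hlt.trans_le (Finset.card_le_card (Finset.subset_insert _ _))), norm_zero]
    positivity
  have hΛn : Λ.card < n := by
    have := Finset.card_lt_univ_of_notMem hb
    simpa using this
  have h1 : ((n : ℝ) - Λ.card) * ‖Pext m Z (insert b Λ)‖ ≤
      Real.exp 16 * (2 * ((m : ℝ) - Λ.card) * ‖Pext m Z Λ‖) := by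
    refine le_trans ?_ (mul_le_mul_of_nonneg_left (sum_norm_Pext_le hτ hτ1 hcl hΛ) (by positivity))
    rw [Finset.mul_sum]
    have : ((n : ℝ) - Λ.card) = (Λᶜ.card : ℝ) := by
      rw [Finset.card_compl, Nat.cast_sub (by simpa using hΛn.le)]; simp
    rw [this, ← nsmul_eq_mul]
    exact Finset.card_nsmul_le_sum _ _ _ fun j hj => hcmp j (by simpa using hj) b hb
  have hpos : (0 : ℝ) < (n : ℝ) - Λ.card := by
    have : (Λ.card : ℝ) < n := by exact_mod_cast hΛn
    linarith
  have h2 : ω * ((m : ℝ) - Λ.card) ≤ (n : ℝ) - Λ.card := by nlinarith [Nat.cast_nonneg (α := ℝ) Λ.card]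
  have h3 : ((m : ℝ) - Λ.card) ≤ ((n : ℝ) - Λ.card) / ω := by
    rw [le_div_iff₀ (by linarith)]; linarith
  refine le_of_mul_le_mul_left ?_ hpos
  refine h1.trans ?_
  calc Real.exp 16 * (2 * ((m : ℝ) - Λ.card) * ‖Pext m Z Λ‖)
      ≤ Real.exp 16 * (2 * (((n : ℝ) - Λ.card) / ω) * ‖Pext m Z Λ‖) := by gcongr
    _ = _ := by ring

lemma abs_rowDiff_le {δ η : ℝ} (hZ : Region m δ η Z) (hm : 2 ≤ m) (hδ : 0 ≤ δ) (hη : 0 ≤ η)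
    {a b : Fin n} (j : Fin n) :
    |(rowDiff Z a b j).re| ≤ 2 * δ / ((m : ℝ) - 1) ∧ |(rowDiff Z a b j).im| ≤ 2 * η / ((m : ℝ) - 1) := by
  have hm' : (2 : ℝ) ≤ m := by exact_mod_cast hm
  unfold rowDiff
  split_ifs with h
  · have : 0 < (m : ℝ) - 1 := by linarith
    simp only [Complex.zero_re, Complex.zero_im, abs_zero]
    constructor <;> positivity
  · push Not at h
    have h1 := hZ.2 b j h.2.symm
    have h2 := hZ.2 a j h.1.symm
    rw [Complex.sub_re, Complex.sub_im]
    have e : ∀ x : ℝ, 2 * x / ((m : ℝ) - 1) = x / ((m : ℝ) - 1) + x / ((m : ℝ) - 1) := fun x => by ring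
    rw [e, e]
    exact ⟨(abs_sub _ _).trans (add_le_add h1.1 h2.1), (abs_sub _ _).trans (add_le_add h1.2 h2.2)⟩

/-- The step of the downward induction.  Along the segment from `Z` to the matrix with `a` and `b`
exchanged, the logarithmic derivative of `Pext` at `Ω ∪ {a}` has imaginary part at most `δ τ + 4 η` from the
sets without `b`, by the bound at level `k + 1`, and a small rest from the sets with `b`, by the bound
at level `k + 2`. -/
lemma LevelBound.step {δ η τ ω A : ℝ} (hm : 2 ≤ m) (hδ : 0 ≤ δ) (hη : 0 ≤ η) (hδη : δ + η ≤ 2)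
    (hτ : 0 < τ) (hτ1 : τ ≤ 1) (hω : 1 ≤ ω) (hω2 : 2 * Real.exp 16 / ω ≤ 1) (hn : ω * m ≤ n)
    (hA : δ * τ + 4 * η + 8 * (2 * Real.exp 16 / ω) ≤ A) (hApi : A < Real.pi / 2)
    (htan : Real.tan A ≤ τ) {k : ℕ} (h1 : LevelBound n m δ η τ (k + 1))
    (h2 : LevelBound n m δ η τ (k + 2)) (hk : k < m) : LevelBound n m δ η τ k := by
  have hm' : (2 : ℝ) ≤ m := by exact_mod_cast hm
  have hm1 : (0 : ℝ) < (m : ℝ) - 1 := by linarith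
  have hν : 0 < 2 * Real.exp 16 / ω := by have := Real.exp_pos 16; positivity
  have key : ∀ Z : Matrix (Fin n) (Fin n) ℂ, Region m δ η Z → ∀ Ω : Finset (Fin n), Ω.card = k →
      ∀ a ∉ Ω, ∀ b ∉ Ω, ∃ g : ℂ,
        Pext m Z (insert b Ω) = Pext m Z (insert a Ω) * Complex.exp g ∧ |g.im| ≤ A ∧ ‖g‖ ≤ 16 := by
    intro Z hZ Ω hΩ a ha b hb
    rcases eq_or_ne a b with rfl | hab
    · exact ⟨0, by simp, by simp; nlinarith, by simp⟩
    set D := Z.submatrix (Equiv.swap a b) (Equiv.swap a b) - Z with hD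
    have hbΛ : b ∉ insert a Ω := by simp [hab.symm, hb]
    have hΛ : (insert a Ω).card = k + 1 := by rw [Finset.card_insert_of_notMem ha, hΩ]
    have hΛ2 : (insert b (insert a Ω)).card = k + 2 := by rw [Finset.card_insert_of_notMem hbΛ, hΛ]
    have hX := fun j => abs_rowDiff_le hZ hm hδ hη (a := a) (b := b) j
    have hXn : ∀ j, ‖rowDiff Z a b j‖ ≤ 4 / ((m : ℝ) - 1) := fun j => by
      refine (Complex.norm_le_abs_re_add_abs_im _).trans ((add_le_add (hX j).1 (hX j).2).trans ?_)
      rw [← add_div]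
      gcongr
      linarith
    have hXa : rowDiff Z a b a = 0 := by simp [rowDiff]
    have bound : ∀ t ∈ Set.Icc (0 : ℝ) 1,
        Pext m (Z + (t : ℂ) • D) (insert a Ω) ≠ 0 ∧
        |((∑ j, rowDiff Z a b j * Pext m (Z + (t : ℂ) • D) (insert j (insert a Ω)) -
          ∑ j, rowDiff Z a b j * Pext m (Z + (t : ℂ) • D) (insert j (insert b (insert a Ω)))) /
            Pext m (Z + (t : ℂ) • D) (insert a Ω)).im| ≤ A ∧
        ‖(∑ j, rowDiff Z a b j * Pext m (Z + (t : ℂ) • D) (insert j (insert a Ω)) -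
          ∑ j, rowDiff Z a b j * Pext m (Z + (t : ℂ) • D) (insert j (insert b (insert a Ω)))) /
            Pext m (Z + (t : ℂ) • D) (insert a Ω)‖ ≤ 16 := by
      intro t ht
      have hW := hZ.swap_path (Equiv.swap a b) ht
      rw [← hD] at hW
      generalize Z + (t : ℂ) • D = W at hW ⊢
      obtain ⟨cl1, cmp1, ne1⟩ := h1 W hW _ hΛ
      obtain ⟨cl2, -, -⟩ := h2 W hW _ hΛ2
      have hne := ne1 hk
      have hpos : 0 < ‖Pext m W (insert a Ω)‖ := norm_pos_iff.mpr hne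
      have b1 := norm_sum_mul_Pext_le hτ hτ1 cl1 (Finset.mem_insert_self a Ω) hXa hXn
      have b2 := norm_sum_mul_Pext_le hτ hτ1 cl2
        (Finset.mem_insert_of_mem (Finset.mem_insert_self a Ω)) hXa hXn
      have b3 := abs_im_sum_mul_Pext_div_le hτ hτ1 cl1 hne (Finset.mem_insert_self a Ω) hXa
        (fun j => (hX j).1) (fun j => (hX j).2)
      have b4 := norm_Pext_insert_le hτ hτ1 hω hn cl1 cmp1 hbΛ
      have e8 : 2 * (4 / ((m : ℝ) - 1)) * ((m : ℝ) - 1) = 8 := by field_simp; norm_num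
      have e9 : ((m : ℝ) - 1) * (2 * δ / ((m : ℝ) - 1) * τ / 2 + 2 * (2 * η / ((m : ℝ) - 1))) =
          δ * τ + 4 * η := by field_simp; ring
      rw [e8] at b1 b2
      rw [e9] at b3
      have b5 : ‖(∑ j, rowDiff Z a b j * Pext m W (insert j (insert b (insert a Ω)))) /
          Pext m W (insert a Ω)‖ ≤ 8 * (2 * Real.exp 16 / ω) := by
        rw [norm_div, div_le_iff₀ hpos]
        linarith
      have b6 : ‖(∑ j, rowDiff Z a b j * Pext m W (insert j (insert a Ω))) /
          Pext m W (insert a Ω)‖ ≤ 8 := by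
        rw [norm_div, div_le_iff₀ hpos]
        exact b1
      refine ⟨hne, ?_, ?_⟩
      · rw [sub_div, Complex.sub_im]
        refine (abs_sub _ _).trans ?_
        have := (Complex.abs_im_le_norm _).trans b5
        linarith
      · rw [sub_div]
        refine (norm_sub_le _ _).trans ?_
        linarith
    obtain ⟨g, hg, hg1, hg2⟩ := exists_exp_of_logDeriv_bound
      (fun t => hasDerivAt_Pext_swap (m := m) hZ.1 hab Ω t)
      (by
        rw [← hD]
        unfold Pext
        simp only [pairSum_add_smul]
        have hS : ∀ (S T : Finset (Fin n)), Continuous fun t : ℝ =>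
            if T ⊆ S then Complex.exp (pairSum Z S + (t : ℂ) * pairSum D S) else 0 := by
          intro S T
          split_ifs
          · fun_prop
          · exact continuous_const
        exact (continuous_finsetSum _ fun j _ => continuous_const.mul
          (continuous_finsetSum _ fun S _ => hS S _)).sub
          (continuous_finsetSum _ fun j _ => continuous_const.mul
          (continuous_finsetSum _ fun S _ => hS S _)))
      (fun t ht => (bound t ht).1) (fun t ht => (bound t ht).2.1) (fun t ht => (bound t ht).2.2)
    refine ⟨g, ?_, hg1, hg2⟩
    have e1 : Z + ((1 : ℝ) : ℂ) • (Z.submatrix (Equiv.swap a b) (Equiv.swap a b) - Z) =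
        Z.submatrix (Equiv.swap a b) (Equiv.swap a b) := by simp
    have e0 : Z + ((0 : ℝ) : ℂ) • (Z.submatrix (Equiv.swap a b) (Equiv.swap a b) - Z) = Z := by simp
    simp only [e1, e0] at hg
    rwa [Pext_submatrix hZ.1, map_swap_insert ha hb] at hg
  intro Z hZ Ω hΩ
  have hcl : CloseAbove τ m Z Ω := by
    intro a ha b hb
    obtain ⟨g, hg, hg1, -⟩ := key Z hZ Ω hΩ a ha b hb
    rw [hg]
    exact close_mul_exp _ g hg1 hApi htan
  refine ⟨hcl, ?_, fun _ => ?_⟩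
  · intro a ha b hb
    obtain ⟨g, hg, -, hg2⟩ := key Z hZ Ω hΩ a ha b hb
    rw [hg, norm_mul, Complex.norm_exp, mul_comm]
    gcongr
    exact (Complex.re_le_norm g).trans hg2
  · obtain ⟨a, ha⟩ : ∃ a, a ∉ Ω := by
      by_contra hall
      push Not at hall
      have h3 : Ω = univ := Finset.eq_univ_iff_forall.mpr hall
      have h4 : k = n := by rw [← hΩ, h3]; simp
      have h5 : (n : ℝ) < m := by exact_mod_cast h4 ▸ hk
      nlinarith
    have hne := (h1 Z hZ (insert a Ω) (by rw [Finset.card_insert_of_notMem ha, hΩ])).2.2 hk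
    have hs := sum_ne_zero_of_close hτ hτ1 (s := Ωᶜ) (q := fun j => Pext m Z (insert j Ω))
      (fun i hi j hj => hcl i (by simpa using hi) j (by simpa using hj)) (by simpa using ha) hne
    rw [sum_Pext_insert] at hs
    exact right_ne_zero_of_mul hs

lemma levelBound_of_le {δ η τ : ℝ} {k : ℕ} (hk : m ≤ k) : LevelBound n m δ η τ k := by
  intro Z _ Ω hΩ
  have h0 : ∀ a ∉ Ω, Pext m Z (insert a Ω) = 0 := fun a ha =>
    Pext_of_lt_card (by rw [Finset.card_insert_of_notMem ha]; omega)
  refine ⟨fun a ha b _ => ?_, fun a ha b hb => ?_, fun h => ?_⟩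
  · rw [h0 a ha]; exact Close.zero_left _
  · simp [h0 a ha, h0 b hb]
  · rw [Pext_of_card_eq (by omega)]; exact Complex.exp_ne_zero _

lemma tan_mul_le {s : ℝ} (hs0 : 0 ≤ s) (hs1 : s < 1) : Real.tan (s * (1 - s)) ≤ 1 - s := by
  set x := s * (1 - s) with hx
  have hx0 : 0 ≤ x := by have : 0 ≤ 1 - s := by linarith
                         positivity
  have hx1 : x ≤ 1 - s := by nlinarith
  have hcos := Real.one_sub_sq_div_two_le_cos (x := x)
  have hcp : 0 < Real.cos x := by nlinarith
  rw [Real.tan_eq_sin_div_cos, div_le_iff₀ hcp]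
  have h1 := Real.sin_le hx0
  have h2 : s ≤ 1 - x ^ 2 / 2 := by nlinarith
  have h3 : (1 - s) * s ≤ (1 - s) * Real.cos x := by
    apply mul_le_mul_of_nonneg_left _ (by linarith)
    linarith
  linarith

/-- For every `δ < 1`, the zero-free region of `P` extends to real parts up to `δ / (m - 1)`. -/
theorem exists_zero_free_region {δ : ℝ} (hδ0 : 0 < δ) (hδ1 : δ < 1) :
    ∃ η ω : ℝ, 0 < η ∧ 1 < ω ∧ ∀ n m : ℕ, 2 ≤ m → ω * m ≤ n →
      ∀ Z : Matrix (Fin n) (Fin n) ℂ, Region m δ η Z → P m Z ≠ 0 := by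
  -- `s` lies strictly between `δ` and `1`, and `τ = 1 - s` is so small that `tan (s τ) ≤ τ`.
  set s := (1 + δ) / 2 with hs
  have hs0 : 0 < s := by linarith
  have hs1 : s < 1 := by linarith
  -- `c` is the slack `s τ - δ τ`: one half is used for `η`, the other for the sets with both elements.
  set c := (s - δ) * (1 - s) with hc
  have hc0 : 0 < c := mul_pos (by linarith) (by linarith)
  have hc1 : c ≤ 1 := by nlinarith
  have he : 1 < Real.exp 16 := by simp
  refine ⟨c / 8, 32 * Real.exp 16 / c, by positivity, ?_, ?_⟩
  · rw [lt_div_iff₀ hc0]; linarith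
  intro n m hm hn Z hZ
  have hω : 2 * Real.exp 16 / (32 * Real.exp 16 / c) = c / 16 := by
    field_simp; norm_num
  have hω1 : 1 ≤ 32 * Real.exp 16 / c := by rw [le_div_iff₀ hc0]; linarith
  have hpi := Real.pi_gt_three
  have all : ∀ d k, m ≤ k + d → LevelBound n m δ (c / 8) (1 - s) k := by
    intro d
    induction d with
    | zero => intro k hk; exact levelBound_of_le hk
    | succ d ih =>
      intro k hk
      rcases le_or_gt m k with h | h
      · exact levelBound_of_le h
      exact LevelBound.step (ω := 32 * Real.exp 16 / c) (A := s * (1 - s)) hm hδ0.le (by positivity)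
        (by linarith) (by linarith) (by linarith) hω1 (by rw [hω]; linarith) hn
        (by rw [hω, hc]; nlinarith) (by nlinarith) (tan_mul_le hs0.le hs1)
        (ih (k + 1) (by omega)) (ih (k + 2) (by omega)) h
  rw [← Pext_empty]
  exact (all m 0 (by omega) Z hZ ∅ rfl).2.2 (Nat.zero_le _)

end

/-! ### A polynomial that maps a disc into a thin neighbourhood of the unit interval -/

/-- The Taylor polynomial of degree `N` of `-log (1 - α z)`. -/
noncomputable def logPoly (α : ℚ) (N : ℕ) : Polynomial ℚ :=
  ∑ k ∈ Finset.range (N + 1), Polynomial.C (α ^ k / (k : ℚ)) * Polynomial.X ^ k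

lemma aeval_logPoly (α : ℚ) (N : ℕ) (z : ℂ) :
    Polynomial.aeval z (logPoly α N) = -Complex.logTaylor (N + 1) (-(α * z)) := by
  simp only [logPoly, map_sum, map_mul, Polynomial.aeval_C, map_pow, Polynomial.aeval_X,
    Complex.logTaylor]
  rw [← Finset.sum_neg_distrib]
  refine Finset.sum_congr rfl fun k _ => ?_
  have : (-(α * z)) ^ k = (-1) ^ k * ((α : ℂ) ^ k * z ^ k) := by
    rw [neg_pow, mul_pow]
  rw [this, pow_succ]
  have h1 : ((-1 : ℂ) ^ k) * (-1) ^ k = 1 := by rw [← mul_pow]; simp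
  have h2 : (algebraMap ℚ ℂ) (α ^ k / (k : ℚ)) = (α : ℂ) ^ k / k := by simp
  rw [h2]
  linear_combination (-(α : ℂ) ^ k * z ^ k / k) * h1

lemma norm_aeval_logPoly_add_log_le (α : ℚ) (N : ℕ) {z : ℂ} (hz : ‖(α : ℂ) * z‖ < 1) :
    ‖Polynomial.aeval z (logPoly α N) + Complex.log (1 - α * z)‖ ≤
      ‖(α : ℂ) * z‖ ^ (N + 1) * (1 - ‖(α : ℂ) * z‖)⁻¹ := by
  have h1 := Complex.norm_log_sub_logTaylor_le N (z := -(α * z)) (by rwa [norm_neg])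
  rw [norm_neg] at h1
  rw [aeval_logPoly, neg_add_eq_sub, sub_eq_add_neg 1]
  refine h1.trans (div_le_self ?_ ?_)
  · have : 0 < 1 - ‖(α : ℂ) * z‖ := by linarith
    positivity
  · have : (0 : ℝ) ≤ N := Nat.cast_nonneg N
    linarith

lemma neg_log_bounds {u : ℂ} {e : ℝ} (he : 0 < e) (hu : ‖u‖ ≤ 1 - e) :
    -Real.log 2 ≤ (-Complex.log (1 - u)).re ∧ (-Complex.log (1 - u)).re ≤ -Real.log e ∧
      |(-Complex.log (1 - u)).im| ≤ Real.pi / 2 := by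
  have h1 : e ≤ ‖1 - u‖ := by
    have := norm_sub_norm_le (1 : ℂ) u
    rw [norm_one] at this
    linarith
  have h2 : ‖1 - u‖ ≤ 2 := by
    have := norm_sub_le (1 : ℂ) u
    rw [norm_one] at this
    linarith
  rw [Complex.neg_re, Complex.neg_im, Complex.log_re, Complex.log_im, abs_neg]
  refine ⟨?_, ?_, ?_⟩
  · exact neg_le_neg (Real.log_le_log (he.trans_le h1) h2)
  · exact neg_le_neg (Real.log_le_log he h1)
  · rw [Complex.abs_arg_le_pi_div_two_iff]
    have := Complex.re_le_norm u
    simp only [Complex.sub_re, Complex.one_re]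
    linarith

/-- A truncation of `-log (1 - α z)` maps a disc of radius greater than `1` into a strip of bounded
width, while its value at `1` is large if `α < 1` is close to `1`; so it can be normalised at `1`.
The coefficients are rational, which makes them available to programs. -/
theorem exists_rat_polynomial_mapsTo_rect {ρ : ℝ} (hρ : 0 < ρ) :
    ∃ (β : ℝ) (φ : Polynomial ℚ), 1 < β ∧ φ.eval 0 = 0 ∧ φ.eval 1 = 1 ∧
      ∀ z : ℂ, ‖z‖ ≤ β → Polynomial.aeval z φ ∈ rect ρ := by
  obtain ⟨α, hα1, hα2⟩ : ∃ α : ℚ, 1 - min (1 / 2) (Real.exp (-(3 / ρ + 1))) < α ∧ (α : ℝ) < 1 :=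
    exists_rat_btwn (by
      have : 0 < min (1 / 2) (Real.exp (-(3 / ρ + 1))) := lt_min (by norm_num) (Real.exp_pos _)
      linarith)
  set e : ℝ := 1 - α with he
  have he0 : 0 < e := by linarith
  have he1 : e < 1 / 2 := by
    have := min_le_left (1 / 2) (Real.exp (-(3 / ρ + 1)))
    linarith
  have he2 : e < Real.exp (-(3 / ρ + 1)) := by
    have := min_le_right (1 / 2) (Real.exp (-(3 / ρ + 1)))
    linarith
  have hα0 : (0 : ℝ) < α := by linarith
  have hK : 3 / ρ + 1 ≤ -Real.log e := by
    have := (Real.log_lt_iff_lt_exp he0).mpr he2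
    linarith
  -- `s` is the radius to which `α z` is allowed; `α < s` makes the radius `s / α` of the disc exceed `1`.
  set s : ℝ := 1 - e / 2 with hs
  have hs0 : 0 < s := by linarith
  have hs1 : s < 1 := by linarith
  obtain ⟨N, hN⟩ : ∃ N : ℕ, s ^ (N + 1) * (1 - s)⁻¹ ≤ 1 / 2 := by
    obtain ⟨N, hN⟩ := exists_pow_lt_of_lt_one (show 0 < (1 - s) / 2 by linarith) hs1
    refine ⟨N, ?_⟩
    rw [← div_eq_mul_inv, div_le_iff₀ (by linarith), pow_succ]
    nlinarith [pow_pos hs0 N]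
  have hnorm : ∀ z : ℂ, ‖(α : ℂ) * z‖ = α * ‖z‖ := fun z => by
    rw [norm_mul]
    congr 1
    rw [← Complex.ofReal_ratCast, Complex.norm_real, Real.norm_of_nonneg hα0.le]
  have bnd : ∀ z : ℂ, ‖(α : ℂ) * z‖ ≤ s →
      ‖Polynomial.aeval z (logPoly α N) + Complex.log (1 - α * z)‖ ≤ 1 / 2 := fun z hz => by
    refine (norm_aeval_logPoly_add_log_le α N (hz.trans_lt hs1)).trans (le_trans ?_ hN)
    have h1 : 0 < 1 - s := by linarith
    have h2 : (1 - ‖(α : ℂ) * z‖)⁻¹ ≤ (1 - s)⁻¹ := by gcongr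
    exact mul_le_mul (pow_le_pow_left₀ (norm_nonneg _) hz _) h2
      (by have : 0 < 1 - ‖(α : ℂ) * z‖ := by linarith
          positivity) (by positivity)
  -- `K` is close to `-log e`, so it exceeds `3 / ρ`, and division by `K` shrinks the strip to width `ρ`.
  set K : ℚ := (logPoly α N).eval 1 with hKdef
  have hKc : Polynomial.aeval (1 : ℂ) (logPoly α N) = ((K : ℝ) : ℂ) := by
    have := Polynomial.aeval_algebraMap_apply ℂ (1 : ℚ) (logPoly α N)
    rw [map_one] at this
    rw [this, Polynomial.coe_aeval_eq_eval, ← hKdef]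
    simp
  have hK1 : |(K : ℝ) - -Real.log e| ≤ 1 / 2 := by
    have h1 := bnd 1 (by rw [hnorm]; simp; linarith)
    rw [hKc, mul_one] at h1
    have h2 : (1 : ℂ) - α = ((e : ℝ) : ℂ) := by rw [he]; push_cast; ring
    rw [h2, ← Complex.ofReal_log he0.le, ← Complex.ofReal_add, Complex.norm_real] at h1
    simpa using h1
  rw [abs_le] at hK1
  have hK0 : 3 / ρ < (K : ℝ) := by linarith
  have hKpos : (0 : ℝ) < K := lt_trans (by positivity) hK0
  have hKne : K ≠ 0 := by
    have : (K : ℝ) ≠ 0 := hKpos.ne'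
    exact_mod_cast this
  have h3K : 3 / (K : ℝ) ≤ ρ := by
    rw [div_lt_iff₀ hρ] at hK0
    rw [div_le_iff₀ hKpos]; linarith
  refine ⟨s / α, Polynomial.C K⁻¹ * logPoly α N, ?_, ?_, ?_, ?_⟩
  · rw [lt_div_iff₀ hα0]; linarith
  · have : (logPoly α N).eval 0 = 0 := by
      simp only [logPoly, Polynomial.eval_finsetSum, Polynomial.eval_mul, Polynomial.eval_C,
        Polynomial.eval_pow, Polynomial.eval_X]
      refine Finset.sum_eq_zero fun k _ => ?_
      rcases k.eq_zero_or_pos with rfl | hk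
      · simp
      · rw [zero_pow hk.ne', mul_zero]
    simp [this]
  · rw [Polynomial.eval_mul, Polynomial.eval_C, ← hKdef, inv_mul_cancel₀ hKne]
  · intro z hz
    have hz' : ‖(α : ℂ) * z‖ ≤ s := by
      rw [hnorm]
      rw [le_div_iff₀ hα0] at hz
      linarith
    have h1 := bnd z hz'
    obtain ⟨b1, b2, b3⟩ := neg_log_bounds (u := α * z) (e := e / 2) (by linarith)
      (by linarith)
    set T := Polynomial.aeval z (logPoly α N) with hT
    have hre := (Complex.abs_re_le_norm _).trans h1
    have him := (Complex.abs_im_le_norm _).trans h1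
    rw [Complex.add_re] at hre
    rw [Complex.add_im] at him
    rw [Complex.neg_re] at b1 b2
    rw [Complex.neg_im] at b3
    rw [Real.log_div he0.ne' two_ne_zero] at b2
    have hlog2 := Real.log_two_lt_d9
    have hpi := Real.pi_lt_d2
    rw [abs_le] at hre him b3
    have eT : Polynomial.aeval z (Polynomial.C K⁻¹ * logPoly α N) = (((K : ℝ)⁻¹ : ℝ) : ℂ) * T := by
      rw [map_mul, Polynomial.aeval_C]
      simp [hT]
    have ere : ∀ x : ℝ, (K : ℝ)⁻¹ * x = x / K := fun x => by ring
    rw [eT]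
    simp only [rect, Set.mem_ofPred_eq, Complex.re_ofReal_mul, Complex.im_ofReal_mul, ere]
    refine ⟨?_, ?_, ?_⟩
    · have : -(3 / (K : ℝ)) ≤ T.re / K := by
        rw [← neg_div]; gcongr; linarith
      linarith
    · have : T.re / K ≤ 1 + 3 / (K : ℝ) := by
        rw [← div_self hKpos.ne', ← add_div]; gcongr; linarith
      linarith
    · rw [abs_div, abs_of_pos hKpos]
      refine le_trans ?_ h3K
      gcongr
      rw [abs_le]; constructor <;> linarith

/-! ### Branches of the logarithm and their Taylor polynomials -/

lemma exists_log_on_ball {F : ℂ → ℂ} {β : ℝ} (hβ : 0 < β)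
    (hF : DifferentiableOn ℂ F (Metric.ball 0 β)) (h0 : ∀ z ∈ Metric.ball (0 : ℂ) β, F z ≠ 0)
    (hF0 : F 0 = 1) :
    ∃ f : ℂ → ℂ, DifferentiableOn ℂ f (Metric.ball 0 β) ∧ f 0 = 0 ∧
      ∀ z ∈ Metric.ball (0 : ℂ) β, Complex.exp (f z) = F z := by
  have hd : DifferentiableOn ℂ (fun z => deriv F z / F z) (Metric.ball 0 β) :=
    (hF.deriv Metric.isOpen_ball).div hF h0
  obtain ⟨f, hf0, hf⟩ := hd.isExactOn_ball.with_val_at 0 0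
  have hfd : DifferentiableOn ℂ f (Metric.ball 0 β) :=
    fun z hz => (hf z hz).differentiableAt.differentiableWithinAt
  refine ⟨f, hfd, hf0, fun z hz => ?_⟩
  have hFd : ∀ z ∈ Metric.ball (0 : ℂ) β, HasDerivAt F (deriv F z) z := fun z hz =>
    (hF.differentiableAt (Metric.isOpen_ball.mem_nhds hz)).hasDerivAt
  have hder : ∀ z ∈ Metric.ball (0 : ℂ) β, HasDerivAt (fun z => F z * Complex.exp (-f z)) 0 z := by
    intro z hz
    refine ((hFd z hz).mul (hf z hz).neg.cexp).congr_deriv ?_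
    have := h0 z hz
    field_simp
    ring
  have hmem : (0 : ℂ) ∈ Metric.ball (0 : ℂ) β := Metric.mem_ball_self hβ
  have hc := Metric.isOpen_ball.is_const_of_deriv_eq_zero (𝕜 := ℂ) (s := Metric.ball (0 : ℂ) β)
    (convex_ball _ _).isPreconnected
    (fun z hz => (hder z hz).differentiableAt.differentiableWithinAt)
    (fun z hz => (hder z hz).deriv) hz hmem
  simp only [hF0, hf0, neg_zero, Complex.exp_zero, mul_one, Complex.exp_neg] at hc
  field_simp at hc
  exact hc.symm

/-- The Borel–Carathéodory inequality bounds `f` on the circle with radius `(1 + β) / 2`, and Cauchy's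
estimates bound the remainder of the Taylor series. -/
lemma norm_taylorAtOne_sub_le {f : ℂ → ℂ} {β M : ℝ} (hβ : 1 < β) (hM : 0 < M)
    (hf : DifferentiableOn ℂ f (Metric.ball 0 β)) (hf0 : f 0 = 0)
    (hre : ∀ z ∈ Metric.ball (0 : ℂ) β, (f z).re ≤ M) (r : ℕ) :
    ‖taylorAtOne f r - f 1‖ ≤
      (2 * ((1 + β) / 2) / (β - (1 + β) / 2) / ((1 + β) / 2 - 1)) * M * (((1 + β) / 2) ^ r)⁻¹ := by
  set b := (1 + β) / 2 with hb
  have hb1 : 1 < b := by linarith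
  have hbβ : b < β := by linarith
  set B := 2 * M * b / (β - b) with hB
  have hB0 : 0 < B := by
    have : 0 < β - b := by linarith
    positivity
  have hcoef : ∀ k, ‖(k.factorial : ℂ)⁻¹ • iteratedDeriv k f 0‖ ≤ B * (b⁻¹) ^ k := by
    intro k
    have h1 := Complex.norm_iteratedDeriv_le_of_forall_mem_sphere_norm_le (c := 0) (R := b)
      (C := B) (f := f) k (by linarith)
      ((hf.mono (by
        rw [closure_ball _ (by linarith)]
        exact Metric.closedBall_subset_ball hbβ)).diffContOnCl)
      (fun z hz => by
        have hz' : ‖z‖ = b := by simpa using hz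
        have := Complex.borelCaratheodory_zero hM hf (fun z hz => hre z hz) (by linarith)
          (z := z) (by simp [hz', hbβ]) hf0
        rwa [hz'] at this)
    rw [norm_smul, norm_inv, Complex.norm_natCast, inv_mul_le_iff₀ (by positivity)]
    refine h1.trans (le_of_eq ?_)
    rw [inv_pow]; field_simp
  have hs := Complex.hasSum_taylorSeries_on_ball hf (z := 1) (by simpa using hβ)
  simp only [sub_zero, one_pow, one_smul] at hs
  have hsum := hs.summable
  have e1 := hsum.sum_add_tsum_nat_add (r + 1)
  rw [hs.tsum_eq] at e1
  have e2 : taylorAtOne f r = ∑ k ∈ Finset.range (r + 1), (k.factorial : ℂ)⁻¹ • iteratedDeriv k f 0 := by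
    unfold taylorAtOne
    exact Finset.sum_congr rfl fun k _ => by rw [smul_eq_mul, div_eq_inv_mul]
  have e3 : taylorAtOne f r - f 1 =
      -∑' k, ((k + (r + 1)).factorial : ℂ)⁻¹ • iteratedDeriv (k + (r + 1)) f 0 := by
    rw [e2, ← e1]; ring
  rw [e3, norm_neg]
  have hgeo : HasSum (fun k : ℕ => B * (b⁻¹) ^ (r + 1) * (b⁻¹) ^ k)
      (B * (b⁻¹) ^ (r + 1) * (1 - b⁻¹)⁻¹) :=
    (hasSum_geometric_of_lt_one (by positivity) (inv_lt_one_of_one_lt₀ hb1)).mul_left _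
  refine (tsum_of_norm_bounded hgeo fun k => ?_).trans (le_of_eq ?_)
  · refine (hcoef _).trans (le_of_eq ?_)
    rw [pow_add]; ring
  · rw [hB, inv_pow, pow_succ]
    have h1 : b - 1 ≠ 0 := by linarith
    have h2 : β - b ≠ 0 := by linarith
    have h3 : b ≠ 0 := by linarith
    field_simp

/-- A branch of the logarithm of a function that is positive on `[0, 1]` is real at `1`. -/
lemma eq_log_of_exp_eq_pos {f : ℂ → ℂ} {β : ℝ} (hβ : 1 < β)
    (hf : DifferentiableOn ℂ f (Metric.ball 0 β)) (hf0 : f 0 = 0)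
    (hpos : ∀ x : ℝ, x ∈ Set.Icc (0 : ℝ) 1 → ∃ y : ℝ, 0 < y ∧ Complex.exp (f x) = y) :
    ∀ y : ℝ, Complex.exp (f 1) = y → f 1 = Real.log y := by
  have hc : ContinuousOn (fun x : ℝ => (f x).im) (Set.Icc 0 1) := by
    refine Complex.continuous_im.comp_continuousOn (hf.continuousOn.comp
      Complex.continuous_ofReal.continuousOn fun x hx => ?_)
    rw [mem_ball_zero_iff, Complex.norm_real, Real.norm_of_nonneg hx.1]
    linarith [hx.2]
  -- the imaginary part takes values in `2πℤ` on `[0, 1]`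
  have hval : ∀ x ∈ Set.Icc (0 : ℝ) 1, ∃ k : ℤ, (f x).im = k * (2 * Real.pi) := by
    intro x hx
    obtain ⟨y, hy, he⟩ := hpos x hx
    have h1 : Complex.exp (f x) = Complex.exp (Real.log y) := by
      rw [he, ← Complex.ofReal_exp, Real.exp_log hy]
    obtain ⟨k, hk⟩ := Complex.exp_eq_exp_iff_exists_int.mp h1
    refine ⟨k, ?_⟩
    rw [hk]
    simp
  have him : (f 1).im = 0 := by
    by_contra hne
    -- otherwise some point has imaginary part `π` or `-π`, which is not a multiple of `2π`
    have h0 : (fun x : ℝ => (f x).im) 0 = 0 := by simp [hf0]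
    have hpi := Real.pi_pos
    have key : ∃ x ∈ Set.Icc (0 : ℝ) 1, |(f x).im| = Real.pi := by
      have hca : ContinuousOn (fun x : ℝ => |(f x).im|) (Set.Icc 0 1) := hc.abs
      have hiv := intermediate_value_Icc zero_le_one hca
      have hmem : Real.pi ∈ Set.Icc |(f ((0 : ℝ) : ℂ)).im| |(f ((1 : ℝ) : ℂ)).im| := by
        obtain ⟨k, hk⟩ := hval 1 (by simp)
        refine ⟨by simp [hf0, hpi.le], ?_⟩
        have hk0 : k ≠ 0 := by
          rintro rfl
          apply hne
          simpa using hk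
        have : (1 : ℝ) ≤ |(k : ℝ)| := by exact_mod_cast Int.one_le_abs hk0
        rw [hk, abs_mul, abs_of_pos (show 0 < 2 * Real.pi by positivity)]
        nlinarith
      obtain ⟨x, hx, hxe⟩ := hiv hmem
      exact ⟨x, hx, hxe⟩
    obtain ⟨x, hx, hxe⟩ := key
    obtain ⟨k, hk⟩ := hval x hx
    rw [hk, abs_mul, abs_of_pos (show 0 < 2 * Real.pi by positivity)] at hxe
    have h2 : |(k : ℝ)| * 2 = 1 := by
      apply mul_right_cancel₀ hpi.ne'
      linarith
    have h3 : |k| * 2 = 1 := by exact_mod_cast h2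
    omega
  intro y hy
  have h1 : f 1 = (((f 1).re : ℝ) : ℂ) := Complex.ext (by simp) (by simp [him])
  rw [h1, ← Complex.ofReal_exp] at hy
  rw [h1]
  norm_cast at hy ⊢
  rw [← hy, Real.log_exp]

/-- Taylor interpolation: a function without zeros on the rectangle `rect ρ`, of size at most
`exp M` there and positive on the real points, has its logarithm at `1` approximated by the Taylor
polynomials of the logarithm of its composition with a polynomial that maps a disc into `rect ρ`. -/
theorem exists_log_taylor_bound {ρ β : ℝ} (hβ : 1 < β) {φ : Polynomial ℝ}
    (hφ0 : φ.eval 0 = 0) (hφ1 : φ.eval 1 = 1)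
    (hφ : ∀ z : ℂ, ‖z‖ ≤ β → Polynomial.aeval z φ ∈ rect ρ) :
    ∃ K : ℝ, 0 < K ∧ ∀ (H : ℂ → ℂ) (M : ℝ), 0 < M → Differentiable ℂ H → H 0 = 1 →
      (∀ z ∈ rect ρ, H z ≠ 0) → (∀ z ∈ rect ρ, ‖H z‖ ≤ Real.exp M) →
      (∀ x : ℝ, (x : ℂ) ∈ rect ρ → ∃ y : ℝ, 0 < y ∧ H x = y) →
      ∃ f : ℂ → ℂ, DifferentiableOn ℂ f (Metric.ball 0 β) ∧ f 0 = 0 ∧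
        (∀ z ∈ Metric.ball (0 : ℂ) β, Complex.exp (f z) = H (Polynomial.aeval z φ)) ∧
        ∀ y : ℝ, H 1 = y → ∀ r : ℕ,
          ‖taylorAtOne f r - (Real.log y : ℂ)‖ ≤ K * M * (((1 + β) / 2) ^ r)⁻¹ := by
  refine ⟨2 * ((1 + β) / 2) / (β - (1 + β) / 2) / ((1 + β) / 2 - 1), ?_, ?_⟩
  · have h1 : 0 < β - (1 + β) / 2 := by linarith
    have h2 : 0 < (1 + β) / 2 - 1 := by linarith
    have h3 : 0 < (1 + β) / 2 := by linarith
    positivity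
  intro H M hM hH hH0 hne hle hpos
  have hb : ∀ z ∈ Metric.ball (0 : ℂ) β, Polynomial.aeval z φ ∈ rect ρ := fun z hz =>
    hφ z (mem_ball_zero_iff.mp hz).le
  have hre : ∀ x : ℝ, Polynomial.aeval (x : ℂ) φ = ((φ.eval x : ℝ) : ℂ) := fun x => by
    have := Polynomial.aeval_algebraMap_apply ℂ x φ
    simpa using this
  have h0 : Polynomial.aeval (0 : ℂ) φ = 0 := by
    have := hre 0
    rwa [hφ0, Complex.ofReal_zero] at this
  have h1 : Polynomial.aeval (1 : ℂ) φ = 1 := by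
    have := hre 1
    rwa [hφ1, Complex.ofReal_one] at this
  obtain ⟨f, hfd, hf0, hfe⟩ := exists_log_on_ball (F := fun z => H (Polynomial.aeval z φ))
    (by linarith : 0 < β) ((hH.comp (Polynomial.differentiable_aeval φ)).differentiableOn)
    (fun z hz => hne _ (hb z hz)) (by simp [h0, hH0])
  refine ⟨f, hfd, hf0, hfe, fun y hy r => ?_⟩
  have hlog : f 1 = Real.log y := by
    refine eq_log_of_exp_eq_pos hβ hfd hf0 (fun x hx => ?_) y ?_
    · have hx' : (x : ℂ) ∈ Metric.ball (0 : ℂ) β := by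
        rw [mem_ball_zero_iff, Complex.norm_real, Real.norm_of_nonneg hx.1]
        linarith [hx.2]
      rw [hfe _ hx', hre]
      exact hpos _ (hre x ▸ hb _ hx')
    · rw [hfe 1 (by simpa using hβ), h1, hy]
  rw [← hlog]
  refine norm_taylorAtOne_sub_le hβ hM hfd hf0 (fun z hz => ?_) r
  have := hle _ (hb z hz)
  rw [← hfe z hz, Complex.norm_exp, Real.exp_le_exp] at this
  exact this

lemma exists_order_bound {K b : ℝ} (hK : 0 < K) (hb : 1 < b) :
    ∃ C : ℝ, 0 < C ∧ ∀ m : ℕ, 4 ≤ m → ∀ ε : ℝ, 0 < ε → ε < 1 → ∀ r : ℕ,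
      C * (Real.log m - Real.log ε) ≤ r → K * m * (b ^ r)⁻¹ ≤ ε := by
  have hlb : 0 < Real.log b := Real.log_pos hb
  refine ⟨(|Real.log K| + 1) / Real.log b, by positivity, fun m hm ε hε hε1 r hr => ?_⟩
  have hm' : (4 : ℝ) ≤ m := by exact_mod_cast hm
  have hlm : 1 ≤ Real.log m := by
    rw [Real.le_log_iff_exp_le (by linarith)]
    linarith [Real.exp_one_lt_d9]
  have hle : Real.log ε < 0 := Real.log_neg hε hε1
  rw [div_mul_eq_mul_div, div_le_iff₀ hlb] at hr
  have h1 : Real.log K + Real.log m - Real.log ε ≤ r * Real.log b := by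
    nlinarith [le_abs_self (Real.log K), abs_nonneg (Real.log K)]
  have h2 : 0 < b ^ r := pow_pos (by linarith) r
  rw [← div_eq_mul_inv, div_le_iff₀ h2, ← Real.log_le_log_iff (by positivity) (by positivity),
    Real.log_mul hK.ne' (by positivity), Real.log_mul hε.ne' h2.ne', Real.log_pow]
  linarith

/-! ### The interpolating functions have no zeros near the unit interval -/

/-- For `z` near `[0, 1]`, `1 + z (e^x - 1)` is a real number between `e^(-κ)` and `e^κ` times a
complex number close to `1`. -/
lemma log_one_add_mul_bounds {ρ κ x : ℝ} (hρ : 0 ≤ ρ) (hρ1 : ρ ≤ 1 / 12) (hκ : 0 ≤ κ) (hκ1 : κ ≤ 1 / 3)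
    (hx : |x| ≤ κ) {z : ℂ} (hz : z ∈ rect ρ) :
    1 + z * ((Real.exp x - 1 : ℝ) : ℂ) ≠ 0 ∧
    |(Complex.log (1 + z * ((Real.exp x - 1 : ℝ) : ℂ))).re| ≤ κ + 12 * ρ * κ ∧
    |(Complex.log (1 + z * ((Real.exp x - 1 : ℝ) : ℂ))).im| ≤ 12 * ρ * κ := by
  obtain ⟨hz1, hz2, hz3⟩ := hz
  rw [abs_le] at hx
  set W := Real.exp x - 1 with hW
  -- the point of `[0, 1]` closest to `z`
  set x0 : ℝ := max 0 (min 1 z.re) with hx0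
  have hx00 : 0 ≤ x0 := le_max_left _ _
  have hx01 : x0 ≤ 1 := max_le zero_le_one (min_le_left _ _)
  have hre : |z.re - x0| ≤ ρ := by
    rw [hx0]
    rcases le_total z.re 0 with h | h
    · rw [min_eq_right (by linarith), max_eq_left h, abs_le]; constructor <;> linarith
    · rcases le_total z.re 1 with h' | h'
      · rw [min_eq_right h', max_eq_right h]; simpa using hρ
      · rw [min_eq_left h', max_eq_right zero_le_one, abs_le]; constructor <;> linarith
  have hexp1 : Real.exp κ ≤ 1 + 2 * κ := by
    have := Real.exp_bound_div_one_sub_of_interval hκ (by linarith : κ < 1)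
    refine this.trans ?_
    rw [div_le_iff₀ (by linarith)]; nlinarith
  have hexp2 : 1 - κ ≤ Real.exp (-κ) := by linarith [Real.add_one_le_exp (-κ)]
  have hWu : W ≤ Real.exp κ - 1 := by
    rw [hW]; linarith [Real.exp_le_exp.mpr hx.2]
  have hWl : Real.exp (-κ) - 1 ≤ W := by
    rw [hW]; linarith [Real.exp_le_exp.mpr hx.1]
  have hWabs : |W| ≤ 2 * κ := by rw [abs_le]; constructor <;> linarith
  set r : ℝ := 1 + x0 * W with hr
  have he1 : 1 ≤ Real.exp κ := Real.one_le_exp hκ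
  have he2 : Real.exp (-κ) ≤ 1 := Real.exp_le_one_iff.mpr (by linarith)
  have hru : r ≤ Real.exp κ := by
    rw [hr]
    nlinarith
  have hrl : Real.exp (-κ) ≤ r := by
    rw [hr]
    nlinarith
  have hr0 : 0 < r := (Real.exp_pos _).trans_le hrl
  have hr1 : 1 / 2 ≤ r := by linarith
  set u : ℂ := (z - x0) * W / r with hu
  have hfac : 1 + z * (W : ℂ) = (r : ℂ) * (1 + u) := by
    have : (r : ℂ) ≠ 0 := by exact_mod_cast hr0.ne'
    rw [hu, mul_add, mul_div_cancel₀ _ this, hr]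
    push_cast; ring
  have hζ : ‖z - x0‖ ≤ 2 * ρ := by
    refine (Complex.norm_le_abs_re_add_abs_im _).trans ?_
    simp only [Complex.sub_re, Complex.ofReal_re, Complex.sub_im, Complex.ofReal_im, sub_zero]
    linarith
  have hun : ‖u‖ ≤ 8 * ρ * κ := by
    rw [hu, norm_div, norm_mul, Complex.norm_real, Complex.norm_real, Real.norm_eq_abs,
      Real.norm_of_nonneg hr0.le, div_le_iff₀ hr0]
    calc ‖z - x0‖ * |W| ≤ (2 * ρ) * (2 * κ) := by gcongr
      _ = 8 * ρ * κ * (1 / 2) := by ring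
      _ ≤ 8 * ρ * κ * r := by gcongr
  have hu2 : ‖u‖ ≤ 1 / 2 := hun.trans (by nlinarith)
  have hne : 1 + u ≠ 0 := by
    intro h0
    have : u = -1 := by linear_combination h0
    rw [this, norm_neg, norm_one] at hu2
    norm_num at hu2
  have hlu := Complex.norm_log_one_add_half_le_self hu2
  have hlog : Complex.log (1 + z * (W : ℂ)) = (Real.log r : ℂ) + Complex.log (1 + u) := by
    rw [hfac, Complex.log_ofReal_mul hr0 hne]
  have hlr : |Real.log r| ≤ κ := by
    rw [abs_le]
    exact ⟨(Real.le_log_iff_exp_le hr0).mpr hrl, (Real.log_le_iff_le_exp hr0).mpr hru⟩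
  refine ⟨?_, ?_, ?_⟩
  · rw [hfac]
    exact mul_ne_zero (by exact_mod_cast hr0.ne') hne
  · rw [hlog, Complex.add_re, Complex.ofReal_re]
    refine (abs_add_le _ _).trans (add_le_add hlr ?_)
    exact (Complex.abs_re_le_norm _).trans (hlu.trans (by linarith))
  · rw [hlog, Complex.add_im, Complex.ofReal_im, zero_add]
    exact (Complex.abs_im_le_norm _).trans (hlu.trans (by linarith))

section

variable {n m : ℕ} {G : SimpleGraph (Fin n)} {γ : ℝ}

open Classical in
/-- The sign `1` of an edge and `-1` of a non-edge. -/
noncomputable def edgeSign (G : SimpleGraph (Fin n)) (i j : Fin n) : ℝ := if G.Adj i j then 1 else -1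

open Classical in
/-- The adjacency matrix with natural entries. -/
noncomputable def adjNat (G : SimpleGraph (Fin n)) (i j : Fin n) : ℕ := if G.Adj i j then 1 else 0

/-- The number of ordered pairs of adjacent vertices of `S`. -/
noncomputable def arcCount (G : SimpleGraph (Fin n)) (S : Finset (Fin n)) : ℕ :=
  ∑ i ∈ S, ∑ j ∈ S, adjNat G i j

lemma edgeSign_eq (G : SimpleGraph (Fin n)) (i j : Fin n) :
    edgeSign G i j = 2 * (adjNat G i j : ℝ) - 1 := by
  unfold edgeSign adjNat
  split_ifs <;> norm_num

lemma adjNat_symm (G : SimpleGraph (Fin n)) (i j : Fin n) : adjNat G i j = adjNat G j i := by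
  by_cases hij : G.Adj i j <;> simp [adjNat, hij, G.adj_comm j i]

lemma adjNat_self (G : SimpleGraph (Fin n)) (i : Fin n) : adjNat G i i = 0 := by simp [adjNat]

lemma edgeSign_symm (G : SimpleGraph (Fin n)) (i j : Fin n) : edgeSign G i j = edgeSign G j i := by
  by_cases hij : G.Adj i j <;> simp [edgeSign, hij, G.adj_comm j i]

lemma w_eq (i j : Fin n) : w m G γ i j = Real.exp (γ / ((m : ℝ) - 1) * edgeSign G i j) - 1 := by
  unfold w edgeSign
  split_ifs <;> simp

lemma two_mul_card_pairs (S : Finset (Fin n)) :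
    2 * ((pairs S).card : ℝ) = S.card * ((S.card : ℝ) - 1) := by
  have := sum_pairs_add_sum_diag (f := fun _ _ : Fin n => (1 : ℝ)) (fun _ _ => rfl) S
  simp only [Finset.sum_const, nsmul_eq_mul, mul_one] at this
  linarith

lemma two_mul_sum_pairs_adjNat (S : Finset (Fin n)) :
    2 * ∑ p ∈ pairs S, (adjNat G p.1 p.2 : ℝ) = arcCount G S := by
  have := sum_pairs_add_sum_diag (f := fun i j => (adjNat G i j : ℝ))
    (fun i j => by rw [adjNat_symm]) S
  simp only [adjNat_self, Nat.cast_zero, Finset.sum_const_zero, add_zero] at this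
  rw [two_mul, this, arcCount]
  push_cast; rfl

lemma sum_pairs_edgeSign (S : Finset (Fin n)) :
    ∑ p ∈ pairs S, edgeSign G p.1 p.2 = arcCount G S - S.card * ((S.card : ℝ) - 1) / 2 := by
  simp only [edgeSign_eq, Finset.sum_sub_distrib, Finset.sum_const, nsmul_eq_mul, mul_one]
  rw [← Finset.mul_sum, two_mul_sum_pairs_adjNat, ← two_mul_card_pairs]
  ring

lemma mul_density_eq (hm : 2 ≤ m) {S : Finset (Fin n)} (hS : S.card = m) :
    γ * m * density G S = γ / ((m : ℝ) - 1) * arcCount G S := by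
  have hm' : (2 : ℝ) ≤ m := by exact_mod_cast hm
  have h1 : (m : ℝ) - 1 ≠ 0 := by linarith
  have h2 : (m : ℝ) ≠ 0 := by linarith
  rw [← two_mul_sum_pairs_adjNat, density, hS, Nat.cast_choose_two, Finset.card_filter]
  unfold adjNat
  push_cast
  field_simp

/-- The entire function `z ↦ den m G (γ z)`.  Other than those of `h`, its Taylor coefficients at `0` can be
computed from `γ` by rational operations. -/
noncomputable def denFun (m : ℕ) (G : SimpleGraph (Fin n)) (γ : ℝ) (z : ℂ) : ℂ :=
  (n.choose m : ℂ)⁻¹ * ∑ S ∈ (Finset.univ : Finset (Fin n)).powersetCard m,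
    Complex.exp (z * ((γ / ((m : ℝ) - 1) * arcCount G S : ℝ) : ℂ))

lemma inv_choose_mul_sum_one (hmn : m ≤ n) :
    (n.choose m : ℂ)⁻¹ * ∑ _S ∈ (Finset.univ : Finset (Fin n)).powersetCard m, (1 : ℂ) = 1 := by
  have : (n.choose m : ℂ) ≠ 0 := by exact_mod_cast (Nat.choose_pos hmn).ne'
  simp [this]

lemma denFun_zero (hmn : m ≤ n) : denFun m G γ 0 = 1 := by
  simp only [denFun, zero_mul, Complex.exp_zero]
  exact inv_choose_mul_sum_one hmn

lemma h_zero (hmn : m ≤ n) : h m G γ 0 = 1 := by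
  simp only [h, zero_mul, add_zero, Finset.prod_const_one]
  exact inv_choose_mul_sum_one hmn

lemma den_pos (hmn : m ≤ n) : 0 < den m G γ := by
  unfold den
  have h1 : (0 : ℝ) < n.choose m := by exact_mod_cast Nat.choose_pos hmn
  have h2 : ((Finset.univ : Finset (Fin n)).powersetCard m).Nonempty := by
    rw [← Finset.card_pos, Finset.card_powersetCard]; simpa using Nat.choose_pos hmn
  exact mul_pos (inv_pos.mpr h1) (Finset.sum_pos (fun S _ => Real.exp_pos _) h2)

lemma denFun_one (hm : 2 ≤ m) : denFun m G γ 1 = den m G γ := by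
  unfold denFun den
  push_cast
  congr 1
  refine Finset.sum_congr rfl fun S hS => ?_
  have hS : S.card = m := by simpa using hS
  have := mul_density_eq (G := G) (γ := γ) hm hS
  rw [one_mul]
  congr 1
  exact_mod_cast this.symm

lemma h_one (hm : 2 ≤ m) : h m G γ 1 = (Real.exp (-(γ * m / 2)) * den m G γ : ℝ) := by
  have hm' : (2 : ℝ) ≤ m := by exact_mod_cast hm
  have h1 : (m : ℝ) - 1 ≠ 0 := by linarith
  have e : ∀ S ∈ (Finset.univ : Finset (Fin n)).powersetCard m,
      ∏ p ∈ pairs S, (1 + 1 * (w m G γ p.1 p.2 : ℂ)) = (Real.exp (-(γ * m / 2)) : ℂ) *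
        Complex.exp (1 * ((γ / ((m : ℝ) - 1) * arcCount G S : ℝ) : ℂ)) := ?_
  · rw [Complex.ofReal_mul, ← denFun_one hm, denFun, h, mul_left_comm, Finset.sum_congr rfl e,
      ← Finset.mul_sum]
  intro S hS
  have hS : S.card = m := by simpa using hS
  simp only [one_mul, w_eq]
  rw [← Complex.ofReal_exp, ← Complex.ofReal_mul, ← Real.exp_add]
  have : ∀ p : Fin n × Fin n, (1 : ℂ) + ((Real.exp (γ / ((m : ℝ) - 1) * edgeSign G p.1 p.2) - 1 : ℝ) : ℂ) =
      (Real.exp (γ / ((m : ℝ) - 1) * edgeSign G p.1 p.2) : ℂ) := fun p => by push_cast; ring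
  simp only [this]
  rw [← Complex.ofReal_prod, ← Real.exp_sum, ← Finset.mul_sum, sum_pairs_edgeSign, hS]
  congr 2
  field_simp
  ring

/-- The relations between the constants: `ρ` is so small that the interpolating functions map
`rect ρ` into the zero-free region given by `δ` and `η`. -/
structure Admissible (γ δ η ρ : ℝ) : Prop where
  γ_pos : 0 < γ
  γ_lt_one : γ < 1
  δ_lt_one : δ < 1
  ρ_pos : 0 < ρ
  ρ_le_sub : 12 * ρ ≤ δ - γ
  ρ_le_η : 12 * ρ ≤ η

variable {δ η ρ : ℝ}

lemma log_weight_bounds (hadm : Admissible γ δ η ρ) (hm : 4 ≤ m) {z : ℂ} (hz : z ∈ rect ρ) (i j : Fin n) :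
    1 + z * (w m G γ i j : ℂ) ≠ 0 ∧
    |(Complex.log (1 + z * (w m G γ i j : ℂ))).re| ≤ δ / ((m : ℝ) - 1) ∧
    |(Complex.log (1 + z * (w m G γ i j : ℂ))).im| ≤ η / ((m : ℝ) - 1) := by
  obtain ⟨hγ0, hγ1, hδ1, hρ, hρδ, hρη⟩ := hadm
  have hm' : (4 : ℝ) ≤ m := by exact_mod_cast hm
  have hm1 : 0 < (m : ℝ) - 1 := by linarith
  have hκ : 0 < γ / ((m : ℝ) - 1) := by positivity
  obtain ⟨h0, h1, h2⟩ := log_one_add_mul_bounds (ρ := ρ) (κ := γ / ((m : ℝ) - 1))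
    (x := γ / ((m : ℝ) - 1) * edgeSign G i j) hρ.le (by linarith) hκ.le
    (by rw [div_le_iff₀ hm1]; linarith)
    (by
      rw [abs_mul, abs_of_pos hκ]
      have : |edgeSign G i j| = 1 := by unfold edgeSign; split_ifs <;> simp
      rw [this, mul_one]) hz
  rw [← w_eq] at h0 h1 h2
  refine ⟨h0, h1.trans ?_, h2.trans ?_⟩
  · rw [mul_div_assoc', ← add_div]; gcongr; nlinarith
  · rw [mul_div_assoc']; gcongr; nlinarith

/-- Up to a factor, `h z` is `P` at the matrix with the entries `log (1 + z w_ij)`. -/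
lemma h_ne_zero (hadm : Admissible γ δ η ρ) (hm : 4 ≤ m) (hmn : m ≤ n)
    (hP : ∀ Z : Matrix (Fin n) (Fin n) ℂ, Region m δ η Z → P m Z ≠ 0) {z : ℂ} (hz : z ∈ rect ρ) :
    h m G γ z ≠ 0 := by
  obtain ⟨hγ0, hγ1, hδ1, hρ, hρδ, hρη⟩ := id hadm
  have hb := fun i j => log_weight_bounds (G := G) hadm hm hz i j
  have hne := hP (fun i j => Complex.log (1 + z * (w m G γ i j : ℂ)))
    ⟨by
      ext i j
      change Complex.log (1 + z * (w m G γ j i : ℂ)) = Complex.log (1 + z * (w m G γ i j : ℂ))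
      rw [w_eq, w_eq, edgeSign_symm G i j], fun i j _ => (hb i j).2⟩
  have hc : (n.choose m : ℂ) ≠ 0 := by exact_mod_cast (Nat.choose_pos hmn).ne'
  refine mul_ne_zero (inv_ne_zero hc) ?_
  convert hne using 1
  unfold P
  refine Finset.sum_congr rfl fun S _ => ?_
  rw [Complex.exp_sum]
  exact Finset.prod_congr rfl fun p _ => (Complex.exp_log (hb _ _).1).symm

lemma norm_h_le (hadm : Admissible γ δ η ρ) (hm : 4 ≤ m) (hmn : m ≤ n) {z : ℂ} (hz : z ∈ rect ρ) :
    ‖h m G γ z‖ ≤ Real.exp m := by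
  obtain ⟨hγ0, hγ1, hδ1, hρ, hρδ, hρη⟩ := id hadm
  have hm' : (4 : ℝ) ≤ m := by exact_mod_cast hm
  have hm1 : 0 < (m : ℝ) - 1 := by linarith
  have hb := fun i j => log_weight_bounds (G := G) hadm hm hz i j
  have hc : (0 : ℝ) < n.choose m := by exact_mod_cast Nat.choose_pos hmn
  rw [h, norm_mul, norm_inv, Complex.norm_natCast, inv_mul_le_iff₀ hc]
  refine (norm_sum_le_of_le (f := fun S => ∏ p ∈ pairs S, (1 + z * (w m G γ p.1 p.2 : ℂ)))
    (n := fun _ => Real.exp m) _ fun S hS => ?_).trans (by simp)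
  have hS : S.card = m := by simpa using hS
  rw [norm_prod]
  have h1 : ∀ p ∈ pairs S, ‖1 + z * (w m G γ p.1 p.2 : ℂ)‖ ≤ Real.exp (δ / ((m : ℝ) - 1)) := by
    intro p _
    obtain ⟨h0, h1, -⟩ := hb p.1 p.2
    rw [← Complex.exp_log h0, Complex.norm_exp, Real.exp_le_exp]
    exact (le_abs_self _).trans h1
  refine (Finset.prod_le_prod (fun _ _ => norm_nonneg _) h1).trans ?_
  rw [Finset.prod_const, ← Real.exp_nat_mul, Real.exp_le_exp]
  have h2 := two_mul_card_pairs S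
  rw [hS] at h2
  have h3 : ((pairs S).card : ℝ) = m * ((m : ℝ) - 1) / 2 := by linarith
  rw [h3]
  field_simp
  nlinarith

lemma h_pos_of_real (hadm : Admissible γ δ η ρ) (hm : 4 ≤ m) (hmn : m ≤ n) (x : ℝ)
    (hx : (x : ℂ) ∈ rect ρ) : ∃ y : ℝ, 0 < y ∧ h m G γ x = y := by
  obtain ⟨hγ0, hγ1, hδ1, hρ, hρδ, hρη⟩ := id hadm
  have hm' : (4 : ℝ) ≤ m := by exact_mod_cast hm
  have hm1 : 0 < (m : ℝ) - 1 := by linarith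
  have hκ : 0 < γ / ((m : ℝ) - 1) := by positivity
  have hκ1 : γ / ((m : ℝ) - 1) ≤ 1 / 3 := by rw [div_le_iff₀ hm1]; linarith
  refine ⟨(n.choose m : ℝ)⁻¹ * ∑ S ∈ (Finset.univ : Finset (Fin n)).powersetCard m,
    ∏ p ∈ pairs S, (1 + x * w m G γ p.1 p.2), ?_, by unfold h; push_cast; rfl⟩
  have h1 : (0 : ℝ) < n.choose m := by exact_mod_cast Nat.choose_pos hmn
  have h2 : ((Finset.univ : Finset (Fin n)).powersetCard m).Nonempty := by
    rw [← Finset.card_pos, Finset.card_powersetCard]; simpa using Nat.choose_pos hmn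
  refine mul_pos (inv_pos.mpr h1) (Finset.sum_pos (fun S _ => Finset.prod_pos fun p _ => ?_) h2)
  obtain ⟨hx1, hx2, -⟩ := hx
  simp only [Complex.ofReal_re] at hx1 hx2
  have hexp : Real.exp (1 / 3) ≤ 3 / 2 := by
    have := Real.exp_bound_div_one_sub_of_interval (x := 1 / 3) (by norm_num) (by norm_num)
    norm_num at this ⊢
    exact this
  have hw : |w m G γ p.1 p.2| ≤ 1 / 2 := by
    rw [w_eq]
    set y := γ / ((m : ℝ) - 1) * edgeSign G p.1 p.2 with hy
    have hy1 : -(1 / 3) ≤ y ∧ y ≤ 1 / 3 := by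
      rw [hy]; unfold edgeSign; split_ifs <;> constructor <;> linarith
    rw [abs_le]
    have h3 := Real.add_one_le_exp y
    have h4 := Real.exp_le_exp.mpr hy1.2
    constructor <;> linarith [hy1.1]
  have hxa : |x| ≤ 3 / 2 := by rw [abs_le]; constructor <;> linarith
  have : |x * w m G γ p.1 p.2| ≤ 3 / 2 * (1 / 2) := by rw [abs_mul]; gcongr
  linarith [neg_abs_le (x * w m G γ p.1 p.2)]

/-- Up to a factor without zeros, `denFun m G γ z` is `P` at the matrix with the entries `± z γ / (m - 1)`. -/
lemma denFun_ne_zero (hadm : Admissible γ δ η ρ) (hm : 4 ≤ m) (hmn : m ≤ n)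
    (hP : ∀ Z : Matrix (Fin n) (Fin n) ℂ, Region m δ η Z → P m Z ≠ 0) {z : ℂ} (hz : z ∈ rect ρ) :
    denFun m G γ z ≠ 0 := by
  obtain ⟨hγ0, hγ1, hδ1, hρ, hρδ, hρη⟩ := id hadm
  have hm' : (4 : ℝ) ≤ m := by exact_mod_cast hm
  have hm1 : 0 < (m : ℝ) - 1 := by linarith
  obtain ⟨hz1, hz2, hz3⟩ := hz
  have hne := hP (fun i j => z * ((γ / ((m : ℝ) - 1) * edgeSign G i j : ℝ) : ℂ))
    ⟨by
      ext i j
      change z * ((γ / ((m : ℝ) - 1) * edgeSign G j i : ℝ) : ℂ) = z * _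
      rw [edgeSign_symm G i j], fun i j _ => by
      have hs : |edgeSign G i j| = 1 := by unfold edgeSign; split_ifs <;> simp
      have hκ : 0 < γ / ((m : ℝ) - 1) := by positivity
      have ha : |γ / ((m : ℝ) - 1) * edgeSign G i j| = γ / ((m : ℝ) - 1) := by
        rw [abs_mul, hs, mul_one, abs_of_pos hκ]
      rw [Complex.re_mul_ofReal, Complex.im_mul_ofReal, abs_mul, abs_mul z.im, ha, mul_div_assoc',
        mul_div_assoc']
      have hzr : |z.re| ≤ 1 + ρ := by rw [abs_le]; constructor <;> linarith
      have hzr0 := abs_nonneg z.re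
      have hzi0 := abs_nonneg z.im
      constructor
      · gcongr; nlinarith
      · gcongr; nlinarith⟩
  have hc : (n.choose m : ℂ) ≠ 0 := by exact_mod_cast (Nat.choose_pos hmn).ne'
  refine mul_ne_zero (inv_ne_zero hc) ?_
  have e : ∑ S ∈ (Finset.univ : Finset (Fin n)).powersetCard m,
      Complex.exp (z * ((γ / ((m : ℝ) - 1) * arcCount G S : ℝ) : ℂ)) =
      Complex.exp (z * ((γ * m / 2 : ℝ) : ℂ)) *
        P m (fun i j => z * ((γ / ((m : ℝ) - 1) * edgeSign G i j : ℝ) : ℂ)) := by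
    unfold P
    rw [Finset.mul_sum]
    refine Finset.sum_congr rfl fun S hS => ?_
    have hS : S.card = m := by simpa using hS
    rw [← Complex.exp_add, ← Finset.mul_sum, ← mul_add, ← Complex.ofReal_sum, ← Complex.ofReal_add,
      ← Finset.mul_sum, sum_pairs_edgeSign, hS]
    congr 3
    field_simp
    ring
  rw [e]
  exact mul_ne_zero (Complex.exp_ne_zero _) hne

lemma arcCount_le (S : Finset (Fin n)) : (arcCount G S : ℝ) ≤ S.card * ((S.card : ℝ) - 1) := by
  rw [← two_mul_sum_pairs_adjNat, ← two_mul_card_pairs]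
  gcongr
  rw [← nsmul_one, ← Finset.sum_const]
  refine Finset.sum_le_sum fun p _ => ?_
  unfold adjNat
  split_ifs <;> simp

lemma norm_denFun_le (hadm : Admissible γ δ η ρ) (hm : 4 ≤ m) (hmn : m ≤ n) {z : ℂ} (hz : z ∈ rect ρ) :
    ‖denFun m G γ z‖ ≤ Real.exp m := by
  obtain ⟨hγ0, hγ1, hδ1, hρ, hρδ, hρη⟩ := id hadm
  have hm' : (4 : ℝ) ≤ m := by exact_mod_cast hm
  have hm1 : 0 < (m : ℝ) - 1 := by linarith
  obtain ⟨-, hz2, -⟩ := hz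
  have hc : (0 : ℝ) < n.choose m := by exact_mod_cast Nat.choose_pos hmn
  rw [denFun, norm_mul, norm_inv, Complex.norm_natCast, inv_mul_le_iff₀ hc]
  refine (norm_sum_le_of_le (n := fun _ => Real.exp m) _ fun S hS => ?_).trans (by simp)
  have hS : S.card = m := by simpa using hS
  rw [Complex.norm_exp, Real.exp_le_exp, Complex.re_mul_ofReal]
  have h1 := arcCount_le (G := G) S
  rw [hS] at h1
  have h2 : γ / ((m : ℝ) - 1) * arcCount G S ≤ γ * m := by
    rw [div_mul_eq_mul_div, div_le_iff₀ hm1]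
    nlinarith
  have h3 : 0 ≤ γ / ((m : ℝ) - 1) * arcCount G S := by positivity
  have h4 : (1 + ρ) * γ ≤ 1 := by nlinarith
  calc z.re * (γ / ((m : ℝ) - 1) * arcCount G S)
      ≤ (1 + ρ) * (γ / ((m : ℝ) - 1) * arcCount G S) := by gcongr
    _ ≤ (1 + ρ) * (γ * m) := by gcongr
    _ = (1 + ρ) * γ * m := by ring
    _ ≤ 1 * m := by gcongr
    _ = m := one_mul _

lemma denFun_pos_of_real (hmn : m ≤ n) (x : ℝ) : ∃ y : ℝ, 0 < y ∧ denFun m G γ x = y := by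
  refine ⟨(n.choose m : ℝ)⁻¹ * ∑ S ∈ (Finset.univ : Finset (Fin n)).powersetCard m,
    Real.exp (x * (γ / ((m : ℝ) - 1) * arcCount G S)), ?_, by unfold denFun; push_cast; rfl⟩
  have h1 : (0 : ℝ) < n.choose m := by exact_mod_cast Nat.choose_pos hmn
  have h2 : ((Finset.univ : Finset (Fin n)).powersetCard m).Nonempty := by
    rw [← Finset.card_pos, Finset.card_powersetCard]; simpa using Nat.choose_pos hmn
  exact mul_pos (inv_pos.mpr h1) (Finset.sum_pos (fun S _ => Real.exp_pos _) h2)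

lemma differentiable_denFun : Differentiable ℂ (denFun m G γ) := by
  unfold denFun; fun_prop

lemma differentiable_h : Differentiable ℂ (h m G γ) := by
  unfold h
  refine (differentiable_const _).mul (Differentiable.fun_sum fun S _ => ?_)
  exact Differentiable.fun_finsetProd fun p _ => by fun_prop

end

/-! ### Taylor coefficients of compositions and logarithms -/

lemma iteratedDeriv_polynomial_eval (p : Polynomial ℂ) (k : ℕ) :
    iteratedDeriv k (fun z => p.eval z) = fun z => (Polynomial.derivative^[k] p).eval z := by
  induction k with
  | zero => simp
  | succ k ih =>
    rw [iteratedDeriv_succ, ih]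
    funext z
    rw [Polynomial.deriv, Function.iterate_succ_apply']

lemma iteratedDeriv_polynomial_eval_zero (p : Polynomial ℂ) (k : ℕ) :
    iteratedDeriv k (fun z => p.eval z) 0 = k.factorial * p.coeff k := by
  rw [iteratedDeriv_polynomial_eval]
  simp only
  rw [← Polynomial.coeff_zero_eq_eval_zero, Polynomial.coeff_iterate_derivative, zero_add,
    Nat.descFactorial_self, nsmul_eq_mul]

/-- The Taylor coefficients up to order `R` of `H ∘ p`, where `p 0 = 0`, only depend on the Taylor
polynomial of degree `R` of `H`. -/
lemma iteratedDeriv_comp_polynomial_zero {H : ℂ → ℂ} (hH : Differentiable ℂ H) {p : Polynomial ℂ}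
    (hp : p.eval 0 = 0) {k R : ℕ} (hk : k ≤ R) :
    iteratedDeriv k (fun z => H (p.eval z)) 0 = k.factorial *
      (∑ l ∈ Finset.range (R + 1),
        Polynomial.C (iteratedDeriv l H 0 / l.factorial) * p ^ l).coeff k := by
  set T : Polynomial ℂ := ∑ l ∈ Finset.range (R + 1),
    Polynomial.C (iteratedDeriv l H 0 / l.factorial) * Polynomial.X ^ l with hT
  have hTc : ∀ i ≤ R, T.coeff i = iteratedDeriv i H 0 / i.factorial := by
    intro i hi
    rw [hT, Polynomial.finsetSum_coeff]
    simp only [Polynomial.coeff_C_mul, Polynomial.coeff_X_pow, mul_ite, mul_one, mul_zero]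
    rw [Finset.sum_ite_eq, if_pos (by simp; omega)]
  have hTp : T.comp p = ∑ l ∈ Finset.range (R + 1),
      Polynomial.C (iteratedDeriv l H 0 / l.factorial) * p ^ l := by
    rw [hT, Polynomial.comp, Polynomial.eval₂_finsetSum]
    simp
  have hHa : AnalyticAt ℂ H 0 := hH.analyticAt 0
  have hpoly : ∀ q : Polynomial ℂ, Differentiable ℂ fun z => q.eval z := fun q => q.differentiable
  have hTd : Differentiable ℂ fun z => T.eval z := hpoly T
  -- `H - T` has a zero of order greater than `R` at `0`, hence so has its composition with `p`.
  have hE : AnalyticAt ℂ (fun z => H z - T.eval z) 0 := (hH.sub hTd).analyticAt 0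
  have hord : ((R + 1 : ℕ) : ℕ∞) ≤ analyticOrderAt (fun z => H z - T.eval z) 0 := by
    rw [natCast_le_analyticOrderAt_iff_iteratedDeriv_eq_zero hE]
    intro i hi
    rw [iteratedDeriv_fun_sub hH.contDiff.contDiffAt hTd.contDiff.contDiffAt,
      iteratedDeriv_polynomial_eval_zero, hTc i (by omega)]
    have : (i.factorial : ℂ) ≠ 0 := by exact_mod_cast i.factorial_ne_zero
    field_simp
    ring
  rw [natCast_le_analyticOrderAt hE] at hord
  obtain ⟨g, hg, hge⟩ := hord
  obtain ⟨q, hq⟩ : Polynomial.X ∣ p :=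
    Polynomial.X_dvd_iff.mpr (by rw [Polynomial.coeff_zero_eq_eval_zero, hp])
  have hpd : Differentiable ℂ fun z => p.eval z := hpoly p
  have hD : AnalyticAt ℂ (fun z => H (p.eval z) - T.eval (p.eval z)) 0 :=
    ((hH.comp hpd).sub (hTd.comp hpd)).analyticAt 0
  have hord2 : ((R + 1 : ℕ) : ℕ∞) ≤
      analyticOrderAt (fun z => H (p.eval z) - T.eval (p.eval z)) 0 := by
    rw [natCast_le_analyticOrderAt hD]
    refine ⟨fun z => (q.eval z) ^ (R + 1) * g (p.eval z), ?_, ?_⟩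
    · refine (((hpoly q).analyticAt 0).pow _).mul ?_
      refine AnalyticAt.fun_comp (f := fun z => p.eval z) ?_ (hpd.analyticAt 0)
      rw [hp]; exact hg
    · have hcont : Filter.Tendsto (fun z => p.eval z) (nhds 0) (nhds 0) := by
        have := hpd.continuous.tendsto (0 : ℂ)
        simpa only [hp] using this
      filter_upwards [hcont.eventually hge] with z hz
      rw [hz]
      have e : p.eval z = z * q.eval z := by rw [hq]; simp
      simp only [sub_zero, smul_eq_mul]
      rw [e, mul_pow]
      ring
  rw [natCast_le_analyticOrderAt_iff_iteratedDeriv_eq_zero hD] at hord2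
  have h1 := hord2 k (by omega)
  have hHp : Differentiable ℂ fun z => H (p.eval z) := hH.comp hpd
  have hTq : Differentiable ℂ fun z => T.eval (p.eval z) := hTd.comp hpd
  rw [iteratedDeriv_fun_sub hHp.contDiff.contDiffAt hTq.contDiff.contDiffAt, sub_eq_zero] at h1
  rw [h1, ← hTp]
  have : (fun z => T.eval (p.eval z)) = fun z => (T.comp p).eval z := by
    funext z; rw [Polynomial.eval_comp]
  rw [this, iteratedDeriv_polynomial_eval_zero]

/-- The recurrence for the Taylor coefficients of a branch of the logarithm, from `F' = f' F`. -/
lemma taylor_coeff_log {F f : ℂ → ℂ} (hF : Differentiable ℂ F) {β : ℝ} (hβ : 0 < β)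
    (hf : DifferentiableOn ℂ f (Metric.ball 0 β)) (hf0 : f 0 = 0)
    (he : ∀ z ∈ Metric.ball (0 : ℂ) β, Complex.exp (f z) = F z) (k : ℕ) :
    (k : ℂ) * (iteratedDeriv k f 0 / k.factorial) =
      k * (iteratedDeriv k F 0 / k.factorial) -
        ∑ j ∈ Finset.range k, (j : ℂ) * (iteratedDeriv j f 0 / j.factorial) *
          (iteratedDeriv (k - j) F 0 / (k - j).factorial) := by
  have hmem : Metric.ball (0 : ℂ) β ∈ nhds (0 : ℂ) := Metric.ball_mem_nhds _ hβ
  rcases k with _ | k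
  · simp
  have hder : deriv F =ᶠ[nhds 0] fun z => deriv f z * F z := by
    filter_upwards [Metric.isOpen_ball.mem_nhds (Metric.mem_ball_self hβ)] with z hz
    have h1 : HasDerivAt f (deriv f z) z :=
      (hf.differentiableAt (Metric.isOpen_ball.mem_nhds hz)).hasDerivAt
    have h2 : F =ᶠ[nhds z] fun z => Complex.exp (f z) := by
      filter_upwards [Metric.isOpen_ball.mem_nhds hz] with y hy using (he y hy).symm
    rw [h2.deriv_eq, h1.cexp.deriv, ← he z hz, mul_comm]
  have hfa : AnalyticAt ℂ f 0 := hf.analyticAt hmem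
  have hL := hder.iteratedDeriv_eq k
  rw [iteratedDeriv_fun_mul hfa.deriv.contDiffAt hF.contDiff.contDiffAt, ← iteratedDeriv_succ'] at hL
  simp only [← iteratedDeriv_succ'] at hL
  have hF0 : iteratedDeriv 0 F 0 = 1 := by
    rw [iteratedDeriv_zero, ← he 0 (Metric.mem_ball_self hβ), hf0, Complex.exp_zero]
  have hk0 : (k.factorial : ℂ) ≠ 0 := by exact_mod_cast k.factorial_ne_zero
  have hk1 : ((k : ℂ) + 1) ≠ 0 := by exact_mod_cast k.succ_ne_zero
  have e1 : ((k + 1 : ℕ) : ℂ) * (iteratedDeriv (k + 1) F 0 / (k + 1).factorial) =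
      ∑ j ∈ Finset.range (k + 1), ((j + 1 : ℕ) : ℂ) * (iteratedDeriv (j + 1) f 0 / (j + 1).factorial) *
          (iteratedDeriv (k - j) F 0 / (k - j).factorial) := by
    rw [hL, Finset.sum_div, Finset.mul_sum]
    refine Finset.sum_congr rfl fun j hj => ?_
    have hjk : j ≤ k := by simp at hj; omega
    have hj0 : (j.factorial : ℂ) ≠ 0 := by exact_mod_cast j.factorial_ne_zero
    have hj1 : ((j : ℂ) + 1) ≠ 0 := by exact_mod_cast j.succ_ne_zero
    have hkj : ((k - j).factorial : ℂ) ≠ 0 := by exact_mod_cast (k - j).factorial_ne_zero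
    rw [Nat.cast_choose ℂ hjk, Nat.factorial_succ, Nat.factorial_succ]
    push_cast
    field_simp
  rw [e1, Finset.sum_range_succ, Nat.sub_self, hF0]
  have e2 : ∑ j ∈ Finset.range (k + 1), (j : ℂ) * (iteratedDeriv j f 0 / j.factorial) *
          (iteratedDeriv (k + 1 - j) F 0 / (k + 1 - j).factorial) =
      ∑ j ∈ Finset.range k, ((j + 1 : ℕ) : ℂ) * (iteratedDeriv (j + 1) f 0 / (j + 1).factorial) *
          (iteratedDeriv (k - j) F 0 / (k - j).factorial) := by
    rw [Finset.sum_range_succ']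
    simp
  rw [e2]
  simp

/-- `k` times the `k`-th coefficient of the logarithm of the power series with coefficients `a`,
where `a 0 = 1`. -/
noncomputable def logDerivCoeff (a : ℕ → ℝ) (k : ℕ) : ℝ :=
  k * a k - ∑ j : Fin k, logDerivCoeff a j.1 * a (k - j.1)
termination_by k
decreasing_by exact j.2

lemma logDerivCoeff_eq (a : ℕ → ℝ) (k : ℕ) :
    logDerivCoeff a k = k * a k - ∑ j ∈ Finset.range k, logDerivCoeff a j * a (k - j) := by
  rw [logDerivCoeff, ← Finset.sum_range (fun j => logDerivCoeff a j * a (k - j))]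

lemma taylorAtOne_eq_sum_logDerivCoeff {F f : ℂ → ℂ} (hF : Differentiable ℂ F) {β : ℝ} (hβ : 0 < β)
    (hf : DifferentiableOn ℂ f (Metric.ball 0 β)) (hf0 : f 0 = 0)
    (he : ∀ z ∈ Metric.ball (0 : ℂ) β, Complex.exp (f z) = F z) {R : ℕ} {a : ℕ → ℝ}
    (ha : ∀ k ≤ R, iteratedDeriv k F 0 = k.factorial * (a k : ℂ)) :
    taylorAtOne f R = ((∑ k ∈ Finset.range (R + 1), logDerivCoeff a k / k : ℝ) : ℂ) := by
  have ha' : ∀ k ≤ R, iteratedDeriv k F 0 / k.factorial = (a k : ℂ) := by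
    intro k hk
    have : (k.factorial : ℂ) ≠ 0 := by exact_mod_cast k.factorial_ne_zero
    rw [ha k hk]; field_simp
  have key : ∀ k ≤ R, (k : ℂ) * (iteratedDeriv k f 0 / k.factorial) = (logDerivCoeff a k : ℂ) := by
    intro k
    induction k using Nat.strong_induction_on with
    | _ k ih =>
      intro hk
      rw [taylor_coeff_log hF hβ hf hf0 he k, ha' k hk, logDerivCoeff_eq]
      push_cast
      congr 1
      refine Finset.sum_congr rfl fun j hj => ?_
      simp only [Finset.mem_range] at hj
      rw [ih j hj (by omega), ha' (k - j) (by omega)]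
  unfold taylorAtOne
  push_cast
  refine Finset.sum_congr rfl fun k hk => ?_
  simp only [Finset.mem_range] at hk
  rw [← key k (by omega)]
  rcases k with _ | k
  · simp [hf0]
  · have : ((k + 1 : ℕ) : ℂ) ≠ 0 := by exact_mod_cast k.succ_ne_zero
    field_simp

/-! ### Moments of the number of edges in a random set -/

section

variable {n m : ℕ} {G : SimpleGraph (Fin n)} {γ : ℝ}

/-- The average of `arcCount ^ l` over the `m`-sets. -/
noncomputable def moment (m : ℕ) (G : SimpleGraph (Fin n)) (l : ℕ) : ℝ :=
  (n.choose m : ℝ)⁻¹ * ∑ S ∈ (Finset.univ : Finset (Fin n)).powersetCard m, (arcCount G S : ℝ) ^ l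

lemma iteratedDeriv_denFun_zero (l : ℕ) :
    iteratedDeriv l (denFun m G γ) 0 = (((γ / ((m : ℝ) - 1)) ^ l * moment m G l : ℝ) : ℂ) := by
  have hexp : ∀ x : ℂ, iteratedDeriv l (fun z => Complex.exp (z * x)) 0 = x ^ l := by
    intro x
    have := congrFun (iteratedDeriv_cexp_const_mul l x) 0
    simp only [mul_comm x] at this
    simpa using this
  unfold denFun
  rw [iteratedDeriv_const_mul_field, iteratedDeriv_fun_sum (fun S _ => by fun_prop)]
  simp only [hexp, moment]
  push_cast
  rw [mul_left_comm, Finset.mul_sum, Finset.mul_sum, Finset.mul_sum]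
  refine Finset.sum_congr rfl fun S _ => ?_
  rw [mul_pow]

/-- The Taylor coefficients of `denFun ∘ φ` in terms of the moments. -/
noncomputable def compCoeff (m : ℕ) (G : SimpleGraph (Fin n)) (γ : ℝ) (φ : Polynomial ℝ) (R k : ℕ) : ℝ :=
  ∑ l ∈ Finset.range (R + 1),
    (γ / ((m : ℝ) - 1)) ^ l * moment m G l / l.factorial * (φ ^ l).coeff k

lemma iteratedDeriv_denFun_comp {φ : Polynomial ℝ} (hφ : φ.eval 0 = 0) {k R : ℕ} (hk : k ≤ R) :
    iteratedDeriv k (fun z => denFun m G γ (Polynomial.aeval z φ)) 0 =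
      k.factorial * (compCoeff m G γ φ R k : ℂ) := by
  have h1 : ∀ z : ℂ, Polynomial.aeval z φ = (φ.map (algebraMap ℝ ℂ)).eval z := fun z => by
    rw [Polynomial.eval_map_algebraMap]
  simp only [h1]
  rw [iteratedDeriv_comp_polynomial_zero differentiable_denFun ?_ hk]
  · congr 1
    rw [Polynomial.finsetSum_coeff, compCoeff]
    push_cast
    refine Finset.sum_congr rfl fun l _ => ?_
    rw [Polynomial.coeff_C_mul, iteratedDeriv_denFun_zero, ← Polynomial.map_pow, Polynomial.coeff_map]
    push_cast
    rfl
  · rw [← h1]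
    have := Polynomial.aeval_algebraMap_apply ℂ (0 : ℝ) φ
    simpa [hφ] using this

/-- The probability that a random `m`-subset of `n` elements contains `v ≤ n` given elements. -/
noncomputable def containProb (n m v : ℕ) : ℝ := ∏ c ∈ Finset.range v, ((m : ℝ) - c) / ((n : ℝ) - c)

/-- For `Z = 0`, all one-element extensions of a set have the same value, by symmetry. -/
lemma Pext_zero_eq (hmn : m ≤ n) (U : Finset (Fin n)) :
    (n.choose m : ℂ)⁻¹ * Pext m (0 : Matrix (Fin n) (Fin n) ℂ) U = (containProb n m U.card : ℂ) := by
  induction U using Finset.induction_on with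
  | empty =>
    have hc : (n.choose m : ℂ) ≠ 0 := by exact_mod_cast (Nat.choose_pos hmn).ne'
    simp [Pext, pairSum, containProb, hc]
  | insert b Ω hb ih =>
    have h1 := sum_Pext_insert m (0 : Matrix (Fin n) (Fin n) ℂ) Ω
    have h2 : ∀ j ∈ Ωᶜ, Pext m (0 : Matrix (Fin n) (Fin n) ℂ) (insert j Ω) =
        Pext m (0 : Matrix (Fin n) (Fin n) ℂ) (insert b Ω) := by
      intro j hj
      have := Pext_submatrix (m := m) (Z := (0 : Matrix (Fin n) (Fin n) ℂ)) (by
        exact Matrix.isSymm_zero) (Equiv.swap b j) (insert b Ω)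
      rw [map_swap_insert hb (by simpa using hj)] at this
      rw [← this]
      rfl
    have hlt : Ω.card < n := by
      have := Finset.card_lt_univ_of_notMem hb
      simpa using this
    rw [Finset.sum_congr rfl h2, Finset.sum_const, Finset.card_compl, Fintype.card_fin,
      nsmul_eq_mul, Nat.cast_sub hlt.le] at h1
    have hne : (n : ℂ) - Ω.card ≠ 0 := by
      rw [sub_ne_zero]; exact_mod_cast hlt.ne'
    rw [Finset.card_insert_of_notMem hb, containProb, Finset.prod_range_succ, ← containProb]
    push_cast
    rw [← ih]
    field_simp
    linear_combination h1 / (n.choose m : ℂ)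

/-- The recursion that computes the moments: `momentRec m G l U` is the average of `arcCount ^ l` over
the `m`-sets, restricted to those that contain `U`. -/
noncomputable def momentRec (m : ℕ) (G : SimpleGraph (Fin n)) : ℕ → Finset (Fin n) → ℝ
  | 0, U => containProb n m U.card
  | l + 1, U => ∑ i, ∑ j, (adjNat G i j : ℝ) * momentRec m G l (insert j (insert i U))

lemma momentRec_eq (hmn : m ≤ n) (l : ℕ) (U : Finset (Fin n)) :
    momentRec m G l U = (n.choose m : ℝ)⁻¹ *
      ∑ S ∈ (Finset.univ : Finset (Fin n)).powersetCard m,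
        if U ⊆ S then (arcCount G S : ℝ) ^ l else 0 := by
  induction l generalizing U with
  | zero =>
    have := Pext_zero_eq hmn U
    rw [Pext] at this
    simp only [pairSum, Matrix.zero_apply, Finset.sum_const_zero, Complex.exp_zero] at this
    rw [momentRec]
    simp only [pow_zero]
    apply Complex.ofReal_injective
    rw [← this]
    push_cast
    congr 1
    refine Finset.sum_congr rfl fun S _ => ?_
    split_ifs <;> simp
  | succ l ih =>
    rw [momentRec]
    simp only [ih, Finset.mul_sum]
    have e1 : ∀ i : Fin n, ∑ j, ∑ S ∈ (Finset.univ : Finset (Fin n)).powersetCard m,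
        (adjNat G i j : ℝ) * ((n.choose m : ℝ)⁻¹ *
          if insert j (insert i U) ⊆ S then (arcCount G S : ℝ) ^ l else 0) =
        ∑ S ∈ (Finset.univ : Finset (Fin n)).powersetCard m, ∑ j,
        (adjNat G i j : ℝ) * ((n.choose m : ℝ)⁻¹ *
          if insert j (insert i U) ⊆ S then (arcCount G S : ℝ) ^ l else 0) :=
      fun i => Finset.sum_comm
    simp only [e1]
    rw [Finset.sum_comm]
    refine Finset.sum_congr rfl fun S _ => ?_
    by_cases hU : U ⊆ S
    · simp only [Finset.insert_subset_iff, hU, and_true, if_true]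
      rw [pow_succ]
      conv_rhs => rw [arcCount]
      push_cast
      rw [Finset.mul_sum, Finset.mul_sum, ← Finset.sum_subset (Finset.subset_univ S)]
      · refine Finset.sum_congr rfl fun i hi => ?_
        rw [Finset.mul_sum, Finset.mul_sum, ← Finset.sum_subset (Finset.subset_univ S)]
        · refine Finset.sum_congr rfl fun j hj => ?_
          rw [if_pos ⟨hj, hi⟩, arcCount]
          push_cast
          ring
        · intro j _ hj
          rw [if_neg (fun h => hj h.1)]; ring
      · intro i _ hi
        refine Finset.sum_eq_zero fun j _ => ?_
        rw [if_neg (fun h => hi h.2)]; ring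
    · simp [Finset.insert_subset_iff, hU]

lemma momentRec_empty (hmn : m ≤ n) (l : ℕ) : momentRec m G l ∅ = moment m G l := by
  rw [momentRec_eq hmn, moment]
  simp

end

end DensePartition

namespace RealRAM

open DensePartition

/-! ### Bounded loops on the real random access machine -/

/-- Programs whose loops are counted: `count i b p` runs `p` for `i = 0, 1, …` as long as `i` is
smaller than the natural variable `b`.  The variable `i + 1` is used to control the loop. -/
inductive Code where
  | instr (i : Instr)
  | seq (p q : Code)
  | ite (b : Test) (p q : Code)
  | count (i b : ℕ) (p : Code)

namespace Code

/-- The translation into a program.  In the loop, the variable `i + 1` exceeds `i` by one when the test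
is made, so that `i < b` can be tested with `≤`. -/
def compile : Code → Program
  | instr i => .instr i
  | seq p q => .seq p.compile q.compile
  | ite b p q => .ite b p.compile q.compile
  | count i b p =>
      .seq (.seq (.instr (.natConst i 0)) (.instr (.natConst (i + 1) 1)))
        (.loop (.natLe (i + 1) b)
          (.seq p.compile (.seq (.instr (.natConst (i + 1) 1))
            (.seq (.instr (.natAdd i i (i + 1))) (.instr (.natAdd (i + 1) i (i + 1)))))))

/-- The memory at the start of a counted loop. -/
def start (i : ℕ) (s : State) : State :=
  { s with nat := Function.update (Function.update s.nat i 0) (i + 1) 1 }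

/-- Incrementing the counter of a counted loop. -/
def next (i : ℕ) (s : State) : State :=
  { s with nat := Function.update (Function.update s.nat i (s.nat i + 1)) (i + 1) (s.nat i + 2) }

lemma next_nat_self (i : ℕ) (s : State) : (next i s).nat i = s.nat i + 1 := by simp [next]

lemma next_nat_succ (i : ℕ) (s : State) : (next i s).nat (i + 1) = s.nat i + 1 + 1 := by simp [next]

lemma apply_eq_next (i : ℕ) (s : State) :
    (Instr.natAdd (i + 1) i (i + 1)).apply ((Instr.natAdd i i (i + 1)).apply
      ((Instr.natConst (i + 1) 1).apply s)) = next i s := by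
  simp only [Instr.apply, next]
  congr 1
  funext x
  rcases eq_or_ne x (i + 1) with rfl | h1
  · simp
  rcases eq_or_ne x i with rfl | h2
  · simp
  simp [h1, h2]

open Classical in
/-- The effect of a code on the memory. -/
noncomputable def denote : Code → State → State
  | instr i, s => i.apply s
  | seq p q, s => q.denote (p.denote s)
  | ite b p q, s => if b.holds s then p.denote s else q.denote s
  | count i b p, s => (fun s' => next i (p.denote s'))^[s.nat b] (start i s)

/-- The location written by an instruction: its kind (`0` for natural variables, `1` for real variables,
`2` for natural arrays, `3` for real arrays) and its name. -/
def target : Instr → ℕ × ℕ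
  | .natConst x _ => (0, x)
  | .natAdd x _ _ => (0, x)
  | .natSub x _ _ => (0, x)
  | .natLoad x _ _ => (0, x)
  | .natStore a _ _ => (2, a)
  | .realConst x _ => (1, x)
  | .realOfNat x _ => (1, x)
  | .realAdd x _ _ => (1, x)
  | .realSub x _ _ => (1, x)
  | .realMul x _ _ => (1, x)
  | .realDiv x _ _ => (1, x)
  | .realLoad x _ _ => (1, x)
  | .realStore a _ _ => (3, a)

/-- `p.keeps k x` means that the location with kind `k` and name `x` is not written by `p`. -/
def keeps (k x : ℕ) : Code → Bool
  | instr i => target i != (k, x)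
  | seq p q => p.keeps k x && q.keeps k x
  | ite _ p q => p.keeps k x && q.keeps k x
  | count i _ p => (k, x) != (0, i) && (k, x) != (0, i + 1) && p.keeps k x

/-- The memories `s` and `s'` agree at all locations that are not written by `p`. -/
structure Agrees (p : Code) (s s' : State) : Prop where
  nat : ∀ x, p.keeps 0 x = true → s'.nat x = s.nat x
  real : ∀ x, p.keeps 1 x = true → s'.real x = s.real x
  natArr : ∀ x, p.keeps 2 x = true → s'.natArr x = s.natArr x
  realArr : ∀ x, p.keeps 3 x = true → s'.realArr x = s.realArr x

lemma Agrees.trans {p : Code} {s s' s'' : State} (h : Agrees p s s') (h' : Agrees p s' s'') :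
    Agrees p s s'' :=
  ⟨fun x hx => (h'.nat x hx).trans (h.nat x hx), fun x hx => (h'.real x hx).trans (h.real x hx),
    fun x hx => (h'.natArr x hx).trans (h.natArr x hx),
    fun x hx => (h'.realArr x hx).trans (h.realArr x hx)⟩

lemma Agrees.mono {p q : Code} (hpq : ∀ k x, q.keeps k x = true → p.keeps k x = true) {s s' : State}
    (h : Agrees p s s') : Agrees q s s' :=
  ⟨fun x hx => h.nat x (hpq _ _ hx), fun x hx => h.real x (hpq _ _ hx),
    fun x hx => h.natArr x (hpq _ _ hx), fun x hx => h.realArr x (hpq _ _ hx)⟩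

lemma agrees_instr (i : Instr) (s : State) : Agrees (instr i) s (i.apply s) := by
  constructor <;> intro x hx <;> cases i <;>
    first
    | rfl
    | (refine Function.update_of_ne ?_ _ _
       rintro rfl
       simp [keeps, target] at hx)

lemma agrees_start (i b : ℕ) (p : Code) (s : State) : Agrees (count i b p) s (start i s) := by
  constructor <;> intro x hx <;> simp_all [keeps, start]

lemma agrees_next (i b : ℕ) (p : Code) (s : State) : Agrees (count i b p) s (next i s) := by
  constructor <;> intro x hx <;> simp_all [keeps, next]

lemma agrees_denote (p : Code) (s : State) : Agrees p s (p.denote s) := by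
  induction p generalizing s with
  | instr i => exact agrees_instr i s
  | seq p q ihp ihq =>
    exact ((ihp s).mono fun k x h => by simp_all [keeps]).trans
      ((ihq _).mono fun k x h => by simp_all [keeps])
  | ite b p q ihp ihq =>
    rw [denote]
    split_ifs
    · exact (ihp s).mono fun k x h => by simp_all [keeps]
    · exact (ihq s).mono fun k x h => by simp_all [keeps]
  | count i b p ih =>
    rw [denote]
    generalize s.nat b = N
    induction N with
    | zero => exact agrees_start i b p s
    | succ N ihN =>
      rw [Function.iterate_succ_apply']
      exact (ihN.trans ((ih _).mono fun k x h => by simp_all [keeps])).trans (agrees_next i b p _)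

/-- The values of the variables in `A` bound all numbers of iterations: every loop is controlled by a
variable of `A`, or by the counter of an enclosing loop, and these are not changed inside. -/
def bounded (A : List ℕ) : Code → Bool
  | instr i => A.all fun x => target i != (0, x)
  | seq p q => p.bounded A && q.bounded A
  | ite _ p q => p.bounded A && q.bounded A
  | count i b p => A.contains b && !A.contains i && !A.contains (i + 1) && p.bounded (i :: A)

lemma keeps_of_bounded {A : List ℕ} {p : Code} (h : p.bounded A = true) {x : ℕ} (hx : x ∈ A) :
    p.keeps 0 x = true := by
  induction p generalizing A with
  | instr i =>
    simp only [bounded, List.all_eq_true] at h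
    exact h x hx
  | seq p q ihp ihq =>
    simp only [bounded, Bool.and_eq_true] at h
    simp [keeps, ihp h.1 hx, ihq h.2 hx]
  | ite b p q ihp ihq =>
    simp only [bounded, Bool.and_eq_true] at h
    simp [keeps, ihp h.1 hx, ihq h.2 hx]
  | count i b p ih =>
    simp only [bounded, Bool.and_eq_true, Bool.not_eq_true', List.contains_eq_mem,
      decide_eq_true_eq, decide_eq_false_iff_not] at h
    have h1 : x ≠ i := fun e => h.1.1.2 (e ▸ hx)
    have h2 : x ≠ i + 1 := fun e => h.1.2 (e ▸ hx)
    simp [keeps, h1, h2, ih h.2 (List.mem_cons_of_mem _ hx)]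

/-- A bound for the number of steps when all loops have at most `B` iterations. -/
def time (B : ℕ) : Code → ℕ
  | instr _ => 1
  | seq p q => p.time B + q.time B
  | ite _ p q => p.time B + q.time B + 1
  | count _ _ p => 3 + B * (p.time B + 4)

/-- The counter after `k` rounds of a loop. -/
lemma iterate_nat_counter {i b : ℕ} {p : Code} {A : List ℕ} (h : (count i b p).bounded A = true)
    (s : State) (k : ℕ) :
    let s' := (fun s' => next i (p.denote s'))^[k] (start i s)
    s'.nat i = k ∧ s'.nat (i + 1) = k + 1 ∧ Agrees (count i b p) s s' := by
  have hi : p.keeps 0 i = true := by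
    simp only [bounded, Bool.and_eq_true] at h
    exact keeps_of_bounded h.2 (by simp)
  induction k with
  | zero =>
    refine ⟨by simp [start], by simp [start], agrees_start i b p s⟩
  | succ k ih =>
    obtain ⟨h1, h2, h3⟩ := ih
    rw [Function.iterate_succ_apply']
    have h4 := (agrees_denote p ((fun s' => next i (p.denote s'))^[k] (start i s))).nat i hi
    refine ⟨?_, ?_, ?_⟩
    · rw [next_nat_self, h4, h1]
    · rw [next_nat_succ, h4, h1]
    · exact (h3.trans ((agrees_denote p _).mono fun k x h => by simp_all [keeps])).trans
        (agrees_next i b p _)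

/-- Induction for counted loops.  At the beginning of round `k` the counter has the value `k`, and all
locations that are not written in the loop have their original values. -/
lemma denote_count_induction {i b : ℕ} {p : Code} {s : State} {A : List ℕ}
    (hb : (count i b p).bounded A = true) (Inv : ℕ → State → Prop)
    (h0 : Inv 0 (start i s))
    (hstep : ∀ k < s.nat b, ∀ s', Agrees (count i b p) s s' → s'.nat i = k → Inv k s' →
      Inv (k + 1) (next i (p.denote s'))) :
    Inv (s.nat b) ((count i b p).denote s) := by
  have key : ∀ k ≤ s.nat b, Inv k ((fun s' => next i (p.denote s'))^[k] (start i s)) := by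
    intro k
    induction k with
    | zero => intro _; exact h0
    | succ k ih =>
      intro hk
      rw [Function.iterate_succ_apply']
      obtain ⟨h1, -, h3⟩ := iterate_nat_counter hb s k
      exact hstep k (by omega) _ h3 h1 (ih (by omega))
  exact key _ le_rfl

lemma runs_loop {i b : ℕ} {p : Code} {A : List ℕ} (hb : (count i b p).bounded A = true)
    (s : State) {c : ℕ}
    (hp : ∀ k < s.nat b, ∃ t ≤ c, Runs p.compile ((fun s' => next i (p.denote s'))^[k] (start i s))
      (p.denote ((fun s' => next i (p.denote s'))^[k] (start i s))) t) :
    ∀ j k, k + j = s.nat b → ∃ t ≤ j * (c + 4) + 1, Runs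
      (.loop (.natLe (i + 1) b) (.seq p.compile (.seq (.instr (.natConst (i + 1) 1))
        (.seq (.instr (.natAdd i i (i + 1))) (.instr (.natAdd (i + 1) i (i + 1)))))))
      ((fun s' => next i (p.denote s'))^[k] (start i s)) ((count i b p).denote s) t := by
  have hbk : (count i b p).keeps 0 b = true := by
    have h' := hb
    simp only [bounded, Bool.and_eq_true, List.contains_eq_mem, decide_eq_true_eq] at h'
    exact keeps_of_bounded hb h'.1.1.1
  intro j
  induction j with
  | zero =>
    intro k hk
    obtain ⟨h1, h2, h3⟩ := iterate_nat_counter hb s k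
    refine ⟨1, by simp, ?_⟩
    rw [denote, ← hk, add_zero]
    refine Runs.loop_false ?_
    simp only [Test.holds]
    rw [h2, h3.nat b hbk]
    omega
  | succ j ih =>
    intro k hk
    obtain ⟨h1, h2, h3⟩ := iterate_nat_counter hb s k
    obtain ⟨t, ht, hr⟩ := hp k (by omega)
    obtain ⟨t', ht', hr'⟩ := ih (k + 1) (by omega)
    refine ⟨t + (1 + (1 + 1)) + t' + 1, ?_, ?_⟩
    · rw [Nat.succ_mul]; omega
    · refine Runs.loop_true ?_ (Runs.seq hr (Runs.seq (Runs.instr _ _)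
        (Runs.seq (Runs.instr _ _) (Runs.instr _ _)))) ?_
      · simp only [Test.holds]
        rw [h2, h3.nat b hbk]
        omega
      · rw [Function.iterate_succ_apply'] at hr'
        rwa [apply_eq_next]

/-- A code with bounded loops runs in the time `time B`. -/
theorem runs_compile {p : Code} {A : List ℕ} {B : ℕ} (hb : p.bounded A = true) {s : State}
    (hA : ∀ x ∈ A, s.nat x ≤ B) :
    ∃ t ≤ p.time B, Runs p.compile s (p.denote s) t := by
  induction p generalizing A s with
  | instr i => exact ⟨1, le_rfl, Runs.instr i s⟩
  | seq p q ihp ihq =>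
    simp only [bounded, Bool.and_eq_true] at hb
    obtain ⟨t, ht, hr⟩ := ihp hb.1 hA
    obtain ⟨t', ht', hr'⟩ := ihq hb.2 (s := p.denote s) fun x hx => by
      rw [(agrees_denote p s).nat x (keeps_of_bounded hb.1 hx)]
      exact hA x hx
    exact ⟨t + t', by simp only [time]; omega, Runs.seq hr hr'⟩
  | ite b p q ihp ihq =>
    simp only [bounded, Bool.and_eq_true] at hb
    rw [denote]
    by_cases h : b.holds s
    · rw [if_pos h]
      obtain ⟨t, ht, hr⟩ := ihp hb.1 hA
      exact ⟨t + 1, by simp only [time]; omega, Runs.ite_true h hr⟩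
    · rw [if_neg h]
      obtain ⟨t, ht, hr⟩ := ihq hb.2 hA
      exact ⟨t + 1, by simp only [time]; omega, Runs.ite_false h hr⟩
  | count i b p ih =>
    have hb' := hb
    simp only [bounded, Bool.and_eq_true, List.contains_eq_mem, decide_eq_true_eq] at hb'
    have hbB : s.nat b ≤ B := hA b hb'.1.1.1
    obtain ⟨t, ht, hr⟩ := runs_loop hb s (c := p.time B) (fun k hk => by
      obtain ⟨h1, h2, h3⟩ := iterate_nat_counter hb s k
      refine ih hb'.2 fun x hx => ?_
      rcases List.mem_cons.mp hx with rfl | hx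
      · rw [h1]; omega
      · rw [h3.nat x (keeps_of_bounded hb hx)]
        exact hA x hx) (s.nat b) 0 (by omega)
    refine ⟨1 + 1 + t, ?_, Runs.seq (Runs.seq (Runs.instr _ _) (Runs.instr _ _)) hr⟩
    simp only [time]
    have := Nat.mul_le_mul_right (p.time B + 4) hbB
    omega

/-- The size of a code, for the time bound. -/
def size : Code → ℕ
  | instr _ => 1
  | seq p q => p.size + q.size
  | ite _ p q => p.size + q.size + 1
  | count _ _ p => p.size + 4

/-- The nesting depth of the loops. -/
def depth : Code → ℕ
  | instr _ => 0
  | seq p q => max p.depth q.depth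
  | ite _ p q => max p.depth q.depth
  | count _ _ p => p.depth + 1

lemma time_le (B : ℕ) (p : Code) : ∀ d, p.depth ≤ d → p.time B ≤ p.size * (B + 1) ^ d := by
  induction p with
  | instr i => intro d _; simpa [time, size] using Nat.one_le_pow _ _ (by omega)
  | seq p q ihp ihq =>
    intro d hd
    simp only [depth, max_le_iff] at hd
    have := ihp d hd.1
    have := ihq d hd.2
    simp only [time, size, add_mul]
    omega
  | ite b p q ihp ihq =>
    intro d hd
    simp only [depth, max_le_iff] at hd
    have := ihp d hd.1
    have := ihq d hd.2
    have := Nat.one_le_pow d (B + 1) (by omega)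
    simp only [time, size, add_mul]
    omega
  | count i b p ih =>
    intro d hd
    simp only [depth] at hd
    obtain ⟨d, rfl⟩ : ∃ e, d = e + 1 := ⟨d - 1, by omega⟩
    have h1 := ih d (by omega)
    have h2 := Nat.one_le_pow d (B + 1) (by omega)
    simp only [time, size, pow_succ]
    nlinarith [Nat.mul_le_mul_left B h1, Nat.mul_le_mul_left B h2]

end Code

/-! ### Building blocks of the program -/

open Code

local infixr:60 " ;; " => Code.seq

/-! Use of the memory.

* Natural variables: `0` and `1` hold `n` and `m`; `2` the order `R`; `3` and `4` hold `R + 1` and `n ^ 2`;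
  `5` holds `n ^ (2 R)`; `6` holds `n ^ (2 l)` in round `l` of the main loop; `10` to `19` are loop counters,
  in pairs; `20` to `23` hold the sequence of pairs that remains to be read, the next pair and its two
  vertices; `24` holds `1`; `33` holds the constant for the order; the others are auxiliary.
* Natural arrays: `0` is the adjacency matrix; `1` to `4` are the tables of quotients and remainders; `5`
  marks the vertices of a sequence of pairs.
* Real variables: `0` and `1` hold `γ` and `ε`; `3`, `4` and `6` hold `m`, `n` and `1`; `5` holds
  `γ / (m - 1)`; `7` is the product of the entries of the adjacency matrix along a sequence; `8` and `9` are
  the probability and the number belonging to the marked vertices; `10` is a moment; `11` is its coefficient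
  in the Taylor series; `15` is the result; the others are auxiliary.
* Real arrays: `0` holds the coefficients of `φ`; `1` and `2` those of its powers; `3` those of
  `denFun ∘ φ`; `4` those of its logarithmic derivative. -/


instance : Coe Instr Code := ⟨Code.instr⟩

lemma denote_seq (p q : Code) (s : State) : (p ;; q).denote s = q.denote (p.denote s) := rfl

/-- Multiply the natural variable `x` by the natural variable `y`. -/
def mulBy (x y : ℕ) : Code :=
  Instr.natConst 31 0 ;; Instr.natConst 32 0 ;; count 16 y (Instr.natAdd 32 32 x) ;;
    Instr.natAdd x 32 31

lemma denote_mulBy {x y : ℕ} (hx : x < 16) (hy : y < 16) (s : State) :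
    ((mulBy x y).denote s).nat x = s.nat x * s.nat y := by
  have hb : (count 16 y (Instr.natAdd 32 32 x)).bounded [y] = true := by
    simp [bounded, target]; omega
  set s1 : State := (Instr.natConst 32 0).apply ((Instr.natConst 31 0).apply s) with hs1
  have h := denote_count_induction hb (s := s1)
    (fun k s' => s'.nat 32 = k * s.nat x) (by simp [start, s1, Instr.apply])
    (fun k _ s' hs' _ ih => by
      have h1 : s'.nat x = s1.nat x := hs'.nat x (by simp [keeps, target]; omega)
      have h2 : s1.nat x = s.nat x := by
        simp [s1, Instr.apply, show x ≠ 32 by omega, show x ≠ 31 by omega]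
      simp only [next, denote, Instr.apply]
      simp [ih, h1, h2]
      ring)
  have hy1 : s1.nat y = s.nat y := by
    simp [s1, Instr.apply, show y ≠ 32 by omega, show y ≠ 31 by omega]
  have h31 : ((count 16 y (Instr.natAdd 32 32 x)).denote s1).nat 31 = 0 := by
    rw [(agrees_denote _ s1).nat 31 (by simp [keeps, target])]
    simp [s1, Instr.apply]
  simp only [mulBy, denote] at h h31 ⊢
  rw [← hs1]
  simp only [Instr.apply, Function.update_self]
  simp only [Instr.apply] at h h31
  rw [h, h31, hy1]
  ring

/-- One round of the loop of `tables`. -/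
def tablesStep : Code :=
  Instr.natStore 1 12 26 ;; Instr.natStore 2 12 27 ;;
  Instr.natStore 3 12 28 ;; Instr.natStore 4 12 29 ;;
  Instr.natAdd 27 27 24 ;;
  Code.ite (.natLe 0 27) (Instr.natConst 27 0 ;; Instr.natAdd 26 26 24) (Instr.natConst 25 0) ;;
  Instr.natAdd 29 29 24 ;;
  Code.ite (.natLe 4 29) (Instr.natConst 29 0 ;; Instr.natAdd 28 28 24) (Instr.natConst 25 0)

/-- Tables of quotients and remainders: for `t` below the natural variable `5`, the natural arrays `1` and
`2` receive the quotient and the remainder of `t` by the natural variable `0`, and the arrays `3` and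
`4` those by the natural variable `4`. -/
def tables : Code :=
  Instr.natConst 26 0 ;; Instr.natConst 27 0 ;; Instr.natConst 28 0 ;; Instr.natConst 29 0 ;;
  count 12 5 tablesStep

lemma succ_div_mod (t a : ℕ) (ha : 0 < a) :
    (a ≤ t % a + 1 → (t + 1) / a = t / a + 1 ∧ (t + 1) % a = 0) ∧
    (¬ a ≤ t % a + 1 → (t + 1) / a = t / a ∧ (t + 1) % a = t % a + 1) := by
  have h1 := Nat.mod_lt t ha
  have h2 := Nat.div_add_mod t a
  constructor
  · intro h
    have e : t + 1 = a * (t / a + 1) := by rw [mul_add]; omega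
    rw [e]
    exact ⟨Nat.mul_div_cancel_left _ ha, Nat.mul_mod_right _ _⟩
  · intro h
    have e : t + 1 = (t % a + 1) + a * (t / a) := by omega
    constructor
    · conv_lhs => rw [e]
      rw [Nat.add_mul_div_left _ _ ha, Nat.div_eq_of_lt (by omega), zero_add]
    · conv_lhs => rw [e]
      rw [Nat.add_mul_mod_self_left, Nat.mod_eq_of_lt (by omega)]

/-- The natural arrays `1`, `2`, `3`, `4` hold the quotients and remainders by `a` and `b` of all numbers
below `N`. -/
def HasTables (a b N : ℕ) (s : State) : Prop :=
  ∀ t < N, s.natArr 1 t = t / a ∧ s.natArr 2 t = t % a ∧ s.natArr 3 t = t / b ∧ s.natArr 4 t = t % b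

lemma denote_tables {s : State} (h0 : 0 < s.nat 0) (h4 : 0 < s.nat 4) (h24 : s.nat 24 = 1) :
    HasTables (s.nat 0) (s.nat 4) (s.nat 5) (tables.denote s) := by
  simp only [tables]
  rw [denote_seq, denote_seq, denote_seq, denote_seq]
  set s1 : State := denote (Instr.natConst 29 0) _ with hs1
  have e0 : s1.nat 0 = s.nat 0 := by simp [s1, denote, Instr.apply]
  have e4 : s1.nat 4 = s.nat 4 := by simp [s1, denote, Instr.apply]
  have e5 : s1.nat 5 = s.nat 5 := by simp [s1, denote, Instr.apply]
  have e24 : s1.nat 24 = 1 := by simp [s1, denote, Instr.apply, h24]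
  rw [← e5]
  have hb : (count 12 5 tablesStep).bounded [5] = true := by decide
  refine (denote_count_induction hb (fun k s' => HasTables (s.nat 0) (s.nat 4) k s' ∧
    s'.nat 26 = k / s.nat 0 ∧ s'.nat 27 = k % s.nat 0 ∧ s'.nat 28 = k / s.nat 4 ∧
      s'.nat 29 = k % s.nat 4) ?_ ?_).1
  · refine ⟨fun t ht => by omega, ?_⟩
    simp [start, s1, denote, Instr.apply]
  · intro k hk s' hs' hi ⟨hT, i1, i2, i3, i4⟩
    have f0 : s'.nat 0 = s.nat 0 := (hs'.nat 0 (by decide)).trans e0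
    have f4 : s'.nat 4 = s.nat 4 := (hs'.nat 4 (by decide)).trans e4
    have f24 : s'.nat 24 = 1 := (hs'.nat 24 (by decide)).trans e24
    obtain ⟨d1, d2⟩ := succ_div_mod k _ h0
    obtain ⟨d3, d4⟩ := succ_div_mod k _ h4
    have hT' : ∀ t < k + 1,
        (if t = k then k / s.nat 0 else s'.natArr 1 t) = t / s.nat 0 ∧
        (if t = k then k % s.nat 0 else s'.natArr 2 t) = t % s.nat 0 ∧
        (if t = k then k / s.nat 4 else s'.natArr 3 t) = t / s.nat 4 ∧
        (if t = k then k % s.nat 4 else s'.natArr 4 t) = t % s.nat 4 := by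
      intro t ht
      split_ifs with htk
      · subst htk; simp
      · exact hT t (by omega)
    by_cases c1 : s.nat 0 ≤ k % s.nat 0 + 1 <;> by_cases c2 : s.nat 4 ≤ k % s.nat 4 + 1 <;>
    · refine ⟨fun t ht => ?_, ?_⟩
      · convert hT' t ht using 2 <;>
        simp [tablesStep, denote, next, Test.holds, Instr.apply, Function.update_apply, hi, f0, f4,
          f24, i1, i2, i3, i4, c1, c2]
      · simp [tablesStep, denote, next, Test.holds, Instr.apply, f0, f4, f24,
          i1, i2, i3, i4, c1, c2, d1, d2, d3, d4]

/-! ### Enumeration of the tuples of pairs of vertices -/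

/-- Mark the vertex in the natural variable `x`.  If it is new, the probability in the real variable `8`
that a random set contains all marked vertices, and their number, in the real variable `9`, are updated. -/
def mark (x : ℕ) : Code :=
  Instr.natLoad 25 5 x ;;
  Code.ite (.natLe 24 25) (Instr.natConst 25 0)
    (Instr.realSub 12 3 9 ;; Instr.realSub 13 4 9 ;; Instr.realDiv 12 12 13 ;;
      Instr.realMul 8 8 12 ;; Instr.realAdd 9 9 6 ;; Instr.natStore 5 x 24)

/-- The marked vertices are those of `U`. -/
def Marked (n m : ℕ) (s : State) (U : Finset ℕ) : Prop :=
  (∀ v < n, s.natArr 5 v = if v ∈ U then 1 else 0) ∧ s.real 9 = U.card ∧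
    s.real 8 = containProb n m U.card

/-- The constants that are used in the enumeration. -/
structure Consts (n m : ℕ) (s : State) : Prop where
  one : s.nat 24 = 1
  realM : s.real 3 = m
  realN : s.real 4 = n
  realOne : s.real 6 = 1

lemma denote_mark {n m x : ℕ} (hx : x = 22 ∨ x = 23) {s : State} (hc : Consts n m s) {U : Finset ℕ}
    (hU : Marked n m s U) (hv : s.nat x < n) :
    Marked n m ((mark x).denote s) (insert (s.nat x) U) := by
  obtain ⟨h1, h2, h3⟩ := hU
  have hmem := h1 _ hv
  by_cases hin : s.nat x ∈ U
  · rw [if_pos hin] at hmem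
    rw [Finset.insert_eq_of_mem hin]
    refine ⟨fun v hvn => ?_, ?_, ?_⟩
    · simp [mark, denote, Test.holds, Instr.apply, hc.one, hmem, h1 v hvn]
    · simp [mark, denote, Test.holds, Instr.apply, hc.one, hmem, h2]
    · simp [mark, denote, Test.holds, Instr.apply, hc.one, hmem, h3]
  · rw [if_neg hin] at hmem
    have hx25 : x ≠ 25 := by omega
    refine ⟨fun v hvn => ?_, ?_, ?_⟩
    · rcases eq_or_ne v (s.nat x) with hvx | hvx
      · simp [mark, denote, Test.holds, Instr.apply, hc.one, hmem, hvx, hx25]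
      · simp [mark, denote, Test.holds, Instr.apply, hc.one, hmem, hvx, h1 v hvn, hx25]
    · rw [Finset.card_insert_of_notMem hin]
      simp [mark, denote, Test.holds, Instr.apply, hc.one, hmem, h2, hc.realOne]
    · rw [Finset.card_insert_of_notMem hin, containProb, Finset.prod_range_succ, ← containProb]
      simp [mark, denote, Test.holds, Instr.apply, hc.one, hmem, h2, h3, hc.realM, hc.realN]

/-- The contribution of the number `T`, read as a sequence of `l` pairs of vertices, to the `l`-th moment;
`U` is the set of the vertices met so far, and `A` is the adjacency matrix, row by row. -/
noncomputable def tupleVal (A : ℕ → ℕ) (n m : ℕ) : ℕ → ℕ → Finset ℕ → ℝ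
  | 0, _, U => containProb n m U.card
  | l + 1, T, U => (A (T % (n * n)) : ℝ) * tupleVal A n m l (T / (n * n))
      (insert (T % (n * n) % n) (insert (T % (n * n) / n) U))

lemma sum_range_mul (a b : ℕ) (f : ℕ → ℝ) :
    ∑ t ∈ Finset.range (a * b), f t = ∑ q ∈ Finset.range b, ∑ c ∈ Finset.range a, f (a * q + c) := by
  induction b with
  | zero => simp
  | succ b ih => rw [Nat.mul_succ, Finset.sum_range_add, ih, Finset.sum_range_succ]

lemma sum_tupleVal {n m : ℕ} (G : SimpleGraph (Fin n)) {A : ℕ → ℕ}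
    (hA : ∀ i j : Fin n, A (n * i + j) = adjNat G i j) (l : ℕ) (U : Finset (Fin n)) :
    ∑ T ∈ Finset.range ((n * n) ^ l), tupleVal A n m l T (U.map Fin.valEmbedding) =
      momentRec m G l U := by
  induction l generalizing U with
  | zero => simp [tupleVal, momentRec]
  | succ l ih =>
    rcases n.eq_zero_or_pos with rfl | hn
    · simp [momentRec]
    rw [pow_succ', sum_range_mul, Finset.sum_comm, sum_range_mul, momentRec, Finset.sum_range]
    refine Finset.sum_congr rfl fun i _ => ?_
    rw [Finset.sum_range]
    refine Finset.sum_congr rfl fun j _ => ?_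
    have hc : n * (i : ℕ) + j < n * n := by
      have := Nat.mul_le_mul_left n (Nat.succ_le_of_lt i.2)
      have := j.2
      rw [Nat.mul_succ] at *
      omega
    rw [← ih, Finset.mul_sum]
    refine Finset.sum_congr rfl fun T _ => ?_
    have h1 : (n * n * T + (n * i + j)) % (n * n) = n * i + j := by
      rw [Nat.mul_add_mod, Nat.mod_eq_of_lt hc]
    have h2 : (n * n * T + (n * i + j)) / (n * n) = T := by
      rw [Nat.mul_add_div (by positivity), Nat.div_eq_of_lt hc, add_zero]
    have h3 : (n * (i : ℕ) + j) % n = j := by rw [Nat.mul_add_mod, Nat.mod_eq_of_lt j.2]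
    have h4 : (n * (i : ℕ) + j) / n = i := by
      rw [Nat.mul_add_div hn, Nat.div_eq_of_lt j.2, add_zero]
    rw [tupleVal, h1, h2, h3, h4, hA, Finset.map_insert, Finset.map_insert]
    rfl

/-- Read the next pair of vertices, with code in the natural variable `20`. -/
def readPair : Code :=
  Instr.natLoad 21 4 20 ;; Instr.natLoad 20 3 20 ;; Instr.natLoad 25 0 21 ;; Instr.realOfNat 12 25 ;;
  Instr.realMul 7 7 12 ;; Instr.natLoad 22 1 21 ;; mark 22 ;; Instr.natLoad 23 2 21 ;; mark 23

lemma Consts.of_agrees {n m : ℕ} {p : Code} {s s' : State} (hc : Consts n m s) (h : p.Agrees s s')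
    (h1 : p.keeps 0 24 = true) (h2 : p.keeps 1 3 = true) (h3 : p.keeps 1 4 = true)
    (h4 : p.keeps 1 6 = true) : Consts n m s' :=
  ⟨(h.nat _ h1).trans hc.one, (h.real _ h2).trans hc.realM, (h.real _ h3).trans hc.realN,
    (h.real _ h4).trans hc.realOne⟩

lemma HasTables.of_agrees {a b N : ℕ} {p : Code} {s s' : State} (hT : HasTables a b N s)
    (h : p.Agrees s s') (h1 : p.keeps 2 1 = true) (h2 : p.keeps 2 2 = true) (h3 : p.keeps 2 3 = true)
    (h4 : p.keeps 2 4 = true) : HasTables a b N s' := by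
  intro t ht
  rw [h.natArr 1 h1, h.natArr 2 h2, h.natArr 3 h3, h.natArr 4 h4]
  exact hT t ht

lemma Marked.of_eq {n m : ℕ} {s s' : State} {U : Finset ℕ} (hU : Marked n m s U)
    (h1 : s'.natArr 5 = s.natArr 5) (h2 : s'.real 9 = s.real 9) (h3 : s'.real 8 = s.real 8) :
    Marked n m s' U := by
  unfold Marked
  rw [h1, h2, h3]
  exact hU

lemma denote_readPair {n m N q c : ℕ} (hn : 0 < n) (hN : n * n ≤ N) {s : State} (hc : Consts n m s)
    (hT : HasTables n (n * n) N s) {U : Finset ℕ} (hU : Marked n m s U) (hsq : s.nat 20 = q)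
    (hq : q < N) (hqc : q % (n * n) = c) :
    Marked n m (readPair.denote s) (insert (c % n) (insert (c / n) U)) ∧
      (readPair.denote s).nat 20 = q / (n * n) ∧
      (readPair.denote s).real 7 = s.real 7 * s.natArr 0 c := by
  have hcn : c < n * n := hqc ▸ Nat.mod_lt _ (by positivity)
  obtain ⟨-, -, t3, t4⟩ := hT q hq
  rw [hqc] at t4
  obtain ⟨t1, t2, -, -⟩ := hT c (hcn.trans_le hN)
  have hcdiv : c / n < n := Nat.div_lt_of_lt_mul hcn
  have hcmod : c % n < n := Nat.mod_lt _ hn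
  simp only [readPair, denote_seq]
  set s1 : State := denote (Instr.natLoad 22 1 21) _ with hs1
  have a1 : s1.nat 22 = c / n := by simp [s1, denote, Instr.apply, hsq, t4, t1]
  have a2 : s1.nat 20 = q / (n * n) := by simp [s1, denote, Instr.apply, hsq, t3]
  have a3 : s1.nat 21 = c := by simp [s1, denote, Instr.apply, hsq, t4]
  have a4 : s1.real 7 = s.real 7 * s.natArr 0 c := by simp [s1, denote, Instr.apply, hsq, t4]
  have a5 : s1.natArr = s.natArr := by simp [s1, denote, Instr.apply]
  have a6 : Consts n m s1 := by
    constructor <;> simp [s1, denote, Instr.apply, hc.one, hc.realM, hc.realN, hc.realOne]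
  have a7 : Marked n m s1 U := hU.of_eq (by rw [a5]) (by simp [s1, denote, Instr.apply])
    (by simp [s1, denote, Instr.apply])
  have ag := agrees_denote (mark 22) s1
  have b1 := denote_mark (Or.inl rfl) a6 a7 (by rw [a1]; exact hcdiv)
  rw [a1] at b1
  have b2 : Consts n m ((mark 22).denote s1) := a6.of_agrees ag rfl rfl rfl rfl
  have b3 := (ag.nat 20 rfl).trans a2
  have b4 := (ag.nat 21 rfl).trans a3
  have b5 := (ag.real 7 rfl).trans a4
  have b6 := (congrFun (ag.natArr 2 rfl) c).trans ((congrFun (congrFun a5 2) c).trans t2)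
  generalize (mark 22).denote s1 = s2 at b1 b2 b3 b4 b5 b6 ⊢
  have c1 : (denote (Instr.natLoad 23 2 21) s2).nat 23 = c % n := by
    simp [denote, Instr.apply, b4, b6]
  have ag3 := agrees_denote (Instr.natLoad 23 2 21) s2
  have ag4 := agrees_denote (mark 23) (denote (Instr.natLoad 23 2 21) s2)
  refine ⟨?_, ?_, ?_⟩
  · have := denote_mark (Or.inr rfl) (b2.of_agrees ag3 rfl rfl rfl rfl)
      (b1.of_eq (ag3.natArr 5 rfl) (ag3.real 9 rfl) (ag3.real 8 rfl)) (by rw [c1]; exact hcmod)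
    rwa [c1] at this
  · exact (ag4.nat 20 rfl).trans ((ag3.nat 20 rfl).trans b3)
  · exact (ag4.real 7 rfl).trans ((ag3.real 7 rfl).trans b5)

/-- Process the number in the natural variable `12`, read as a sequence of pairs of vertices whose length
is the natural variable `10`. -/
def tupleBody : Code :=
  Instr.natConst 31 0 ;; count 16 0 (Instr.natStore 5 16 31) ;;
  Instr.natAdd 20 12 31 ;; Instr.realConst 7 1 ;; Instr.realConst 8 1 ;; Instr.realConst 9 0 ;;
  count 14 10 readPair ;;
  Instr.realMul 12 7 8 ;; Instr.realAdd 10 10 12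

lemma denote_clear {s : State} (h31 : s.nat 31 = 0) :
    ∀ v < s.nat 0, ((count 16 0 (Instr.natStore 5 16 31)).denote s).natArr 5 v = 0 := by
  have hb : (count 16 0 (Instr.natStore 5 16 31)).bounded [0] = true := by decide
  refine denote_count_induction hb (fun k s' => ∀ v < k, s'.natArr 5 v = 0) (by simp) ?_
  intro k _ s' hs' hi ih v hv
  have e31 : s'.nat 31 = 0 := (hs'.nat 31 rfl).trans h31
  rcases eq_or_ne v k with rfl | hne
  · simp [denote, next, Instr.apply, hi, e31]
  · simp [denote, next, Instr.apply, hi, hne, ih v (by omega)]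

lemma denote_tupleBody {n m N l T : ℕ} (hn : 0 < n) (hN : n * n ≤ N) {s : State} (hc : Consts n m s)
    (hT : HasTables n (n * n) N s) (h0 : s.nat 0 = n) (h10 : s.nat 10 = l) (h12 : s.nat 12 = T)
    (hTN : T < N) :
    (tupleBody.denote s).real 10 = s.real 10 + tupleVal (s.natArr 0) n m l T ∅ := by
  simp only [tupleBody, denote_seq]
  set s1 : State := denote (Instr.natConst 31 0) s with hs1
  have ag1 := agrees_denote (Instr.natConst 31 0) s
  have ag2 := agrees_denote (count 16 0 (Instr.natStore 5 16 31)) s1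
  have a31 : s1.nat 31 = 0 := by simp [s1, denote, Instr.apply]
  have a0 : s1.nat 0 = n := (ag1.nat 0 rfl).trans h0
  have b5 := denote_clear a31
  rw [a0] at b5
  have b31 := (ag2.nat 31 rfl).trans a31
  have b12 := ((ag2.nat 12 rfl).trans (ag1.nat 12 rfl)).trans h12
  have b10 := ((ag2.nat 10 rfl).trans (ag1.nat 10 rfl)).trans h10
  have br10 := (ag2.real 10 rfl).trans (ag1.real 10 rfl)
  have bA := (ag2.natArr 0 rfl).trans (ag1.natArr 0 rfl)
  have bc := (hc.of_agrees ag1 rfl rfl rfl rfl).of_agrees ag2 rfl rfl rfl rfl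
  have bT := (hT.of_agrees ag1 rfl rfl rfl rfl).of_agrees ag2 rfl rfl rfl rfl
  clear ag2
  generalize denote (count 16 0 (Instr.natStore 5 16 31)) s1 = s2 at b5 b31 b12 b10 br10 bA bc bT ⊢
  set s3 : State := denote (Instr.realConst 9 0) _ with hs3
  have c20 : s3.nat 20 = T := by simp [s3, denote, Instr.apply, b12, b31]
  have c10 : s3.nat 10 = l := by simp [s3, denote, Instr.apply, b10]
  have cr10 : s3.real 10 = s.real 10 := by simp [s3, denote, Instr.apply, br10]
  have cr7 : s3.real 7 = 1 := by simp [s3, denote, Instr.apply]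
  have cA : s3.natArr 0 = s.natArr 0 := by simp [s3, denote, Instr.apply, bA]
  have cc : Consts n m s3 := by
    constructor <;> simp [s3, denote, Instr.apply, bc.one, bc.realM, bc.realN, bc.realOne]
  have cT : HasTables n (n * n) N s3 := bT
  have cM : Marked n m s3 ∅ := by
    refine ⟨fun v hv => ?_, ?_, ?_⟩
    · simp [s3, denote, Instr.apply, b5 v hv]
    · simp [s3, denote, Instr.apply]
    · simp [s3, denote, Instr.apply, containProb]
  have hb : (count 14 10 readPair).bounded [10] = true := by decide
  have key := denote_count_induction hb (s := s3) (fun d s' => ∃ U, Marked n m s' U ∧ s'.nat 20 < N ∧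
      s'.real 7 * tupleVal (s.natArr 0) n m (l - d) (s'.nat 20) U =
        tupleVal (s.natArr 0) n m l T ∅)
    ⟨∅, cM.of_eq rfl rfl rfl, by simp [start, c20, hTN], by simp [start, c20, cr7]⟩ (by
      intro d hd s' hs' hi ⟨U, hM, hlt, hval⟩
      rw [c10] at hd
      obtain ⟨e1, e2, e3⟩ := denote_readPair hn hN (cc.of_agrees hs' rfl rfl rfl rfl)
        (cT.of_agrees hs' rfl rfl rfl rfl) hM rfl hlt rfl
      refine ⟨_, e1.of_eq rfl rfl rfl, ?_, ?_⟩
      · have : (next 14 (readPair.denote s')).nat 20 = (readPair.denote s').nat 20 := by simp [next]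
        rw [this, e2]
        exact (Nat.div_le_self _ _).trans_lt hlt
      · have : (next 14 (readPair.denote s')).nat 20 = (readPair.denote s').nat 20 := by simp [next]
        have h7 : (next 14 (readPair.denote s')).real 7 = (readPair.denote s').real 7 := rfl
        rw [this, h7, e2, e3, ← hval]
        obtain ⟨j, hj⟩ : ∃ j, l - d = j + 1 := ⟨l - d - 1, by omega⟩
        have hj' : l - (d + 1) = j := by omega
        have hA' : s'.natArr 0 = s.natArr 0 := (hs'.natArr 0 rfl).trans cA
        rw [hj, hj', tupleVal, hA', mul_assoc])
  rw [c10, Nat.sub_self] at key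
  obtain ⟨U, hM, -, hval⟩ := key
  have d10 := (agrees_denote (count 14 10 readPair) s3).real 10 rfl
  generalize denote (count 14 10 readPair) s3 = s4 at hM hval d10 ⊢
  rw [tupleVal, ← hM.2.2] at hval
  simp [denote, Instr.apply, d10, cr10, hval]

/-- Sum over all numbers below the natural variable `6`.  This variable changes in the course of the
program, so that the loop is controlled by the larger variable `5` instead. -/
def tupleSum : Code :=
  Instr.realConst 10 0 ;;
  count 12 5 (Code.ite (.natLe 6 12) (Instr.natConst 25 0) tupleBody)

lemma denote_tupleSum {n m N l M : ℕ} (hn : 0 < n) (hN : n * n ≤ N) {s : State} (hc : Consts n m s)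
    (hT : HasTables n (n * n) N s) (h0 : s.nat 0 = n) (h10 : s.nat 10 = l) (h5 : s.nat 5 = N)
    (h6 : s.nat 6 = M) (hM : M ≤ N) :
    (tupleSum.denote s).real 10 = ∑ T ∈ Finset.range M, tupleVal (s.natArr 0) n m l T ∅ := by
  have hb : (count 12 5 (Code.ite (.natLe 6 12) (Instr.natConst 25 0) tupleBody)).bounded [0, 10, 5]
    = true := by decide
  simp only [tupleSum, denote_seq]
  set s1 : State := denote (Instr.realConst 10 0) s with hs1
  have ag1 := agrees_denote (Instr.realConst 10 0) s
  have a5 : s1.nat 5 = N := (ag1.nat 5 rfl).trans h5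
  have key := denote_count_induction hb (s := s1) (fun k s' =>
      s'.real 10 = ∑ T ∈ Finset.range k, if T < M then tupleVal (s.natArr 0) n m l T ∅ else 0)
    (by simp [start, s1, denote, Instr.apply]) (by
      intro k hk s' hs' hi ih
      rw [a5] at hk
      have e6 : s'.nat 6 = M := (hs'.nat 6 rfl).trans ((ag1.nat 6 rfl).trans h6)
      have e0 : s'.nat 0 = n := (hs'.nat 0 rfl).trans ((ag1.nat 0 rfl).trans h0)
      have e10 : s'.nat 10 = l := (hs'.nat 10 rfl).trans ((ag1.nat 10 rfl).trans h10)
      have eA : s'.natArr 0 = s.natArr 0 := (hs'.natArr 0 rfl).trans (ag1.natArr 0 rfl)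
      have h7 : ∀ s : State, (next 12 s).real 10 = s.real 10 := fun s => rfl
      rw [h7, Finset.sum_range_succ, ← ih, denote, Test.holds, e6, hi]
      by_cases hkM : M ≤ k
      · rw [if_pos hkM, if_neg (by omega)]
        simp [denote, Instr.apply]
      · rw [if_neg hkM, if_pos (by omega), ← eA]
        exact denote_tupleBody hn hN
          ((hc.of_agrees ag1 rfl rfl rfl rfl).of_agrees hs' rfl rfl rfl rfl)
          ((hT.of_agrees ag1 rfl rfl rfl rfl).of_agrees hs' rfl rfl rfl rfl) e0 e10 hi hk)
  rw [key, a5, ← Finset.sum_filter]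
  congr 1
  ext T
  simp
  omega

/-! ### Power series arithmetic -/

/-- The convolution, without its last term, of the real arrays `X` and `Y` at the position in the natural
variable `16`. -/
def conv (X Y : ℕ) : Code :=
  Instr.realConst 14 0 ;;
  count 18 16 (Instr.natSub 30 16 18 ;; Instr.realLoad 12 X 18 ;; Instr.realLoad 13 Y 30 ;;
    Instr.realMul 12 12 13 ;; Instr.realAdd 14 14 12)

lemma denote_conv (X Y : ℕ) (s : State) :
    ((conv X Y).denote s).real 14 =
      ∑ i ∈ Finset.range (s.nat 16), s.realArr X i * s.realArr Y (s.nat 16 - i) := by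
  have hb : (count 18 16 (Instr.natSub 30 16 18 ;; Instr.realLoad 12 X 18 ;; Instr.realLoad 13 Y 30 ;;
    Instr.realMul 12 12 13 ;; Instr.realAdd 14 14 12)).bounded [16] = true := by
      simp [bounded, target]
  simp only [conv, denote_seq]
  set s1 : State := denote (Instr.realConst 14 0) s with hs1
  have ag := agrees_denote (Instr.realConst 14 0) s
  have e16 : s1.nat 16 = s.nat 16 := ag.nat 16 rfl
  refine (denote_count_induction hb (s := s1) (fun k s' => s'.real 14 =
    ∑ i ∈ Finset.range k, s.realArr X i * s.realArr Y (s.nat 16 - i)) ?_ ?_).trans (by rw [e16])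
  · simp [start, s1, denote, Instr.apply]
  · intro k _ s' hs' hi ih
    have f16 : s'.nat 16 = s.nat 16 := (hs'.nat 16 rfl).trans e16
    have fX : s'.realArr X = s.realArr X := (hs'.realArr X (by simp [keeps, target])).trans rfl
    have fY : s'.realArr Y = s.realArr Y := (hs'.realArr Y (by simp [keeps, target])).trans rfl
    rw [Finset.sum_range_succ, ← ih]
    simp [next, denote, Instr.apply, hi, f16, fX, fY]

/-- Store the first `D` of the rational numbers `q 0, q 1, …` in the real array `0`. -/
def storeCoeffs (q : ℕ → ℚ) : ℕ → Code
  | 0 => Instr.natConst 25 0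
  | D + 1 => storeCoeffs q D ;; Instr.realConst 12 (q D) ;; Instr.natConst 25 D ;; Instr.realStore 0 25 12

lemma denote_storeCoeffs (q : ℕ → ℚ) (D : ℕ) (s : State) (k : ℕ) :
    ((storeCoeffs q D).denote s).realArr 0 k = if k < D then (q k : ℝ) else s.realArr 0 k := by
  induction D with
  | zero => simp [storeCoeffs, denote, Instr.apply]
  | succ D ih =>
    rw [storeCoeffs, denote_seq]
    rcases eq_or_ne k D with rfl | h
    · simp [denote, Instr.apply]
    · have : k < D + 1 ↔ k < D := by omega
      simp [denote, Instr.apply, h, ih, this]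

lemma keeps_storeCoeffs (q : ℕ → ℚ) (D : ℕ) {k x : ℕ} (h1 : (k, x) ≠ (0, 25)) (h2 : (k, x) ≠ (1, 12))
    (h3 : (k, x) ≠ (3, 0)) : (storeCoeffs q D).keeps k x = true := by
  induction D with
  | zero =>
    simp only [storeCoeffs, keeps, target, bne_iff_ne]
    exact h1.symm
  | succ D ih =>
    simp only [storeCoeffs, keeps, target, ih, Bool.true_and, Bool.and_eq_true, bne_iff_ne]
    exact ⟨h2.symm, h1.symm, h3.symm⟩

lemma bounded_storeCoeffs (q : ℕ → ℚ) (D : ℕ) {A : List ℕ} (hA : 25 ∉ A) :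
    (storeCoeffs q D).bounded A = true := by
  induction D with
  | zero =>
    simp only [storeCoeffs, bounded, List.all_eq_true, target, bne_iff_ne]
    rintro x hx h
    exact hA ((Prod.mk.inj h).2 ▸ hx)
  | succ D ih =>
    simp only [storeCoeffs, bounded, ih, target, Bool.true_and, Bool.and_eq_true, List.all_eq_true,
      bne_iff_ne]
    refine ⟨fun x _ => by simp, fun x hx h => hA ((Prod.mk.inj h).2 ▸ hx), fun x _ => by simp⟩

lemma depth_storeCoeffs (q : ℕ → ℚ) (D : ℕ) : (storeCoeffs q D).depth = 0 := by
  induction D with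
  | zero => rfl
  | succ D ih => simp [storeCoeffs, depth, ih]

/-- Add the real variable `12` times the array `1` to the array `3`. -/
def accumulate : Code :=
  count 16 3 (Instr.realLoad 13 1 16 ;; Instr.realMul 13 12 13 ;; Instr.realLoad 14 3 16 ;;
    Instr.realAdd 14 14 13 ;; Instr.realStore 3 16 14)

lemma denote_accumulate (s : State) : ∀ k < s.nat 3,
    (accumulate.denote s).realArr 3 k = s.realArr 3 k + s.real 12 * s.realArr 1 k := by
  have hb : accumulate.bounded [3] = true := by decide
  have key := denote_count_induction hb (s := s) (fun K s' => ∀ k, s'.realArr 3 k =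
    if k < K then s.realArr 3 k + s.real 12 * s.realArr 1 k else s.realArr 3 k)
    (by simp [start]) (by
      intro K _ s' hs' hi ih k
      have e12 : s'.real 12 = s.real 12 := hs'.real 12 rfl
      have e1 : s'.realArr 1 = s.realArr 1 := hs'.realArr 1 rfl
      rcases eq_or_ne k K with rfl | h
      · have := ih k
        simp at this
        simp [next, denote, Instr.apply, hi, e12, e1, this]
      · have h' : k < K + 1 ↔ k < K := by omega
        simp [next, denote, Instr.apply, hi, h, ih k, h'])
  intro k hk
  exact (key k).trans (if_pos hk)

/-- Convolve the array `1` with the array `0`. -/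
def nextPower : Code :=
  count 16 3 (conv 1 0 ;; Instr.realStore 2 16 14) ;;
  count 16 3 (Instr.realLoad 12 2 16 ;; Instr.realStore 1 16 12)

lemma denote_nextPower (s : State) : ∀ k < s.nat 3, (nextPower.denote s).realArr 1 k =
    ∑ i ∈ Finset.range k, s.realArr 1 i * s.realArr 0 (k - i) := by
  have hb1 : (count 16 3 (conv 1 0 ;; Instr.realStore 2 16 14)).bounded [3] = true := by decide
  have key1 := denote_count_induction hb1 (s := s) (fun K s' => ∀ k < K, s'.realArr 2 k =
      ∑ i ∈ Finset.range k, s.realArr 1 i * s.realArr 0 (k - i)) (by simp) (by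
    intro K _ s' hs' hi ih k hk
    have e1 : s'.realArr 1 = s.realArr 1 := hs'.realArr 1 rfl
    have e0 : s'.realArr 0 = s.realArr 0 := hs'.realArr 0 rfl
    have c := denote_conv 1 0 s'
    have ag := agrees_denote (conv 1 0) s'
    have c16 := ag.nat 16 rfl
    have c2 := ag.realArr 2 rfl
    rw [denote_seq]
    generalize (conv 1 0).denote s' = s2 at c c16 c2
    rcases eq_or_ne k K with rfl | h
    · simp [next, denote, Instr.apply, c16, hi, c, e1, e0]
    · simp [next, denote, Instr.apply, c16, hi, c2, h, ih k (by omega)])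
  have ag1 := (agrees_denote (count 16 3 (conv 1 0 ;; Instr.realStore 2 16 14)) s).nat 3 rfl
  rw [nextPower, denote_seq]
  generalize denote (count 16 3 (conv 1 0 ;; Instr.realStore 2 16 14)) s = s1 at key1 ag1
  have hb2 : (count 16 3 (Instr.realLoad 12 2 16 ;; Instr.realStore 1 16 12)).bounded [3] = true := by
    decide
  have key2 := denote_count_induction hb2 (s := s1) (fun K s' => ∀ k < K, s'.realArr 1 k =
      s1.realArr 2 k) (by simp) (by
    intro K _ s' hs' hi ih k hk
    have e2 : s'.realArr 2 = s1.realArr 2 := hs'.realArr 2 rfl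
    rcases eq_or_ne k K with rfl | h
    · simp [next, denote, Instr.apply, hi, e2]
    · simp [next, denote, Instr.apply, hi, h, ih k (by omega)])
  intro k hk
  rw [key2 k (ag1 ▸ hk), key1 k hk]

/-- One round of the computation of the logarithm: the array `4` receives the coefficients of
`z F'(z) / F(z)`, where the array `3` holds those of `F`. -/
def logStep : Code :=
  conv 4 3 ;; Instr.realLoad 12 3 16 ;; Instr.realOfNat 13 16 ;; Instr.realMul 12 13 12 ;;
  Instr.realSub 12 12 14 ;; Instr.realStore 4 16 12 ;; Instr.realDiv 12 12 13 ;;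
  Instr.realAdd 15 15 12

lemma denote_log {s : State} {a : ℕ → ℝ} (ha : ∀ k < s.nat 3, s.realArr 3 k = a k)
    (h15 : s.real 15 = 0) : ((count 16 3 logStep).denote s).real 15 =
      ∑ k ∈ Finset.range (s.nat 3), logDerivCoeff a k / k := by
  have hb : (count 16 3 logStep).bounded [3] = true := by decide
  refine (denote_count_induction hb (fun K s' => s'.real 15 =
    ∑ k ∈ Finset.range K, logDerivCoeff a k / k ∧ ∀ k < K, s'.realArr 4 k = logDerivCoeff a k)
    (by simp [start, h15]) ?_).1
  intro K hK s' hs' hi ⟨ih1, ih2⟩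
  have e3 : s'.realArr 3 = s.realArr 3 := hs'.realArr 3 rfl
  have c := denote_conv 4 3 s'
  have ag := agrees_denote (conv 4 3) s'
  have c16 := (ag.nat 16 rfl).trans hi
  have c3 := (ag.realArr 3 rfl).trans e3
  have c4 := ag.realArr 4 rfl
  have c15 := ag.real 15 rfl
  have hc : ((conv 4 3).denote s').real 14 =
      ∑ j ∈ Finset.range K, logDerivCoeff a j * a (K - j) := by
    rw [c, hi]
    refine Finset.sum_congr rfl fun j hj => ?_
    rw [Finset.mem_range] at hj
    rw [ih2 j hj, e3, ha _ (by omega)]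
  rw [logStep, denote_seq]
  generalize (conv 4 3).denote s' = s2 at hc c16 c3 c4 c15
  have hK' : (K : ℝ) * a K - ∑ j ∈ Finset.range K, logDerivCoeff a j * a (K - j) =
    logDerivCoeff a K := (logDerivCoeff_eq a K).symm
  constructor
  · rw [Finset.sum_range_succ, ← ih1]
    simp [next, denote, Instr.apply, c16, c3, ha K hK, hc, hK', c15]
  · intro k hk
    rcases eq_or_ne k K with rfl | h
    · simp [next, denote, Instr.apply, c16, c3, ha k hK, hc, hK']
    · simp [next, denote, Instr.apply, c16, c4, h, ih2 k (by omega)]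

/-! ### The main loop -/

/-- The contribution of one moment to the coefficients of the composed function, which are collected in
the array `3`.  The array `1` holds the coefficients of the current power of the polynomial. -/
def momentStep : Code :=
  tupleSum ;; Instr.realMul 12 11 10 ;; accumulate ;;
  Instr.natAdd 25 10 24 ;; Instr.realOfNat 13 25 ;; Instr.realMul 11 11 5 ;; Instr.realDiv 11 11 13 ;;
  nextPower ;; mulBy 6 4

/-- The memory after `l` rounds of the main loop. -/
structure MomentInv {n : ℕ} (m : ℕ) (G : SimpleGraph (Fin n)) (κ : ℝ) (φ : Polynomial ℝ) (R l : ℕ)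
    (s : State) : Prop where
  count : s.nat 6 = (n * n) ^ l
  fac : s.real 11 = κ ^ l / l.factorial
  power : ∀ k < R + 1, s.realArr 1 k = (φ ^ l).coeff k
  coeff : ∀ k < R + 1, s.realArr 3 k =
    ∑ i ∈ Finset.range l, κ ^ i * moment m G i / i.factorial * (φ ^ i).coeff k

/-- The memory at the start of the main loop, as far as the loop does not change it. -/
structure MomentSetup {n : ℕ} (m : ℕ) (G : SimpleGraph (Fin n)) (κ : ℝ) (φ : Polynomial ℝ) (R : ℕ)
    (s : State) : Prop where
  n0 : s.nat 0 = n
  n3 : s.nat 3 = R + 1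
  n4 : s.nat 4 = n * n
  n5 : s.nat 5 = (n * n) ^ R
  r5 : s.real 5 = κ
  consts : Consts n m s
  adj : ∀ i j : Fin n, s.natArr 0 (n * i + j) = adjNat G i j
  poly : ∀ k, s.realArr 0 k = φ.coeff k

lemma coeff_pow_succ_of_coeff_zero {φ : Polynomial ℝ} (h : φ.coeff 0 = 0) (l k : ℕ) :
    (φ ^ (l + 1)).coeff k = ∑ i ∈ Finset.range k, (φ ^ l).coeff i * φ.coeff (k - i) := by
  rw [pow_succ, Polynomial.coeff_mul, Finset.Nat.sum_antidiagonal_eq_sum_range_succ_mk,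
    Finset.sum_range_succ]
  simp [h]

lemma denote_momentStep {n m R l : ℕ} {G : SimpleGraph (Fin n)} {κ : ℝ} {φ : Polynomial ℝ}
    (hn : 0 < n) (hmn : m ≤ n) (hR : 1 ≤ R) (hφ : φ.coeff 0 = 0) (hl : l ≤ R) {s : State}
    (hs : MomentSetup m G κ φ R s) (hT : HasTables n (n * n) ((n * n) ^ R) s)
    (h10 : s.nat 10 = l) (hI : MomentInv m G κ φ R l s) :
    MomentInv m G κ φ R (l + 1) (momentStep.denote s) := by
  have hnn : 0 < n * n := by positivity
  have hsum := denote_tupleSum hn (Nat.le_self_pow (by omega) _) hs.consts hT hs.n0 h10 hs.n5 hI.count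
    (Nat.pow_le_pow_right hnn hl)
  have hmom : ∑ T ∈ Finset.range ((n * n) ^ l), tupleVal (s.natArr 0) n m l T ∅ = moment m G l := by
    have := sum_tupleVal (m := m) G hs.adj l ∅
    rwa [momentRec_empty hmn, Finset.map_empty] at this
  rw [hmom] at hsum
  have ag := agrees_denote tupleSum s
  simp only [momentStep, denote_seq]
  have a3 := (ag.nat 3 rfl).trans hs.n3
  have a4 := (ag.nat 4 rfl).trans hs.n4
  have a6 := (ag.nat 6 rfl).trans hI.count
  have a10 := (ag.nat 10 rfl).trans h10
  have a24 := (ag.nat 24 rfl).trans hs.consts.one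
  have ar5 := (ag.real 5 rfl).trans hs.r5
  have ar11 := (ag.real 11 rfl).trans hI.fac
  have ap0 := ag.realArr 0 rfl
  have ap1 := ag.realArr 1 rfl
  have ap3 := ag.realArr 3 rfl
  clear ag
  generalize tupleSum.denote s = s1 at *
  set s2 : State := denote (Instr.realMul 12 11 10) s1 with hs2
  have b12 : s2.real 12 = κ ^ l / l.factorial * moment m G l := by
    simp [s2, denote, Instr.apply, ar11, hsum]
  have ag := agrees_denote (Instr.realMul 12 11 10) s1
  have b3 := (ag.nat 3 rfl).trans a3
  have b4 := (ag.nat 4 rfl).trans a4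
  have b6 := (ag.nat 6 rfl).trans a6
  have b10 := (ag.nat 10 rfl).trans a10
  have b24 := (ag.nat 24 rfl).trans a24
  have br5 := (ag.real 5 rfl).trans ar5
  have br11 := (ag.real 11 rfl).trans ar11
  have bp0 := (ag.realArr 0 rfl).trans ap0
  have bp1 := (ag.realArr 1 rfl).trans ap1
  have bp3 := (ag.realArr 3 rfl).trans ap3
  have hacc := denote_accumulate s2
  rw [b3, bp1, bp3, b12] at hacc
  have ag := agrees_denote accumulate s2
  have c3 := (ag.nat 3 rfl).trans b3
  have c4 := (ag.nat 4 rfl).trans b4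
  have c6 := (ag.nat 6 rfl).trans b6
  have c10 := (ag.nat 10 rfl).trans b10
  have c24 := (ag.nat 24 rfl).trans b24
  have cr5 := (ag.real 5 rfl).trans br5
  have cr11 := (ag.real 11 rfl).trans br11
  have cp0 := (ag.realArr 0 rfl).trans bp0
  have cp1 := (ag.realArr 1 rfl).trans bp1
  clear ag
  clear_value s2
  generalize accumulate.denote s2 = s3 at *
  set s4 : State := denote (Instr.realDiv 11 11 13) _ with hs4
  have d11 : s4.real 11 = κ ^ (l + 1) / (l + 1).factorial := by
    simp only [s4, denote, Instr.apply, c10, c24]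
    simp [Nat.factorial_succ, pow_succ, cr11, cr5]
    field_simp
  have d3 : s4.nat 3 = R + 1 := by simp [s4, denote, Instr.apply, c3]
  have d4 : s4.nat 4 = n * n := by simp [s4, denote, Instr.apply, c4]
  have d6 : s4.nat 6 = (n * n) ^ l := by simp [s4, denote, Instr.apply, c6]
  have dp : s4.realArr = s3.realArr := rfl
  have hpow := denote_nextPower s4
  rw [d3, dp, cp0, cp1] at hpow
  have ag := agrees_denote nextPower s4
  have e4 := (ag.nat 4 rfl).trans d4
  have e6 := (ag.nat 6 rfl).trans d6
  have er11 := (ag.real 11 rfl).trans d11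
  have ep3 := (ag.realArr 3 rfl).trans (congrFun dp 3)
  clear ag
  clear_value s4
  generalize nextPower.denote s4 = s5 at *
  have ag := agrees_denote (mulBy 6 4) s5
  refine ⟨?_, (ag.real 11 rfl).trans er11, fun k hk => ?_, fun k hk => ?_⟩
  · rw [denote_mulBy (by omega) (by omega), e6, e4, pow_succ]
  · rw [ag.realArr 1 rfl, hpow k hk, coeff_pow_succ_of_coeff_zero hφ]
    refine Finset.sum_congr rfl fun i hi => ?_
    rw [Finset.mem_range] at hi
    rw [hI.power i (by omega), hs.poly]
  · rw [ag.realArr 3 rfl, ep3, hacc k hk, Finset.sum_range_succ, hI.coeff k hk, hI.power k hk]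
    ring

lemma MomentSetup.of_agrees {n m R : ℕ} {G : SimpleGraph (Fin n)} {κ : ℝ} {φ : Polynomial ℝ} {p : Code}
    {s s' : State} (hs : MomentSetup m G κ φ R s) (h : p.Agrees s s')
    (hk : (p.keeps 0 0 && p.keeps 0 3 && p.keeps 0 4 && p.keeps 0 5 && p.keeps 0 24 && p.keeps 1 3 &&
      p.keeps 1 4 && p.keeps 1 5 && p.keeps 1 6 && p.keeps 2 0 && p.keeps 3 0) = true) :
    MomentSetup m G κ φ R s' := by
  simp only [Bool.and_eq_true] at hk
  obtain ⟨⟨⟨⟨⟨⟨⟨⟨⟨⟨h0, h3⟩, h4⟩, h5⟩, h24⟩, r3⟩, r4⟩, r5⟩, r6⟩, hA⟩, hP⟩ := hk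
  refine ⟨(h.nat _ h0).trans hs.n0, (h.nat _ h3).trans hs.n3, (h.nat _ h4).trans hs.n4,
    (h.nat _ h5).trans hs.n5, (h.real _ r5).trans hs.r5, hs.consts.of_agrees h h24 r3 r4 r6, ?_, ?_⟩
  · rw [h.natArr _ hA]; exact hs.adj
  · rw [h.realArr _ hP]; exact hs.poly

/-- The start of the main loop: the power with exponent zero, and the empty sum. -/
def momentInit : Code :=
  Instr.natConst 31 0 ;; Instr.realStore 1 31 6 ;; Instr.natConst 6 1 ;; Instr.realConst 11 1 ;;
    Instr.realConst 15 0

/-- The part of the program that runs after the order `R` of the expansion and the number `n ^ (2 * R)` are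
known and the polynomial is stored. -/
def mainLoop : Code :=
  tables ;; momentInit ;; count 10 3 momentStep ;;
  count 16 3 logStep ;; Instr.realConst 12 0 ;; Instr.realAdd 0 15 12

lemma denote_mainLoop {n m R : ℕ} {G : SimpleGraph (Fin n)} {γ : ℝ} {φ : Polynomial ℝ}
    (hn : 0 < n) (hmn : m ≤ n) (hR : 1 ≤ R) (hφ : φ.coeff 0 = 0) {s : State}
    (hs : MomentSetup m G (γ / ((m : ℝ) - 1)) φ R s)
    (h1 : ∀ k, s.realArr 1 k = 0) (h3 : ∀ k, s.realArr 3 k = 0) :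
    (mainLoop.denote s).real 0 =
      ∑ k ∈ Finset.range (R + 1), logDerivCoeff (compCoeff m G γ φ R) k / k := by
  simp only [mainLoop, denote_seq]
  have hT := denote_tables (s := s) (by rw [hs.n0]; exact hn) (by rw [hs.n4]; positivity) hs.consts.one
  rw [hs.n0, hs.n4, hs.n5] at hT
  have ag := agrees_denote tables s
  have b := hs.of_agrees ag (by decide)
  have b1 : ∀ k, (tables.denote s).realArr 1 k = 0 := by rw [ag.realArr 1 rfl]; exact h1
  have b3 : ∀ k, (tables.denote s).realArr 3 k = 0 := by rw [ag.realArr 3 rfl]; exact h3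
  clear ag
  generalize tables.denote s = s1 at *
  have ag := agrees_denote momentInit s1
  have c := b.of_agrees ag (by decide)
  have cT := hT.of_agrees ag rfl rfl rfl rfl
  have c15 : (momentInit.denote s1).real 15 = 0 := by simp [momentInit, denote, Instr.apply]
  have cI : MomentInv m G (γ / ((m : ℝ) - 1)) φ R 0 (momentInit.denote s1) := by
    refine ⟨?_, ?_, fun k _ => ?_, fun k _ => ?_⟩
    · simp [momentInit, denote, Instr.apply]
    · simp [momentInit, denote, Instr.apply]
    · rcases eq_or_ne k 0 with rfl | hk
      · simp [momentInit, denote, Instr.apply, b.consts.realOne]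
      · simp [momentInit, denote, Instr.apply, hk, b1, Polynomial.coeff_one]
    · simp [momentInit, denote, Instr.apply, b3]
  clear ag
  generalize momentInit.denote s1 = s2 at *
  have hb : (count 10 3 momentStep).bounded [0, 3, 4, 5] = true := by decide
  have key := denote_count_induction hb (s := s2) (fun l s' => MomentInv m G (γ / ((m : ℝ) - 1)) φ R l s')
    ⟨by simpa [start] using cI.count, cI.fac, cI.power, cI.coeff⟩ (by
      intro l hl s' hs' hi hI
      rw [c.n3] at hl
      have := denote_momentStep hn hmn hR hφ (by omega) (c.of_agrees hs' (by decide))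
        (cT.of_agrees hs' rfl rfl rfl rfl) hi hI
      exact ⟨by simpa [next] using this.count, this.fac, this.power, this.coeff⟩)
  have ag := agrees_denote (count 10 3 momentStep) s2
  have d3 := (ag.nat 3 rfl).trans c.n3
  have d15 := (ag.real 15 rfl).trans c15
  rw [c.n3] at key
  clear ag
  generalize denote (count 10 3 momentStep) s2 = s3 at *
  have hlog := denote_log (s := s3) (a := compCoeff m G γ φ R) (by
    rw [d3]; exact fun k hk => key.coeff k hk) d15
  rw [d3] at hlog
  generalize denote (count 16 3 logStep) s3 = s4 at *
  simp [denote, Instr.apply, hlog]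

/-! ### The program -/

/-- The constants, and the start of the search for the order: the real variable `2` holds `ε`, and the natural
variable `2`, which will hold the order, is zero. -/
def prelude (c : ℕ) : Code :=
  Instr.realOfNat 3 1 ;; Instr.realOfNat 4 0 ;; Instr.realConst 6 0 ;; Instr.realAdd 2 1 6 ;;
  Instr.realConst 6 1 ;; Instr.natConst 24 1 ;; Instr.natConst 33 c ;; Instr.natConst 2 0

/-- Double the real variable `2` until it exceeds `m`, and add `c` to the order each time.  This
replaces the computation of a logarithm. -/
def orderLoop : Program :=
  .loop (.realLe 2 3) (.seq (.instr (.realAdd 2 2 2)) (.instr (.natAdd 2 2 33)))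

lemma runs_orderLoop (j : ℕ) (s : State) (h1 : ∀ i < j, s.real 2 * 2 ^ i ≤ s.real 3)
    (h2 : s.real 3 < s.real 2 * 2 ^ j) :
    Runs orderLoop s { s with
      nat := Function.update s.nat 2 (s.nat 2 + j * s.nat 33)
      real := Function.update s.real 2 (s.real 2 * 2 ^ j) } (3 * j + 1) := by
  induction j generalizing s with
  | zero =>
    simp only [zero_mul, add_zero, pow_zero, mul_one, Function.update_eq_self, mul_zero, zero_add]
    refine Runs.loop_false ?_
    simpa [Test.holds] using h2
  | succ j ih =>
    set s1 : State := (Instr.natAdd 2 2 33).apply ((Instr.realAdd 2 2 2).apply s) with hs1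
    have e2 : s1.real 2 = s.real 2 * 2 := by simp [s1, Instr.apply, mul_two]
    have e3 : s1.real 3 = s.real 3 := by simp [s1, Instr.apply]
    have en2 : s1.nat 2 = s.nat 2 + s.nat 33 := by simp [s1, Instr.apply]
    have en33 : s1.nat 33 = s.nat 33 := by simp [s1, Instr.apply]
    have hr := ih s1 (fun i hi => by
      rw [e2, e3, mul_assoc, ← pow_succ']; exact h1 (i + 1) (by omega)) (by
      rw [e2, e3, mul_assoc, ← pow_succ']; exact h2)
    have : Runs orderLoop s _ _ := Runs.loop_true
      (b := .realLe 2 3) (by simpa [Test.holds] using h1 0 (by omega))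
      (Runs.seq (Runs.instr (.realAdd 2 2 2) s) (Runs.instr (.natAdd 2 2 33) _)) hr
    convert this using 1
    · rw [e2, en2, en33]
      simp only [s1, Instr.apply, Function.update_idem]
      congr 2
      · ring
      · ring
    · ring

/-- Store the polynomial, and compute `R + 1`, the coefficient `γ / (m - 1)` and the number `n ^ 2`. -/
def setup (φ : Polynomial ℚ) : Code :=
  storeCoeffs φ.coeff (φ.natDegree + 1) ;;
  Instr.natAdd 3 2 24 ;; Instr.realSub 12 3 6 ;; Instr.realDiv 5 0 12 ;;
  Instr.natConst 31 0 ;; Instr.natAdd 4 0 31 ;; mulBy 4 0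

/-- Compute `n ^ (2 * R)`. -/
def powLoop : Code := Instr.natConst 5 1 ;; count 18 2 (mulBy 5 4)

lemma denote_powLoop (s : State) : (powLoop.denote s).nat 5 = s.nat 4 ^ s.nat 2 := by
  simp only [powLoop, denote_seq]
  set s1 : State := denote (Instr.natConst 5 1) s with hs1
  have ag := agrees_denote (Instr.natConst 5 1) s
  have e2 := ag.nat 2 rfl
  have e4 := ag.nat 4 rfl
  have e5 : s1.nat 5 = 1 := by simp [s1, denote, Instr.apply]
  rw [← hs1] at e2 e4
  have hb : (count 18 2 (mulBy 5 4)).bounded [2, 4] = true := by decide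
  rw [← e2, ← e4]
  refine denote_count_induction hb (fun k s' => s'.nat 5 = s1.nat 4 ^ k) (by simp [start, e5]) ?_
  intro k _ s' hs' _ ih
  have : ∀ s : State, (next 18 s).nat 5 = s.nat 5 := fun s => by simp [next]
  rw [this, denote_mulBy (by omega) (by omega), ih, hs'.nat 4 rfl, pow_succ]

/-- The program for the polynomial `φ` and the constant `c`. -/
def program (φ : Polynomial ℚ) (c : ℕ) : Program :=
  .seq (prelude c).compile (.seq orderLoop
    (.seq (setup φ).compile (.seq powLoop.compile mainLoop.compile)))

lemma input_natArr {n : ℕ} (m : ℕ) (G : SimpleGraph (Fin n)) (γ ε : ℝ) (i j : Fin n) :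
    (input m G γ ε).natArr 0 (n * i + j) = adjNat G i j := by
  have hn : 0 < n := i.pos
  have key : (∃ i' j' : Fin n, G.Adj i' j' ∧ n * (i : ℕ) + j = (i' : ℕ) * n + j') ↔ G.Adj i j := by
    constructor
    · rintro ⟨i', j', hadj, he⟩
      rw [mul_comm (i' : ℕ)] at he
      have h1 := congrArg (· / n) he
      have h2 := congrArg (· % n) he
      simp only [Nat.mul_add_div hn, Nat.div_eq_of_lt j.2, Nat.div_eq_of_lt j'.2, add_zero] at h1
      simp only [Nat.mul_add_mod, Nat.mod_eq_of_lt j.2, Nat.mod_eq_of_lt j'.2] at h2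
      rwa [Fin.ext h1, Fin.ext h2]
    · exact fun hadj => ⟨i, j, hadj, by rw [mul_comm]⟩
  unfold adjNat
  by_cases hadj : G.Adj i j
  · rw [if_pos hadj]
    exact if_pos ⟨rfl, key.2 hadj⟩
  · rw [if_neg hadj]
    exact if_neg fun h => hadj (key.1 h.2)

/-- The program with the constant `c` expands up to the order `c * L`, where `L` is the number of doublings
that lead from `ε` beyond `m`. -/
lemma runs_program (φ : Polynomial ℚ) (hφ : φ.eval 0 = 0) {c : ℕ} (hc : 1 ≤ c) {n m : ℕ}
    (G : SimpleGraph (Fin n)) (γ ε : ℝ) (hm : 2 ≤ m) (hmn : m ≤ n) {L : ℕ} (hL : 1 ≤ L)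
    (hL1 : ∀ i < L, ε * 2 ^ i ≤ m) (hL2 : (m : ℝ) < ε * 2 ^ L) :
    ∃ (s : State) (t : ℕ), Runs (program φ c) (input m G γ ε) s t ∧
      t ≤ ((prelude c).size + 4 + (setup φ).size + powLoop.size + mainLoop.size) *
        ((n * n) ^ (c * L) + 1) ^ 3 ∧
      output s = ∑ k ∈ Finset.range (c * L + 1),
        logDerivCoeff (compCoeff m G γ (φ.map (algebraMap ℚ ℝ)) (c * L)) k / k := by
  have hn : 2 ≤ n := hm.trans hmn
  have hR : 1 ≤ c * L := Nat.mul_pos hc hL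
  have hLR : L ≤ c * L := Nat.le_mul_of_pos_left _ hc
  set R := c * L with hRdef
  set N := (n * n) ^ R with hN
  set ψ := φ.map (algebraMap ℚ ℝ) with hψ
  have hnn : n * n ≤ N := Nat.le_self_pow (by omega) _
  have hnN : n ≤ N := (Nat.le_mul_self n).trans hnn
  have hRN : R + 1 ≤ N := by
    have h1 : R < 2 ^ R := Nat.lt_two_pow_self
    have h2 : 2 ^ R ≤ (n * n) ^ R := Nat.pow_le_pow_left (by nlinarith) _
    omega
  set s0 := input m G γ ε with hs0
  obtain ⟨t1, ht1, hr1⟩ := runs_compile (p := prelude c) (A := []) (B := N) (by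
    simp [prelude, bounded]) (s := s0) (by simp)
  have a2 : ((prelude c).denote s0).nat 2 = 0 := by simp [prelude, denote, Instr.apply]
  have a0 : ((prelude c).denote s0).nat 0 = n := by simp [prelude, denote, Instr.apply, s0, input]
  have a33 : ((prelude c).denote s0).nat 33 = c := by simp [prelude, denote, Instr.apply]
  have ar2 : ((prelude c).denote s0).real 2 = ε := by
    simp [prelude, denote, Instr.apply, s0, input]
  have ar0 : ((prelude c).denote s0).real 0 = γ := by
    simp [prelude, denote, Instr.apply, s0, input]
  have ac : Consts n m ((prelude c).denote s0) := by
    constructor <;> simp [prelude, denote, Instr.apply, s0, input]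
  have aA : ∀ i j : Fin n, ((prelude c).denote s0).natArr 0 (n * i + j) = adjNat G i j :=
    fun i j => input_natArr m G γ ε i j
  have aR : ∀ a k, ((prelude c).denote s0).realArr a k = 0 := fun a k => rfl
  generalize (prelude c).denote s0 = s1 at *
  have hr2 := runs_orderLoop L s1 (by rw [ar2, ac.realM]; exact hL1) (by rw [ar2, ac.realM]; exact hL2)
  rw [a2, a33, zero_add, mul_comm L c, ← hRdef] at hr2
  set s2 : State := { s1 with
      nat := Function.update s1.nat 2 R
      real := Function.update s1.real 2 (s1.real 2 * 2 ^ L) } with hs2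
  have b2 : s2.nat 2 = R := by simp [s2]
  have b0 : s2.nat 0 = n := by simp [s2, a0]
  have br0 : s2.real 0 = γ := by simp [s2, ar0]
  have bc : Consts n m s2 := by
    constructor <;> simp [s2, ac.one, ac.realM, ac.realN, ac.realOne]
  have bA : ∀ i j : Fin n, s2.natArr 0 (n * i + j) = adjNat G i j := aA
  have bR : ∀ a k, s2.realArr a k = 0 := aR
  clear_value s2
  have hbS : (setup φ).bounded [0] = true := by
    simp [setup, bounded, bounded_storeCoeffs, target, mulBy]
  obtain ⟨t3, ht3, hr3⟩ := runs_compile (B := N) hbS (s := s2) (by simpa [b0] using hnN)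
  have c2 := (agrees_denote (setup φ) s2).nat 2 (by
    simp [setup, keeps, keeps_storeCoeffs, target, mulBy])
  have cr1 := (agrees_denote (setup φ) s2).realArr 1 (by
    simp [setup, keeps, keeps_storeCoeffs, target, mulBy])
  have cr3 := (agrees_denote (setup φ) s2).realArr 3 (by
    simp [setup, keeps, keeps_storeCoeffs, target, mulBy])
  have cs : MomentSetup m G (γ / ((m : ℝ) - 1)) ψ R (powLoop.denote ((setup φ).denote s2)) := by
    have ag := agrees_denote (storeCoeffs φ.coeff (φ.natDegree + 1)) s2
    have d2 := (ag.nat 2 (keeps_storeCoeffs _ _ (by simp) (by simp) (by simp))).trans b2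
    have d0 := (ag.nat 0 (keeps_storeCoeffs _ _ (by simp) (by simp) (by simp))).trans b0
    have dr0 := (ag.real 0 (keeps_storeCoeffs _ _ (by simp) (by simp) (by simp))).trans br0
    have dA := ag.natArr 0 (keeps_storeCoeffs _ _ (by simp) (by simp) (by simp))
    have dc := bc.of_agrees ag (keeps_storeCoeffs _ _ (by simp) (by simp) (by simp))
      (keeps_storeCoeffs _ _ (by simp) (by simp) (by simp))
      (keeps_storeCoeffs _ _ (by simp) (by simp) (by simp))
      (keeps_storeCoeffs _ _ (by simp) (by simp) (by simp))
    have dP : ∀ k, ((storeCoeffs φ.coeff (φ.natDegree + 1)).denote s2).realArr 0 k = ψ.coeff k := by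
      intro k
      rw [denote_storeCoeffs, bR, hψ, Polynomial.coeff_map]
      split_ifs with hk
      · rfl
      · rw [Polynomial.coeff_eq_zero_of_natDegree_lt (by omega), map_zero]
    simp only [setup, denote_seq]
    clear ag
    generalize (storeCoeffs φ.coeff (φ.natDegree + 1)).denote s2 = s3 at *
    set s4 : State := denote (Instr.natAdd 4 0 31) _ with hs4
    have e2 : s4.nat 2 = R := by simp [s4, denote, Instr.apply, d2]
    have e0 : s4.nat 0 = n := by simp [s4, denote, Instr.apply, d0]
    have e3 : s4.nat 3 = R + 1 := by simp [s4, denote, Instr.apply, d2, dc.one]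
    have e4 : s4.nat 4 = n := by simp [s4, denote, Instr.apply, d0]
    have er5 : s4.real 5 = γ / ((m : ℝ) - 1) := by
      simp [s4, denote, Instr.apply, dr0, dc.realM, dc.realOne]
    have ec : Consts n m s4 := by
      constructor <;> simp [s4, denote, Instr.apply, dc.one, dc.realM, dc.realN, dc.realOne]
    have eA : s4.natArr 0 = s2.natArr 0 := dA
    have eP : ∀ k, s4.realArr 0 k = ψ.coeff k := dP
    clear_value s4
    have ag1 := agrees_denote (mulBy 4 0) s4
    have ag2 := agrees_denote powLoop ((mulBy 4 0).denote s4)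
    have f4 := denote_mulBy (x := 4) (y := 0) (by omega) (by omega) s4
    rw [e4, e0] at f4
    refine ⟨(ag2.nat 0 rfl).trans ((ag1.nat 0 rfl).trans e0), (ag2.nat 3 rfl).trans
      ((ag1.nat 3 rfl).trans e3), (ag2.nat 4 rfl).trans f4, ?_, (ag2.real 5 rfl).trans
      ((ag1.real 5 rfl).trans er5), (ec.of_agrees ag1 rfl rfl rfl rfl).of_agrees ag2 rfl rfl rfl rfl,
      ?_, ?_⟩
    · rw [denote_powLoop, f4, ag1.nat 2 rfl, e2]
    · rw [ag2.natArr 0 rfl, ag1.natArr 0 rfl, eA]; exact bA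
    · rw [ag2.realArr 0 rfl, ag1.realArr 0 rfl]; exact eP
  generalize (setup φ).denote s2 = s3 at *
  have hbP : powLoop.bounded [2, 4] = true := by decide
  have ag := agrees_denote powLoop s3
  have c4 : s3.nat 4 = n * n := by rw [← ag.nat 4 rfl]; exact cs.n4
  obtain ⟨t4, ht4, hr4⟩ := runs_compile (B := N) hbP (s := s3) (by
    simp only [List.forall_mem_cons, c2, b2, c4]
    exact ⟨by omega, hnn, by simp⟩)
  have hbM : mainLoop.bounded [0, 3, 4, 5] = true := by decide
  have h0 : ψ.coeff 0 = 0 := by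
    rw [hψ, Polynomial.coeff_map, Polynomial.coeff_zero_eq_eval_zero, hφ, map_zero]
  have hout := denote_mainLoop (by omega) hmn hR h0 cs (fun k => by
    rw [ag.realArr 1 rfl, cr1, bR]) (fun k => by rw [ag.realArr 3 rfl, cr3, bR])
  obtain ⟨t5, ht5, hr5⟩ := runs_compile (B := N) hbM (s := powLoop.denote s3) (by
    simp only [List.forall_mem_cons, cs.n0, cs.n3, cs.n4, cs.n5]
    exact ⟨hnN, hRN, hnn, le_rfl, by simp⟩)
  refine ⟨_, _, Runs.seq hr1 (Runs.seq hr2 (Runs.seq hr3 (Runs.seq hr4 hr5))), ?_, hout⟩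
  have g1 := ht1.trans (time_le N (prelude c) 3 (by simp [prelude, depth]))
  have g3 := ht3.trans (time_le N (setup φ) 3 (by simp [setup, depth, depth_storeCoeffs, mulBy]))
  have g4 := ht4.trans (time_le N powLoop 3 (by decide))
  have g5 := ht5.trans (time_le N mainLoop 3 (by decide))
  have g2 : 3 * L + 1 ≤ 4 * (N + 1) ^ 3 := by
    have : N + 1 ≤ (N + 1) ^ 3 := Nat.le_self_pow (by omega) _
    omega
  simp only [add_mul]
  omega

/-- The number of doublings that are needed to reach `m` from `ε`. -/
lemma exists_doublings {m : ℕ} (hm : 1 ≤ m) {ε : ℝ} (hε0 : 0 < ε) (hε1 : ε < 1) :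
    ∃ L : ℕ, 1 ≤ L ∧ (∀ i < L, ε * 2 ^ i ≤ m) ∧ (m : ℝ) < ε * 2 ^ L := by
  classical
  have hm' : (1 : ℝ) ≤ m := by exact_mod_cast hm
  have hex : ∃ L : ℕ, (m : ℝ) < ε * 2 ^ L := by
    obtain ⟨L, hL⟩ := pow_unbounded_of_one_lt ((m : ℝ) / ε) (by norm_num : (1 : ℝ) < 2)
    exact ⟨L, by rwa [div_lt_iff₀' hε0] at hL⟩
  refine ⟨Nat.find hex, ?_, fun i hi => not_lt.mp (Nat.find_min hex hi), Nat.find_spec hex⟩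
  rw [Nat.one_le_iff_ne_zero, Ne, Nat.find_eq_zero]
  simp only [pow_zero, mul_one]
  linarith

/-- The program computes the partial sum of the Taylor series of the logarithm, of an order that is
proportional to `ln m - ln ε`, in quasi-polynomial time. -/
theorem exists_program {φ : Polynomial ℚ} (hφ : φ.eval 0 = 0) (C₁ : ℝ) :
    ∃ (prog : Program) (C : ℝ), 0 < C ∧ ∀ (n m : ℕ) (G : SimpleGraph (Fin n)) (γ ε : ℝ), 4 ≤ m → m ≤ n →
      0 < ε → ε < 1 → ∃ (R : ℕ) (s : State) (t : ℕ), C₁ * (Real.log m - Real.log ε) ≤ R ∧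
        Runs prog (input m G γ ε) s t ∧ (t : ℝ) ≤ (n : ℝ) ^ (C * (Real.log m - Real.log ε)) ∧
        output s = ∑ k ∈ Finset.range (R + 1),
          logDerivCoeff (compCoeff m G γ (φ.map (algebraMap ℚ ℝ)) R) k / k := by
  obtain ⟨c, hc⟩ := exists_nat_ge (max C₁ 1)
  have hc1 : (1 : ℝ) ≤ c := (le_max_right _ _).trans hc
  have hcC : C₁ ≤ c := (le_max_left _ _).trans hc
  obtain ⟨K, hK⟩ : ∃ K : ℕ, K = (prelude c).size + 4 + (setup φ).size + powLoop.size + mainLoop.size :=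
    ⟨_, rfl⟩
  -- `t ≤ K (N + 1) ^ 3 ≤ 8 K n ^ (6 c L)` with `N = n ^ (2 c L)`, where `L ≤ 3 (ln m - ln ε)` and `8 K ≤ n ^ (8 K)`
  refine ⟨program φ c, 8 * K + 18 * c, by positivity, fun n m G γ ε hm hmn hε0 hε1 => ?_⟩
  obtain ⟨L, hL, hL1, hL2⟩ := exists_doublings (by omega : 1 ≤ m) hε0 hε1
  obtain ⟨s, t, hr, ht, hout⟩ := runs_program φ hφ (by exact_mod_cast hc1 : 1 ≤ c) G γ ε (by omega) hmn
    hL hL1 hL2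
  rw [← hK] at ht
  set Λ := Real.log m - Real.log ε with hΛ
  have hlog2 : 0.6931471803 < Real.log 2 := Real.log_two_gt_d9
  have hlog2' : Real.log 2 < 0.6931471808 := Real.log_two_lt_d9
  have hm0 : (0 : ℝ) < m := by exact_mod_cast (by omega : 0 < m)
  have hΛ1 : 1 ≤ Λ := by
    have h1 : Real.log 4 ≤ Real.log m := Real.log_le_log (by norm_num) (by exact_mod_cast hm)
    have h2 : Real.log 4 = 2 * Real.log 2 := by
      rw [show (4 : ℝ) = 2 ^ 2 by norm_num, Real.log_pow]; norm_num
    have h3 : Real.log ε < 0 := Real.log_neg hε0 hε1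
    linarith
  have hLlow : Λ ≤ L := by
    have h1 := Real.log_le_log hm0 hL2.le
    rw [Real.log_mul hε0.ne' (by positivity), Real.log_pow] at h1
    nlinarith [(Nat.cast_nonneg L : (0 : ℝ) ≤ L)]
  have hLup : (L : ℝ) ≤ 3 * Λ := by
    have h1 := Real.log_le_log (by positivity) (hL1 (L - 1) (by omega))
    rw [Real.log_mul hε0.ne' (by positivity), Real.log_pow, Nat.cast_sub hL] at h1
    have : ((L : ℝ) - 1) * Real.log 2 ≤ Λ := by push_cast at h1; linarith
    have hL' : (1 : ℝ) ≤ L := by exact_mod_cast hL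
    nlinarith
  refine ⟨c * L, s, t, ?_, hr, ?_, hout⟩
  · push_cast
    calc C₁ * Λ ≤ c * Λ := by gcongr
      _ ≤ c * L := by gcongr
  · have hn : 4 ≤ n := hm.trans hmn
    have hn1 : (1 : ℝ) ≤ n := by exact_mod_cast (by omega : 1 ≤ n)
    have hK1 : 8 * K ≤ n ^ (8 * K) := (Nat.lt_pow_self (by omega)).le
    have ht' : t ≤ n ^ (8 * K + 6 * (c * L)) := by
      have h1 : 1 ≤ (n * n) ^ (c * L) := Nat.one_le_pow _ _ (by nlinarith)
      have h2 : ((n * n) ^ (c * L) + 1) ^ 3 ≤ (2 * (n * n) ^ (c * L)) ^ 3 :=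
        Nat.pow_le_pow_left (by omega) _
      calc t ≤ K * (2 * (n * n) ^ (c * L)) ^ 3 := ht.trans (Nat.mul_le_mul_left K h2)
        _ = 8 * K * n ^ (6 * (c * L)) := by
          rw [← sq, mul_pow, ← pow_mul, ← pow_mul]; ring_nf
        _ ≤ n ^ (8 * K) * n ^ (6 * (c * L)) := Nat.mul_le_mul_right _ hK1
        _ = n ^ (8 * K + 6 * (c * L)) := (pow_add _ _ _).symm
    calc (t : ℝ) ≤ (n : ℝ) ^ (8 * K + 6 * (c * L)) := by exact_mod_cast ht'
      _ = (n : ℝ) ^ ((8 * K + 6 * (c * L) : ℕ) : ℝ) := (Real.rpow_natCast _ _).symm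
      _ ≤ (n : ℝ) ^ ((8 * K + 18 * c) * Λ) := by
        refine Real.rpow_le_rpow_of_exponent_le hn1 ?_
        push_cast
        have h1 : (8 * K : ℝ) ≤ 8 * K * Λ := le_mul_of_one_le_right (by positivity) hΛ1
        have h2 : (c : ℝ) * L ≤ c * (3 * Λ) := by gcongr
        linarith

end RealRAM

theorem mainTheorem3 (γ : ℝ) (hγ0 : 0 < γ) (hγ1 : γ < 1) :
    ∃ (δ η ω ρ β C : ℝ) (φ : Polynomial ℝ) (prog : RealRAM.Program),
      γ < δ ∧ δ < 1 ∧ 0 < η ∧ 1 < ω ∧ 0 < ρ ∧ 1 < β ∧ 0 < C ∧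
      -- the zero-free region of the multivariate partition function
      (∀ n m : ℕ, 2 ≤ m → ω * m ≤ n →
        ∀ Z : Matrix (Fin n) (Fin n) ℂ, Z.IsSymm →
          (∀ i j, i ≠ j → |(Z i j).re| ≤ δ / ((m : ℝ) - 1) ∧ |(Z i j).im| ≤ η / ((m : ℝ) - 1)) →
          DensePartition.P m Z ≠ 0) ∧
      -- the polynomial that maps the disc of radius `β` into the neighbourhood of `[0, 1]`
      φ.eval 0 = 0 ∧ φ.eval 1 = 1 ∧
      (∀ z : ℂ, ‖z‖ ≤ β → Polynomial.aeval z φ ∈ DensePartition.rect ρ) ∧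
      ∀ (n m : ℕ) (G : SimpleGraph (Fin n)), 4 ≤ m → ω * m ≤ n →
        -- the neighbourhood lies in the zero-free region
        (∀ z ∈ DensePartition.rect ρ,
          (∀ i j : Fin n, i ≠ j →
            |(Complex.log (1 + z * (DensePartition.w m G γ i j : ℂ))).re| ≤ δ / ((m : ℝ) - 1) ∧
            |(Complex.log (1 + z * (DensePartition.w m G γ i j : ℂ))).im| ≤ η / ((m : ℝ) - 1)) ∧
          DensePartition.h m G γ z ≠ 0) ∧
        -- accuracy of Taylor interpolation for the branch `f` of `ln h(φ(z))` with `f 0 = 0`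
        (∃ f : ℂ → ℂ, DifferentiableOn ℂ f (Metric.ball 0 β) ∧ f 0 = 0 ∧
          (∀ z ∈ Metric.ball (0 : ℂ) β,
            Complex.exp (f z) = DensePartition.h m G γ (Polynomial.aeval z φ)) ∧
          ∀ ε : ℝ, 0 < ε → ε < 1 → ∀ r : ℕ, C * (Real.log m - Real.log ε) ≤ r →
            ‖((γ * m / 2 : ℝ) : ℂ) + DensePartition.taylorAtOne f r -
              (Real.log (DensePartition.den m G γ) : ℂ)‖ ≤ ε) ∧
        -- the algorithm and its running time
        (∀ ε : ℝ, 0 < ε → ε < 1 →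
          ∃ (s : RealRAM.State) (t : ℕ),
            RealRAM.Runs prog (RealRAM.input m G γ ε) s t ∧
            (t : ℝ) ≤ (n : ℝ) ^ (C * (Real.log m - Real.log ε)) ∧
            |RealRAM.output s - Real.log (DensePartition.den m G γ)| ≤ ε) := by
  have hδ0 : 0 < (1 + γ) / 2 := by linarith
  have hδ1 : (1 + γ) / 2 < 1 := by linarith
  -- any `δ` strictly between `γ` and `1` will do
  obtain ⟨η, ω, hη, hω, hP⟩ := DensePartition.exists_zero_free_region hδ0 hδ1
  set δ := (1 + γ) / 2 with hδ
  have hγδ : γ < δ := by rw [hδ]; linarith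
  obtain ⟨ρ, hρ, hρδ, hρη⟩ : ∃ ρ : ℝ, 0 < ρ ∧ 12 * ρ ≤ δ - γ ∧ 12 * ρ ≤ η := by
    refine ⟨min ((δ - γ) / 12) (η / 12), lt_min (by linarith) (by linarith), ?_, ?_⟩
    · linarith [min_le_left ((δ - γ) / 12) (η / 12)]
    · linarith [min_le_right ((δ - γ) / 12) (η / 12)]
  have hadm : DensePartition.Admissible γ δ η ρ := ⟨hγ0, hγ1, hδ1, hρ, hρδ, hρη⟩
  obtain ⟨β, φq, hβ, hφ0, hφ1, hφ⟩ := DensePartition.exists_rat_polynomial_mapsTo_rect hρ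
  set φ : Polynomial ℝ := φq.map (algebraMap ℚ ℝ) with hφdef
  have hψ0 : φ.eval 0 = 0 := by
    rw [hφdef, Polynomial.eval_map_algebraMap]
    simpa [hφ0] using Polynomial.aeval_algebraMap_apply ℝ (0 : ℚ) φq
  have hψ1 : φ.eval 1 = 1 := by
    rw [hφdef, Polynomial.eval_map_algebraMap]
    simpa [hφ1] using Polynomial.aeval_algebraMap_apply ℝ (1 : ℚ) φq
  have hψ : ∀ z : ℂ, ‖z‖ ≤ β → Polynomial.aeval z φ ∈ DensePartition.rect ρ := by
    intro z hz
    rw [hφdef, Polynomial.aeval_map_algebraMap]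
    exact hφ z hz
  obtain ⟨K, hK, htaylor⟩ := DensePartition.exists_log_taylor_bound hβ hψ0 hψ1 hψ
  obtain ⟨C₁, hC₁, horder⟩ := DensePartition.exists_order_bound hK
    (show 1 < (1 + β) / 2 by linarith)
  obtain ⟨prog, C₂, hC₂, hprog⟩ := RealRAM.exists_program hφ0 C₁
  have hΛ : ∀ (m : ℕ) (ε : ℝ), 4 ≤ m → 0 < ε → ε < 1 → 0 ≤ Real.log m - Real.log ε := by
    intro m ε hm hε0 hε1
    have h1 : 0 ≤ Real.log m := Real.log_natCast_nonneg m
    have h2 : Real.log ε < 0 := Real.log_neg hε0 hε1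
    linarith
  refine ⟨δ, η, ω, ρ, β, max C₁ C₂, φ, prog, hγδ, hδ1, hη, hω, hρ, hβ, lt_max_of_lt_left hC₁,
    fun n m hm hmn Z hZ hZb => hP n m hm hmn Z ⟨hZ, hZb⟩, hψ0, hψ1, hψ, ?_⟩
  intro n m G hm hωmn
  have hm0 : (0 : ℝ) < m := by exact_mod_cast (by omega : 0 < m)
  have hmn : m ≤ n := by
    have : (m : ℝ) ≤ n := (le_mul_of_one_le_left hm0.le hω.le).trans hωmn
    exact_mod_cast this
  have hPm := hP n m (by omega) hωmn
  -- the function `h` serves the Taylor polynomials, the function `denFun` the program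
  refine ⟨fun z hz => ⟨fun i j _ => (DensePartition.log_weight_bounds hadm hm hz i j).2,
    DensePartition.h_ne_zero hadm hm hmn hPm hz⟩, ?_, ?_⟩
  · obtain ⟨f, hf, hf0, hfe, hfy⟩ := htaylor (DensePartition.h m G γ) m hm0
      DensePartition.differentiable_h (DensePartition.h_zero hmn)
      (fun z hz => DensePartition.h_ne_zero hadm hm hmn hPm hz)
      (fun z hz => DensePartition.norm_h_le hadm hm hmn hz)
      (fun x hx => DensePartition.h_pos_of_real hadm hm hmn x hx)
    refine ⟨f, hf, hf0, hfe, fun ε hε0 hε1 r hr => ?_⟩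
    have hr' : C₁ * (Real.log m - Real.log ε) ≤ r :=
      (mul_le_mul_of_nonneg_right (le_max_left _ _) (hΛ m ε hm hε0 hε1)).trans hr
    refine le_trans (le_of_eq ?_) ((hfy _ (DensePartition.h_one (by omega)) r).trans
      (horder m hm ε hε0 hε1 r hr'))
    rw [Real.log_mul (Real.exp_ne_zero _) (DensePartition.den_pos hmn).ne', Real.log_exp]
    congr 1
    push_cast
    ring
  · intro ε hε0 hε1
    obtain ⟨R, s, t, hR, hrun, ht, hout⟩ := hprog n m G γ ε hm hmn hε0 hε1
    obtain ⟨f, hf, hf0, hfe, hfy⟩ := htaylor (DensePartition.denFun m G γ) m hm0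
      DensePartition.differentiable_denFun (DensePartition.denFun_zero hmn)
      (fun z hz => DensePartition.denFun_ne_zero hadm hm hmn hPm hz)
      (fun z hz => DensePartition.norm_denFun_le hadm hm hmn hz)
      (fun x _ => DensePartition.denFun_pos_of_real hmn x)
    refine ⟨s, t, hrun, ht.trans ?_, ?_⟩
    · have hn1 : (1 : ℝ) ≤ n := by exact_mod_cast (by omega : 1 ≤ n)
      exact Real.rpow_le_rpow_of_exponent_le hn1
        (mul_le_mul_of_nonneg_right (le_max_right _ _) (hΛ m ε hm hε0 hε1))
    · have hF : Differentiable ℂ fun z : ℂ => DensePartition.denFun m G γ (Polynomial.aeval z φ) :=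
        DensePartition.differentiable_denFun.comp (Polynomial.differentiable_aeval φ)
      have hsum := DensePartition.taylorAtOne_eq_sum_logDerivCoeff hF (by linarith) hf hf0 hfe
        (fun k hk => DensePartition.iteratedDeriv_denFun_comp hψ0 hk) (R := R)
      have hbound := (hfy _ (DensePartition.denFun_one (by omega)) R).trans
        (horder m hm ε hε0 hε1 R hR)
      rw [hsum, ← hout, ← Complex.ofReal_sub, Complex.norm_real, Real.norm_eq_abs] at hbound
      exact hbound
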